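/- Let $\Bbbk$ be a commutative ring. Let $\mathcal A$ be a $\Bbbk$-linear monoidal category with finite direct sums, whose tensor product $\star$ is $\Bbbk$-bilinear on morphisms, and let $\mathcal M$ be a $\Bbbk$-linear category with finite direct sums which is an $(\mathcal A,\mathcal A)$ $\star$-bimodule category: it carries a left and a right action of $\mathcal A$, both written $\star$ and $\Bbbk$-bilinear on morphisms, with the usual coherent associativity and unit isomorphisms, and natural middle associativity isomorphisms $(X\star m)\star Y\cong X\star(m\star Y)$ satisfying the two pentagon equations. Write $K^b(-)$ for the homotopy category of bounded cochain complexes. The category $\mathcal A$ acts termwise on $K^b(\mathcal M)$ from both sides. The category $K^b(\mathcal A)$ acts on $K^b(\mathcal M)$ from both sides by total complexes, where the differential on $P^p\star Q^q$ is $d_P\star\mathrm{id}+(-1)^p\,\mathrm{id}\star d_Q$. If $\mathcal C$ acts on $\mathcal N$ from both sides, the objects of the Drinfeld centralizer $\mathcal Z(\mathcal C,\mathcal N)$ are the pairs $(Z,\tau)$ of an object $Z$ of $\mathcal N$ and a natural isomorphism $\tau_X\colon Z\star X\to X\star Z$ ($X\in\mathcal C$) such that, up to the associativity isomorphisms, $\tau_{X_1\star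 X_2}=(\mathrm{id}_{X_1}\star\tau_{X_2})\circ(\tau_{X_1}\star\mathrm{id}_{X_2})$ for all $X_1,X_2\in\mathcal C$. Let $Z\in K^b(\mathcal M)$ be such that for all objects $X_1,X_2$ of $\mathcal A$ the hom complex $\underline{\mathrm{Hom}}(Z\star X_1,X_2\star Z)$ has zero homology in every negative cohomological degree. Let $(Z,\tau)$ be an object of $\mathcal Z(\mathcal A,K^b(\mathcal M))$. An object $(Z,\boldsymbol\tau)$ of $\mathcal Z(K^b(\mathcal A),K^b(\mathcal M))$ is called a lift of $(Z,\tau)$ if 1. for every object $X$ of $\mathcal A$, placed in degree $0$, $\boldsymbol\tau_X=\tau_X$ under the canonical identifications; and 2. for every bounded complex $X$ over $\mathcal A$, the morphism $\boldsymbol\tau_X\colon Z\star X\to X\star Z$ is represented by a chain map which is filtered by the degree in $X$ and has the maps $\tau_{X^i}$ on its diagonal. That is, its components $Z^j\star X^i\to X^{i'}\star Z^{j'}$ vanish for $i'<i$, and for every $i$ there is a chain map $g_i\colon Z\star X^i\to X^i\star Z$ in the homotopy class $\tau_{X^i}$ such that the component $Z^j\star X^i\to X^i\star Z^j$ is $(-1)^{ij}(g_i)^j$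 for all $j$. Then $(Z,\tau)$ has exactly one lift $(Z,\boldsymbol\tau)\in\mathcal Z(K^b(\mathcal A),K^b(\mathcal M))$. -/

import Mathlib

open CategoryTheory Category Limits

namespace DrinfeldLifting

section FiniteSupport

variable {C D : Type*} {J : Type} [Category* C] [Category* D] [Preadditive C] [Preadditive D]

/-- A cofan with finitely many nonzero summands, equipped with projections satisfying the biproduct
relations, is a coproduct. -/
theorem nonempty_isColimit_of_projections {X : J → C} {P : C} (i : ∀ j, X j ⟶ P)
    (s : Finset J) (π : ∀ j, P ⟶ X j) (h_self : ∀ j ∈ s, i j ≫ π j = 𝟙 (X j))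
    (h_ne : ∀ j k, j ≠ k → i j ≫ π k = 0) (h_out : ∀ j, j ∉ s → IsZero (X j))
    (h_sum : ∑ j ∈ s, π j ≫ i j = 𝟙 P) : Nonempty (IsColimit (Cofan.mk P i)) := by
  classical
  refine ⟨Cofan.IsColimit.mk _ (fun t => ∑ j ∈ s, π j ≫ t.inj j) ?_ ?_⟩
  · intro t j
    change i j ≫ _ = _
    by_cases hj : j ∈ s
    · rw [Preadditive.comp_sum, Finset.sum_eq_single j]
      · rw [← Category.assoc, h_self j hj, Category.id_comp]
      · intro k _ hk
        rw [← Category.assoc, h_ne j k hk.symm, zero_comp]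
      · exact fun h => (h hj).elim
    · exact (h_out j hj).eq_of_src _ _
  · intro t m hm
    change P ⟶ t.pt at m
    change m = _
    rw [← Category.id_comp m, ← h_sum, Preadditive.sum_comp]
    refine Finset.sum_congr rfl fun j _ => ?_
    rw [Category.assoc, ← hm j]
    rfl

section

variable [HasFiniteBiproducts C] [DecidableEq J] (X : J → C) (s : Finset J)

/-- The inclusion of a summand in a finite biproduct, or zero. -/
noncomputable def finι (j : J) : X j ⟶ ⨁ fun j : s => X j :=
  if h : j ∈ s then biproduct.ι (fun j : s => X j) ⟨j, h⟩ else 0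

/-- The projection of a finite biproduct to a summand, or zero. -/
noncomputable def finπ (j : J) : (⨁ fun j : s => X j) ⟶ X j :=
  if h : j ∈ s then biproduct.π (fun j : s => X j) ⟨j, h⟩ else 0

theorem finι_finπ_self (j : J) (hj : j ∈ s) : finι X s j ≫ finπ X s j = 𝟙 (X j) := by
  rw [finι, finπ, dif_pos hj, dif_pos hj]
  exact biproduct.ι_π_self (fun j : s => X j) ⟨j, hj⟩

theorem finι_finπ_ne (i j : J) (hij : i ≠ j) : finι X s i ≫ finπ X s j = 0 := by
  rw [finι, finπ]
  by_cases hi : i ∈ s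
  · by_cases hj : j ∈ s
    · rw [dif_pos hi, dif_pos hj]
      exact biproduct.ι_π_ne (fun j : s => X j) (fun h => hij (congrArg Subtype.val h))
    · rw [dif_neg hj, comp_zero]
  · rw [dif_neg hi, zero_comp]

theorem finπ_finι_sum : ∑ j ∈ s, finπ X s j ≫ finι X s j = 𝟙 (⨁ fun j : s => X j) := by
  have h := biproduct.total (f := fun j : s => X j)
  rw [← h, ← Finset.sum_coe_sort]
  refine Finset.sum_congr rfl fun j _ => ?_
  rw [finι, finπ, dif_pos j.2, dif_pos j.2]

end

theorem hasCoproduct_of_finite_support [HasFiniteBiproducts C] (X : J → C) (s : Finset J)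
    (h : ∀ j, j ∉ s → IsZero (X j)) : HasCoproduct X := by
  classical
  obtain ⟨hc⟩ := nonempty_isColimit_of_projections (finι X s) s (finπ X s)
    (finι_finπ_self X s) (finι_finπ_ne X s) h (finπ_finι_sum X s)
  exact ⟨⟨_, hc⟩⟩

theorem preservesColimit_of_finite_support [HasFiniteBiproducts C] (X : J → C) (s : Finset J)
    (h : ∀ j, j ∉ s → IsZero (X j)) (F : C ⥤ D) [F.Additive] :
    PreservesColimit (Discrete.functor X) F := by
  classical
  obtain ⟨hc⟩ := nonempty_isColimit_of_projections (finι X s) s (finπ X s)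
    (finι_finπ_self X s) (finι_finπ_ne X s) h (finπ_finι_sum X s)
  obtain ⟨hc'⟩ := nonempty_isColimit_of_projections (fun j => F.map (finι X s j)) s
    (fun j => F.map (finπ X s j))
    (fun j hj => by rw [← F.map_comp, finι_finπ_self X s j hj, F.map_id])
    (fun i j hij => by rw [← F.map_comp, finι_finπ_ne X s i j hij, F.map_zero])
    (fun j hj => F.map_isZero (h j hj))
    (by
      simp only [← F.map_comp]
      rw [← F.map_sum, finπ_finι_sum, F.map_id])
  exact preservesColimit_of_preserves_colimit_cocone hc
    ((isColimitMapCoconeCofanMkEquiv F X _).symm hc')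

end FiniteSupport

section Bounded

variable (C : Type*) [Category* C] [Preadditive C]

/-- A cochain complex is bounded if all but finitely many of its terms are zero objects. -/
class IsBounded {C : Type*} [Category* C] [Preadditive C] (K : CochainComplex C ℤ) : Prop where
  exists_bounds : ∃ a b : ℤ, ∀ i : ℤ, i < a ∨ b < i → IsZero (K.X i)

/-- The category of bounded cochain complexes and chain maps. -/
abbrev Chb := ObjectProperty.FullSubcategory (fun K : CochainComplex C ℤ => IsBounded K)

instance {C : Type*} [Category* C] [Preadditive C] (K : Chb C) : IsBounded K.obj := K.property

/-- Two chain maps are related if there is a chain homotopy between them. -/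
def homotopyRel : HomRel (Chb C) := fun _ _ f g => Nonempty (Homotopy f.hom g.hom)

instance : Congruence (homotopyRel C) where
  equivalence :=
    { refl := fun f => ⟨Homotopy.refl f.hom⟩
      symm := fun ⟨h⟩ => ⟨h.symm⟩
      trans := fun ⟨h⟩ ⟨h'⟩ => ⟨h.trans h'⟩ }
  comp_left := fun f _ _ ⟨h⟩ => ⟨h.compLeft f.hom⟩
  comp_right := fun g ⟨h⟩ => ⟨h.compRight g.hom⟩

/-- The homotopy category of bounded cochain complexes: objects are bounded complexes and
morphisms are chain maps modulo chain homotopy. -/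
abbrev Kb := CategoryTheory.Quotient (homotopyRel C)

/-- The quotient functor from bounded complexes to the homotopy category. -/
abbrev Kb.quot : Chb C ⥤ Kb C := CategoryTheory.Quotient.functor (homotopyRel C)

end Bounded

section TotalComplex

open HomologicalComplex

variable {C₁ C₂ D : Type*} [Category* C₁] [Category* C₂] [Category* D]
  [Preadditive C₁] [Preadditive C₂] [Preadditive D]
  (F : C₁ ⥤ C₂ ⥤ D) [F.Additive] [∀ X, (F.obj X).Additive]

/-- For bounded complexes the family of the objects `F (K i) (L j)` with `i + j = n` is finitely
supported. -/
theorem exists_finite_support (K : CochainComplex C₁ ℤ) (L : CochainComplex C₂ ℤ) [IsBounded K]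
    [IsBounded L] (n : ℤ) : ∃ s : Finset ((fun p : ℤ × ℤ => p.1 + p.2) ⁻¹' {n}),
      ∀ p, p ∉ s → IsZero ((F.obj (K.X p.1.1)).obj (L.X p.1.2)) := by
  classical
  obtain ⟨a, b, hK⟩ := IsBounded.exists_bounds (K := K)
  obtain ⟨a', b', hL⟩ := IsBounded.exists_bounds (K := L)
  refine ⟨((Finset.Icc a b) ×ˢ (Finset.Icc a' b')).subtype _, ?_⟩
  rintro ⟨⟨i, j⟩, hp⟩ h
  simp only [Finset.mem_subtype, Finset.mem_product, Finset.mem_Icc] at h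
  by_cases hi : a ≤ i ∧ i ≤ b
  · have hj : j < a' ∨ b' < j := by omega
    exact (F.obj _).map_isZero (hL j hj)
  · exact (F.flip.obj _).map_isZero (hK i (by omega))

instance hasMapBifunctor [HasFiniteBiproducts D] (K : CochainComplex C₁ ℤ)
    (L : CochainComplex C₂ ℤ) [IsBounded K] [IsBounded L] :
    HasMapBifunctor K L F (.up ℤ) := fun n => by
  obtain ⟨s, hs⟩ := exists_finite_support F K L n
  exact hasCoproduct_of_finite_support _ s hs

instance isBounded_mapBifunctor [HasFiniteBiproducts D] (K : CochainComplex C₁ ℤ)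
    (L : CochainComplex C₂ ℤ) [IsBounded K] [IsBounded L] :
    IsBounded (mapBifunctor K L F (.up ℤ)) where
  exists_bounds := by
    obtain ⟨a, b, hK⟩ := IsBounded.exists_bounds (K := K)
    obtain ⟨a', b', hL⟩ := IsBounded.exists_bounds (K := L)
    refine ⟨a + a', b + b', fun n hn => ?_⟩
    rw [IsZero.iff_id_eq_zero]
    apply mapBifunctor.hom_ext
    intro i j h
    change i + j = n at h
    apply IsZero.eq_of_src
    by_cases hi : a ≤ i ∧ i ≤ b
    · exact (F.obj _).map_isZero (hL j (by omega))
    · exact (F.flip.obj _).map_isZero (hK i (by omega))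

/-- The bifunctor on bounded complexes induced by a biadditive bifunctor `F`: the value on `K`, `L`
is the total complex of the bicomplex `F (K i) (L j)`, with differential
`F (d_K) (id) + (-1) ^ i F (id) (d_L)`. -/
noncomputable def Chb.map₂ [HasFiniteBiproducts D] : Chb C₁ ⥤ Chb C₂ ⥤ Chb D where
  obj K :=
    { obj L := ⟨mapBifunctor K.obj L.obj F (.up ℤ), inferInstance⟩
      map g := ObjectProperty.homMk (mapBifunctorMap (𝟙 K.obj) g.hom F (.up ℤ))
      map_id L := by
        ext : 1
        apply HomologicalComplex.hom_ext
        intro n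
        apply mapBifunctor.hom_ext
        intro i j h
        simp
      map_comp f g := by
        ext : 1
        apply HomologicalComplex.hom_ext
        intro n
        apply mapBifunctor.hom_ext
        intro i j h
        simp }
  map {K K'} f :=
    { app L := ObjectProperty.homMk (mapBifunctorMap f.hom (𝟙 L.obj) F (.up ℤ))
      naturality L L' g := by
        ext : 1
        apply HomologicalComplex.hom_ext
        intro n
        apply mapBifunctor.hom_ext
        intro i j h
        simp }
  map_id K := by
    ext L : 3
    apply HomologicalComplex.hom_ext
    intro n
    apply mapBifunctor.hom_ext
    intro i j h
    simp
  map_comp f g := by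
    ext L : 3
    apply HomologicalComplex.hom_ext
    intro n
    apply mapBifunctor.hom_ext
    intro i j h
    simp

/-- The bifunctor on homotopy categories induced by a biadditive bifunctor. -/
noncomputable def Kb.map₂ [HasFiniteBiproducts D] : Kb C₁ ⥤ Kb C₂ ⥤ Kb D :=
  CategoryTheory.Quotient.lift _
    { obj K := CategoryTheory.Quotient.lift _ ((Chb.map₂ F).obj K ⋙ Kb.quot D) (by
        rintro L L' g g' ⟨h⟩
        exact CategoryTheory.Quotient.sound _ ⟨mapBifunctorMapHomotopy₂ (𝟙 K.obj) h F (.up ℤ)⟩)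
      map f := CategoryTheory.Quotient.natTransLift _
        (Functor.whiskerRight ((Chb.map₂ F).map f) (Kb.quot D))
      map_id K := by
        apply CategoryTheory.Quotient.natTrans_ext
        ext L
        change (Kb.quot D).map (((Chb.map₂ F).map (𝟙 K)).app L) = 𝟙 _
        rw [CategoryTheory.Functor.map_id, NatTrans.id_app, CategoryTheory.Functor.map_id]
      map_comp f g := by
        apply CategoryTheory.Quotient.natTrans_ext
        ext L
        change (Kb.quot D).map (((Chb.map₂ F).map (f ≫ g)).app L) =
          (Kb.quot D).map (((Chb.map₂ F).map f).app L) ≫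
            (Kb.quot D).map (((Chb.map₂ F).map g).app L)
        rw [Functor.map_comp, NatTrans.comp_app, Functor.map_comp] } (by
        rintro K K' f f' ⟨h⟩
        apply CategoryTheory.Quotient.natTrans_ext
        ext L
        exact CategoryTheory.Quotient.sound _ ⟨mapBifunctorMapHomotopy₁ h (𝟙 L.obj) F (.up ℤ)⟩)

/-- The projection of the total complex to the summand `F (K i) (L j)`. -/
noncomputable def mapBifunctorProj [HasFiniteBiproducts D] (K : CochainComplex C₁ ℤ)
    (L : CochainComplex C₂ ℤ) [IsBounded K] [IsBounded L] (i j n : ℤ) :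
    (mapBifunctor K L F (.up ℤ)).X n ⟶ (F.obj (K.X i)).obj (L.X j) :=
  mapBifunctorDesc (fun i' j' _ =>
    if h : i' = i ∧ j' = j then eqToHom (by rw [h.1, h.2]) else 0)

theorem ι_mapBifunctorProj_self [HasFiniteBiproducts D] (K : CochainComplex C₁ ℤ)
    (L : CochainComplex C₂ ℤ) [IsBounded K] [IsBounded L] (i j n : ℤ) (h : i + j = n) :
    ιMapBifunctor K L F (.up ℤ) i j n h ≫ mapBifunctorProj F K L i j n = 𝟙 _ := by
  rw [mapBifunctorProj, ι_mapBifunctorDesc, dif_pos ⟨rfl, rfl⟩, eqToHom_refl]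

theorem ι_mapBifunctorProj_ne [HasFiniteBiproducts D] (K : CochainComplex C₁ ℤ)
    (L : CochainComplex C₂ ℤ) [IsBounded K] [IsBounded L] (i j i' j' n : ℤ) (h : i + j = n)
    (hij : i ≠ i') :
    ιMapBifunctor K L F (.up ℤ) i j n h ≫ mapBifunctorProj F K L i' j' n = 0 := by
  rw [mapBifunctorProj, ι_mapBifunctorDesc, dif_neg fun h => hij h.1]

end TotalComplex

section Associator

open HomologicalComplex

variable {C₁ C₂ C₃ C₁₂ C₂₃ D : Type*} [Category* C₁] [Category* C₂] [Category* C₃]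
  [Category* C₁₂] [Category* C₂₃] [Category* D]
  [Preadditive C₁] [Preadditive C₂] [Preadditive C₃] [Preadditive C₁₂] [Preadditive C₂₃]
  [Preadditive D] [HasFiniteBiproducts C₁₂] [HasFiniteBiproducts C₂₃] [HasFiniteBiproducts D]
  {F₁₂ : C₁ ⥤ C₂ ⥤ C₁₂} {G : C₁₂ ⥤ C₃ ⥤ D} {F : C₁ ⥤ C₂₃ ⥤ D} {G₂₃ : C₂ ⥤ C₃ ⥤ C₂₃}
  [F₁₂.Additive] [∀ X, (F₁₂.obj X).Additive] [G.Additive] [∀ X, (G.obj X).Additive]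
  [F.Additive] [∀ X, (F.obj X).Additive] [G₂₃.Additive] [∀ X, (G₂₃.obj X).Additive]

instance hasGoodTrifunctor₁₂Obj (K : CochainComplex C₁ ℤ) (L : CochainComplex C₂ ℤ)
    (N : CochainComplex C₃ ℤ) [IsBounded K] [IsBounded L] :
    HasGoodTrifunctor₁₂Obj F₁₂ G K L N (.up ℤ) (.up ℤ) := fun n k => by
  obtain ⟨s, hs⟩ := exists_finite_support F₁₂ K L n
  have : (G.flip.obj (N.X k)).Additive := { }
  exact preservesColimit_of_finite_support _ s hs _

instance hasGoodTrifunctor₂₃Obj (K : CochainComplex C₁ ℤ) (L : CochainComplex C₂ ℤ)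
    (N : CochainComplex C₃ ℤ) [IsBounded L] [IsBounded N] :
    HasGoodTrifunctor₂₃Obj F G₂₃ K L N (.up ℤ) (.up ℤ) (.up ℤ) := fun k n => by
  obtain ⟨s, hs⟩ := exists_finite_support G₂₃ L N n
  exact preservesColimit_of_finite_support _ s hs _

/-- The associativity isomorphism of total complexes induced by an associativity isomorphism of
biadditive bifunctors; it is `α` on each summand. -/
noncomputable def Chb.assoc (α : bifunctorComp₁₂ F₁₂ G ≅ bifunctorComp₂₃ F G₂₃)
    (K : Chb C₁) (L : Chb C₂) (N : Chb C₃) :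
    ((Chb.map₂ G).obj (((Chb.map₂ F₁₂).obj K).obj L)).obj N ≅
      ((Chb.map₂ F).obj K).obj (((Chb.map₂ G₂₃).obj L).obj N) :=
  ObjectProperty.isoMk _ (mapBifunctorAssociator α K.obj L.obj N.obj (.up ℤ) (.up ℤ) (.up ℤ))

/-- The associativity isomorphism in the homotopy category. -/
noncomputable def Kb.assoc (α : bifunctorComp₁₂ F₁₂ G ≅ bifunctorComp₂₃ F G₂₃)
    (K : Kb C₁) (L : Kb C₂) (N : Kb C₃) :
    ((Kb.map₂ G).obj (((Kb.map₂ F₁₂).obj K).obj L)).obj N ≅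
      ((Kb.map₂ F).obj K).obj (((Kb.map₂ G₂₃).obj L).obj N) :=
  (Kb.quot D).mapIso (Chb.assoc α K.as L.as N.as)

end Associator

section Termwise

variable {C D : Type*} [Category* C] [Category* D] [Preadditive C] [Preadditive D]

instance isBounded_map (F : C ⥤ D) [F.Additive] (K : CochainComplex C ℤ) [IsBounded K] :
    IsBounded ((F.mapHomologicalComplex (.up ℤ)).obj K) where
  exists_bounds := by
    obtain ⟨a, b, h⟩ := IsBounded.exists_bounds (K := K)
    exact ⟨a, b, fun i hi => F.map_isZero (h i hi)⟩

/-- The termwise application of an additive functor to bounded complexes. -/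
def Chb.map (F : C ⥤ D) [F.Additive] : Chb C ⥤ Chb D where
  obj K := ⟨(F.mapHomologicalComplex (.up ℤ)).obj K.obj, inferInstance⟩
  map f := ObjectProperty.homMk ((F.mapHomologicalComplex (.up ℤ)).map f.hom)

/-- The termwise application of an additive functor, on homotopy categories. -/
def Kb.map (F : C ⥤ D) [F.Additive] : Kb C ⥤ Kb D :=
  CategoryTheory.Quotient.lift _ (Chb.map F ⋙ Kb.quot D) (by
    rintro K L f g ⟨h⟩
    exact CategoryTheory.Quotient.sound _ ⟨F.mapHomotopy h⟩)

/-- The termwise application of a natural transformation. -/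
def Chb.mapNatTrans {F G : C ⥤ D} [F.Additive] [G.Additive] (α : F ⟶ G) :
    Chb.map F ⟶ Chb.map G where
  app K := ObjectProperty.homMk ((NatTrans.mapHomologicalComplex α (.up ℤ)).app K.obj)
  naturality K L f := by
    ext : 1
    exact (NatTrans.mapHomologicalComplex α (.up ℤ)).naturality f.hom

/-- The termwise application of a natural transformation, on homotopy categories. -/
def Kb.mapNatTrans {F G : C ⥤ D} [F.Additive] [G.Additive] (α : F ⟶ G) :
    Kb.map F ⟶ Kb.map G :=
  CategoryTheory.Quotient.natTransLift _ (Functor.whiskerRight (Chb.mapNatTrans α) (Kb.quot D))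

/-- An isomorphism between complexes from a family of isomorphisms of their terms. -/
def Kb.isoOfComponents {K L : Chb C} (e : ∀ i, K.obj.X i ≅ L.obj.X i)
    (h : ∀ i j, (e i).hom ≫ L.obj.d i j = K.obj.d i j ≫ (e j).hom) :
    (Kb.quot C).obj K ≅ (Kb.quot C).obj L :=
  (Kb.quot C).mapIso (ObjectProperty.isoMk _
    (HomologicalComplex.Hom.isoOfComponents e (fun i j _ => h i j)))

/-- The object of `C` viewed as a complex concentrated in degree zero. -/
noncomputable def Chb.single (C : Type*) [Category* C] [Preadditive C] [HasZeroObject C] :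
    C ⥤ Chb C where
  obj X := ⟨(HomologicalComplex.single C (.up ℤ) 0).obj X, ⟨0, 0, fun i hi =>
    HomologicalComplex.isZero_single_obj_X _ _ _ _ (by omega)⟩⟩
  map f := ObjectProperty.homMk ((HomologicalComplex.single C (.up ℤ) 0).map f)

/-- The object of `C` viewed as an object of the homotopy category concentrated in degree zero. -/
noncomputable abbrev Kb.single (C : Type*) [Category* C] [Preadditive C] [HasZeroObject C] :
    C ⥤ Kb C := Chb.single C ⋙ Kb.quot C

end Termwise

section Comparison

open HomologicalComplex

variable {C₁ C₂ D : Type*} [Category* C₁] [Category* C₂] [Category* D]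
  [Preadditive C₁] [Preadditive C₂] [Preadditive D] [HasFiniteBiproducts D]
  (F : C₁ ⥤ C₂ ⥤ D) [F.Additive] [∀ X, (F.obj X).Additive]

instance isBounded_single {C : Type*} [Category* C] [Preadditive C] [HasZeroObject C] (X : C) :
    IsBounded ((HomologicalComplex.single C (.up ℤ) 0).obj X) := ((Chb.single C).obj X).property

/-- The identification of the terms if the first complex is concentrated in degree zero. -/
noncomputable def singleLeftIsoX [HasZeroObject C₁] (X : C₁) (K : CochainComplex C₂ ℤ)
    [IsBounded K] (n : ℤ) :
    (F.obj X).obj (K.X n) ≅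
      (mapBifunctor ((single C₁ (.up ℤ) 0).obj X) K F (.up ℤ)).X n where
  hom := (F.map (singleObjXSelf (.up ℤ) 0 X).inv).app (K.X n) ≫
    ιMapBifunctor ((single C₁ (.up ℤ) 0).obj X) K F (.up ℤ) 0 n n (zero_add n)
  inv := mapBifunctorDesc (fun i j h =>
    if hi : i = 0 then
      (F.map (singleObjXIsoOfEq (.up ℤ) 0 X i hi).hom).app (K.X j) ≫
        (F.obj X).map (K.XIsoOfEq (by change i + j = n at h; omega : j = n)).hom
    else 0)
  hom_inv_id := by
    rw [Category.assoc, ι_mapBifunctorDesc, dif_pos rfl, ← Category.assoc, ← NatTrans.comp_app,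
      ← F.map_comp]
    simp [singleObjXSelf]
  inv_hom_id := by
    apply mapBifunctor.hom_ext
    intro i j h
    rw [ι_mapBifunctorDesc_assoc]
    by_cases hi : i = 0
    · subst hi
      obtain rfl : j = n := by change 0 + j = n at h; omega
      rw [dif_pos rfl, Category.comp_id, Category.assoc]
      simp [singleObjXSelf, ← NatTrans.comp_app_assoc, ← F.map_comp]
    · exact ((F.flip.obj _).map_isZero (isZero_single_obj_X _ _ _ _ hi)).eq_of_src _ _

theorem singleLeftIsoX_comm [HasZeroObject C₁] (X : C₁) (K : CochainComplex C₂ ℤ)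
    [IsBounded K] (m n : ℤ) :
    (singleLeftIsoX F X K m).hom ≫
        (mapBifunctor ((single C₁ (.up ℤ) 0).obj X) K F (.up ℤ)).d m n =
      (F.obj X).map (K.d m n) ≫ (singleLeftIsoX F X K n).hom := by
  by_cases hmn : (ComplexShape.up ℤ).Rel m n
  · simp only [singleLeftIsoX, Category.assoc, mapBifunctor.d_eq, Preadditive.comp_add,
      mapBifunctor.ι_D₁, mapBifunctor.ι_D₂]
    rw [mapBifunctor.d₂_eq _ _ _ _ _ hmn _ (zero_add n),
      mapBifunctor.d₁_eq _ _ _ _ (i₁ := 0) (i₁' := 1) rfl _ _ (by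
        change m + 1 = n at hmn
        change 1 + m = n
        omega)]
    simp
  · simp only [shape _ _ _ hmn, comp_zero, Functor.map_zero, zero_comp]

/-- If the first complex is concentrated in degree zero, the total complex is obtained by
termwise application of `F.obj X`. -/
noncomputable def Chb.singleLeftIso [HasZeroObject C₁] (X : C₁) (K : Chb C₂) :
    ((Chb.map₂ F).obj ((Chb.single C₁).obj X)).obj K ≅ (Chb.map (F.obj X)).obj K :=
  ObjectProperty.isoMk _ (Iso.symm (Hom.isoOfComponents (fun n => singleLeftIsoX F X K.obj n)
    (fun m n _ => singleLeftIsoX_comm F X K.obj m n)))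

/-- The identification of the terms if the second complex is concentrated in degree zero. -/
noncomputable def singleRightIsoX [HasZeroObject C₂] (K : CochainComplex C₁ ℤ) [IsBounded K]
    (X : C₂) (n : ℤ) :
    (F.obj (K.X n)).obj X ≅
      (mapBifunctor K ((single C₂ (.up ℤ) 0).obj X) F (.up ℤ)).X n where
  hom := (F.obj (K.X n)).map (singleObjXSelf (.up ℤ) 0 X).inv ≫
    ιMapBifunctor K ((single C₂ (.up ℤ) 0).obj X) F (.up ℤ) n 0 n (add_zero n)
  inv := mapBifunctorDesc (fun i j h =>
    if hj : j = 0 then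
      (F.obj (K.X i)).map (singleObjXIsoOfEq (.up ℤ) 0 X j hj).hom ≫
        (F.map (K.XIsoOfEq (by change i + j = n at h; omega : i = n)).hom).app X
    else 0)
  hom_inv_id := by
    rw [Category.assoc, ι_mapBifunctorDesc, dif_pos rfl, ← Category.assoc, ← Functor.map_comp]
    simp [singleObjXSelf]
  inv_hom_id := by
    apply mapBifunctor.hom_ext
    intro i j h
    rw [ι_mapBifunctorDesc_assoc]
    by_cases hj : j = 0
    · subst hj
      obtain rfl : i = n := by change i + 0 = n at h; omega
      rw [dif_pos rfl, Category.comp_id, Category.assoc]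
      simp [singleObjXSelf, ← Functor.map_comp_assoc]
    · exact ((F.obj _).map_isZero (isZero_single_obj_X _ _ _ _ hj)).eq_of_src _ _

theorem singleRightIsoX_comm [HasZeroObject C₂] (K : CochainComplex C₁ ℤ) [IsBounded K]
    (X : C₂) (m n : ℤ) :
    (singleRightIsoX F K X m).hom ≫
        (mapBifunctor K ((single C₂ (.up ℤ) 0).obj X) F (.up ℤ)).d m n =
      (F.map (K.d m n)).app X ≫ (singleRightIsoX F K X n).hom := by
  by_cases hmn : (ComplexShape.up ℤ).Rel m n
  · simp only [singleRightIsoX, Category.assoc, mapBifunctor.d_eq, Preadditive.comp_add,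
      mapBifunctor.ι_D₁, mapBifunctor.ι_D₂]
    rw [mapBifunctor.d₁_eq _ _ _ _ hmn _ _ (add_zero n),
      mapBifunctor.d₂_eq _ _ _ _ _ (show (ComplexShape.up ℤ).Rel 0 1 from rfl) n
        (show ComplexShape.π (.up ℤ) (.up ℤ) (.up ℤ) (m, 1) = n from hmn)]
    simp
  · simp only [shape _ _ _ hmn, comp_zero, Functor.map_zero, zero_app, zero_comp]

instance additive_flip_obj (Y : C₂) : (F.flip.obj Y).Additive where

instance additive_flip : F.flip.Additive where

/-- If the second complex is concentrated in degree zero, the total complex is obtained by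
termwise application of `F.flip.obj X`. -/
noncomputable def Chb.singleRightIso [HasZeroObject C₂] (K : Chb C₁) (X : C₂) :
    ((Chb.map₂ F).obj K).obj ((Chb.single C₂).obj X) ≅ (Chb.map (F.flip.obj X)).obj K :=
  ObjectProperty.isoMk _ (Iso.symm (Hom.isoOfComponents (fun n => singleRightIsoX F K.obj X n)
    (fun m n _ => singleRightIsoX_comm F K.obj X m n)))

end Comparison

section Bimodule

open MonoidalCategory MonoidalLeftAction MonoidalRightAction

variable (A M : Type*) [Category* A] [Category* M]

/-- The middle associativity isomorphisms relating a left and a right action on a category. -/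
class MiddleAssocStruct [MonoidalCategoryStruct A] [MonoidalLeftActionStruct A M]
    [MonoidalRightActionStruct A M] where
  /-- The isomorphism `(X ⋆ m) ⋆ Y ≅ X ⋆ (m ⋆ Y)`. -/
  midAssoc (X : A) (m : M) (Y : A) : (X ⊙ₗ m) ⊙ᵣ Y ≅ X ⊙ₗ (m ⊙ᵣ Y)

open MiddleAssocStruct (midAssoc)

/-- A left and a right action of a monoidal category `A` on `M` form a bimodule category if they
come with natural middle associativity isomorphisms that satisfy the two pentagon equations. -/
class StarBimodule [MonoidalCategory A] [MonoidalLeftAction A M] [MonoidalRightAction A M]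
    extends MiddleAssocStruct A M where
  midAssoc_naturality_left {X X' : A} (f : X ⟶ X') (m : M) (Y : A) :
    (f ⊵ₗ m) ⊵ᵣ Y ≫ (midAssoc X' m Y).hom = (midAssoc X m Y).hom ≫ f ⊵ₗ (m ⊙ᵣ Y)
  midAssoc_naturality_middle (X : A) {m m' : M} (f : m ⟶ m') (Y : A) :
    (X ⊴ₗ f) ⊵ᵣ Y ≫ (midAssoc X m' Y).hom = (midAssoc X m Y).hom ≫ X ⊴ₗ (f ⊵ᵣ Y)
  midAssoc_naturality_right (X : A) (m : M) {Y Y' : A} (f : Y ⟶ Y') :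
    (X ⊙ₗ m) ⊴ᵣ f ≫ (midAssoc X m Y').hom = (midAssoc X m Y).hom ≫ X ⊴ₗ (m ⊴ᵣ f)
  /-- The pentagon for `((X ⊗ X') ⋆ m) ⋆ Y`. -/
  pentagon_left (X X' : A) (m : M) (Y : A) :
    (αₗ X X' m).hom ⊵ᵣ Y ≫ (midAssoc X (X' ⊙ₗ m) Y).hom ≫ X ⊴ₗ (midAssoc X' m Y).hom =
      (midAssoc (X ⊗ X') m Y).hom ≫ (αₗ X X' (m ⊙ᵣ Y)).hom
  /-- The pentagon for `(X ⋆ m) ⋆ (Y ⊗ Y')`. -/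
  pentagon_right (X : A) (m : M) (Y Y' : A) :
    (αᵣ (X ⊙ₗ m) Y Y').hom ≫ (midAssoc X m Y).hom ⊵ᵣ Y' ≫ (midAssoc X (m ⊙ᵣ Y) Y').hom =
      (midAssoc X m (Y ⊗ Y')).hom ≫ X ⊴ₗ (αᵣ m Y Y').hom

/-- The left and the right action are additive in each variable. -/
class BimodulePreadditive [Preadditive A] [Preadditive M] [MonoidalCategory A]
    [MonoidalLeftAction A M] [MonoidalRightAction A M] : Prop where
  actionLeft_add_left {X Y : A} (f g : X ⟶ Y) (m : M) : (f + g) ⊵ₗ m = f ⊵ₗ m + g ⊵ₗ m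
  actionLeft_add_right (X : A) {m n : M} (f g : m ⟶ n) : X ⊴ₗ (f + g) = X ⊴ₗ f + X ⊴ₗ g
  actionRight_add_left {m n : M} (f g : m ⟶ n) (X : A) : (f + g) ⊵ᵣ X = f ⊵ᵣ X + g ⊵ᵣ X
  actionRight_add_right (m : M) {X Y : A} (f g : X ⟶ Y) : m ⊴ᵣ (f + g) = m ⊴ᵣ f + m ⊴ᵣ g

/-- The left and the right action are compatible with scalars in each variable. -/
class BimoduleLinear (k : Type*) [CommRing k] [Preadditive A] [Preadditive M] [Linear k A]
    [Linear k M] [MonoidalCategory A] [MonoidalLeftAction A M] [MonoidalRightAction A M] :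
    Prop where
  actionLeft_smul_left (r : k) {X Y : A} (f : X ⟶ Y) (m : M) : (r • f) ⊵ₗ m = r • (f ⊵ₗ m)
  actionLeft_smul_right (r : k) (X : A) {m n : M} (f : m ⟶ n) : X ⊴ₗ (r • f) = r • (X ⊴ₗ f)
  actionRight_smul_left (r : k) {m n : M} (f : m ⟶ n) (X : A) : (r • f) ⊵ᵣ X = r • (f ⊵ᵣ X)
  actionRight_smul_right (r : k) (m : M) {X Y : A} (f : X ⟶ Y) : m ⊴ᵣ (r • f) = r • (m ⊴ᵣ f)

/-- The left action as a bifunctor `(X, m) ↦ X ⋆ m`. -/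
abbrev leftAct [MonoidalCategory A] [MonoidalLeftAction A M] : A ⥤ M ⥤ M :=
  MonoidalLeftAction.curriedAction A M

/-- The right action as a bifunctor `(m, X) ↦ m ⋆ X`. -/
abbrev rightAct [MonoidalCategory A] [MonoidalRightAction A M] : M ⥤ A ⥤ M :=
  (MonoidalRightAction.curriedAction A M).flip

section

variable [Preadditive A] [Preadditive M] [MonoidalCategory A]
  [MonoidalLeftAction A M] [MonoidalRightAction A M] [BimodulePreadditive A M]

instance : (leftAct A M).Additive where
  map_add := by
    intros
    ext
    exact BimodulePreadditive.actionLeft_add_left _ _ _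

instance (X : A) : ((leftAct A M).obj X).Additive where
  map_add := BimodulePreadditive.actionLeft_add_right _ _ _

instance : (rightAct A M).Additive where
  map_add := by
    intros
    ext
    exact BimodulePreadditive.actionRight_add_left _ _ _

instance (m : M) : ((rightAct A M).obj m).Additive where
  map_add := BimodulePreadditive.actionRight_add_right _ _ _

end

/-- The associativity isomorphism `(m ⋆ X) ⋆ Y ≅ m ⋆ (X ⊗ Y)` of the right action. -/
def rightAssocIso [MonoidalCategory A] [MonoidalRightAction A M] :
    bifunctorComp₁₂ (rightAct A M) (rightAct A M) ≅
      bifunctorComp₂₃ (rightAct A M) (curriedTensor A) :=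
  NatIso.ofComponents (fun m => NatIso.ofComponents (fun X => NatIso.ofComponents
    (fun Y => (αᵣ m X Y).symm)
    (fun {Y Y'} f => by
      change (m ⊙ᵣ X) ⊴ᵣ f ≫ (αᵣ m X Y').inv = (αᵣ m X Y).inv ≫ m ⊴ᵣ (X ◁ f)
      simp))
    (fun {X X'} f => by
      ext Y
      change (m ⊴ᵣ f) ⊵ᵣ Y ≫ (αᵣ m X' Y).inv = (αᵣ m X Y).inv ≫ m ⊴ᵣ (f ▷ Y)
      simp))
    (fun {m m'} f => by
      ext X Y
      change (f ⊵ᵣ X) ⊵ᵣ Y ≫ (αᵣ m' X Y).inv = (αᵣ m X Y).inv ≫ f ⊵ᵣ (X ⊗ Y)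
      simp)

/-- The middle associativity isomorphism `(X ⋆ m) ⋆ Y ≅ X ⋆ (m ⋆ Y)`. -/
def midAssocIso [MonoidalCategory A] [MonoidalLeftAction A M] [MonoidalRightAction A M]
    [StarBimodule A M] :
    bifunctorComp₁₂ (leftAct A M) (rightAct A M) ≅
      bifunctorComp₂₃ (leftAct A M) (rightAct A M) :=
  NatIso.ofComponents (fun X => NatIso.ofComponents (fun m => NatIso.ofComponents
    (fun Y => midAssoc X m Y)
    (fun f => StarBimodule.midAssoc_naturality_right X m f))
    (fun f => by ext Y; exact StarBimodule.midAssoc_naturality_middle X f Y))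
    (fun f => by ext m Y; exact StarBimodule.midAssoc_naturality_left f m Y)

end Bimodule

section HomotopyCategory

open MiddleAssocStruct (midAssoc)
open MonoidalCategory MonoidalLeftAction MonoidalRightAction

variable {A M : Type*} [Category* A] [Category* M] [Preadditive A] [Preadditive M]
  [HasFiniteBiproducts A] [HasFiniteBiproducts M] [MonoidalCategory A] [MonoidalPreadditive A]
  [MonoidalLeftAction A M] [MonoidalRightAction A M] [StarBimodule A M] [BimodulePreadditive A M]

/-- The tensor product of bounded complexes up to homotopy. -/
noncomputable instance Kb.monoidalCategoryStruct : MonoidalCategoryStruct (Kb A) where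
  tensorObj K L := ((Kb.map₂ (curriedTensor A)).obj K).obj L
  whiskerLeft K _ _ f := ((Kb.map₂ (curriedTensor A)).obj K).map f
  whiskerRight f L := ((Kb.map₂ (curriedTensor A)).map f).app L
  tensorUnit := (Kb.single A).obj (𝟙_ A)
  associator K L N := Kb.assoc (curriedAssociatorNatIso A) K L N
  leftUnitor K := (Kb.quot A).mapIso (Chb.singleLeftIso (curriedTensor A) (𝟙_ A) K.as) ≪≫
    Kb.isoOfComponents (fun i => λ_ (K.as.obj.X i)) (fun i j => by
      exact (leftUnitor_naturality (K.as.obj.d i j)).symm)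
  rightUnitor K := (Kb.quot A).mapIso (Chb.singleRightIso (curriedTensor A) K.as (𝟙_ A)) ≪≫
    Kb.isoOfComponents (fun i => ρ_ (K.as.obj.X i)) (fun i j => by
      exact (rightUnitor_naturality (K.as.obj.d i j)).symm)

/-- The left action of bounded complexes over `A` on bounded complexes over `M`. -/
noncomputable instance Kb.leftActionStruct : MonoidalLeftActionStruct (Kb A) (Kb M) where
  actionObj X Z := ((Kb.map₂ (leftAct A M)).obj X).obj Z
  actionHomLeft f Z := ((Kb.map₂ (leftAct A M)).map f).app Z
  actionHomRight X _ _ f := ((Kb.map₂ (leftAct A M)).obj X).map f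
  actionAssocIso X Y Z := Kb.assoc (MonoidalLeftAction.actionAssocNatIso A M) X Y Z
  actionUnitIso Z := (Kb.quot M).mapIso (Chb.singleLeftIso (leftAct A M) (𝟙_ A) Z.as) ≪≫
    Kb.isoOfComponents (fun i => λₗ (Z.as.obj.X i)) (fun i j => by
      exact actionUnitIso_hom_naturality (Z.as.obj.d i j))

/-- The right action of bounded complexes over `A` on bounded complexes over `M`. -/
noncomputable instance Kb.rightActionStruct : MonoidalRightActionStruct (Kb A) (Kb M) where
  actionObj Z X := ((Kb.map₂ (rightAct A M)).obj Z).obj X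
  actionHomLeft f X := ((Kb.map₂ (rightAct A M)).map f).app X
  actionHomRight Z _ _ f := ((Kb.map₂ (rightAct A M)).obj Z).map f
  actionAssocIso Z X Y := (Kb.assoc (rightAssocIso A M) Z X Y).symm
  actionUnitIso Z := (Kb.quot M).mapIso (Chb.singleRightIso (rightAct A M) Z.as (𝟙_ A)) ≪≫
    Kb.isoOfComponents (fun i => ρᵣ (Z.as.obj.X i)) (fun i j => by
      exact actionUnitIso_hom_naturality (Z.as.obj.d i j))

noncomputable instance Kb.middleAssocStruct : MiddleAssocStruct (Kb A) (Kb M) where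
  midAssoc X Z Y := Kb.assoc (midAssocIso A M) X Z Y

/-- The termwise left action of `A` on bounded complexes over `M`. -/
instance Kb.termwiseLeftActionStruct : MonoidalLeftActionStruct A (Kb M) where
  actionObj X Z := (Kb.map ((leftAct A M).obj X)).obj Z
  actionHomLeft f Z := (Kb.mapNatTrans ((leftAct A M).map f)).app Z
  actionHomRight X _ _ f := (Kb.map ((leftAct A M).obj X)).map f
  actionAssocIso X Y Z := Kb.isoOfComponents (fun i => αₗ X Y (Z.as.obj.X i)) (fun i j => by
    change _ ≫ X ⊴ₗ Y ⊴ₗ Z.as.obj.d i j = (X ⊗ Y) ⊴ₗ Z.as.obj.d i j ≫ _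
    simp)
  actionUnitIso Z := Kb.isoOfComponents (fun i => λₗ (Z.as.obj.X i)) (fun i j => by
    exact actionUnitIso_hom_naturality (Z.as.obj.d i j))

/-- The termwise right action of `A` on bounded complexes over `M`. -/
instance Kb.termwiseRightActionStruct : MonoidalRightActionStruct A (Kb M) where
  actionObj Z X := (Kb.map ((rightAct A M).flip.obj X)).obj Z
  actionHomLeft f X := (Kb.map ((rightAct A M).flip.obj X)).map f
  actionHomRight Z _ _ f := (Kb.mapNatTrans ((rightAct A M).flip.map f)).app Z
  actionAssocIso Z X Y := Kb.isoOfComponents (fun i => αᵣ (Z.as.obj.X i) X Y) (fun i j => by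
    change _ ≫ (Z.as.obj.d i j ⊵ᵣ X) ⊵ᵣ Y = Z.as.obj.d i j ⊵ᵣ (X ⊗ Y) ≫ _
    simp)
  actionUnitIso Z := Kb.isoOfComponents (fun i => ρᵣ (Z.as.obj.X i)) (fun i j => by
    exact actionUnitIso_hom_naturality (Z.as.obj.d i j))

instance Kb.termwiseMiddleAssocStruct : MiddleAssocStruct A (Kb M) where
  midAssoc X Z Y := Kb.isoOfComponents (fun i => midAssoc X (Z.as.obj.X i) Y) (fun i j => by
    exact (StarBimodule.midAssoc_naturality_middle X (Z.as.obj.d i j) Y).symm)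

end HomotopyCategory

section Centralizer

open MiddleAssocStruct (midAssoc)
open MonoidalCategory MonoidalLeftAction MonoidalRightAction

/-- A half-braiding on `Z`: a natural isomorphism `Z ⋆ X ≅ X ⋆ Z` in `X : A` which is
multiplicative. The objects of the Drinfeld centralizer of `A` in `M` are the pairs of an object
`Z` of `M` and a half-braiding on `Z`. -/
@[ext]
structure RelHalfBraiding (A : Type*) {M : Type*} [Category* A] [Category* M]
    [MonoidalCategoryStruct A] [MonoidalLeftActionStruct A M] [MonoidalRightActionStruct A M]
    [MiddleAssocStruct A M] (Z : M) where
  /-- The component at `X`. -/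
  β (X : A) : Z ⊙ᵣ X ≅ X ⊙ₗ Z
  naturality {X Y : A} (f : X ⟶ Y) : Z ⊴ᵣ f ≫ (β Y).hom = (β X).hom ≫ f ⊵ₗ Z
  /-- `β (X ⊗ Y) = (id_X ⋆ β Y) ∘ (β X ⋆ id_Y)` up to the associativity isomorphisms. -/
  multiplicativity (X Y : A) : (β (X ⊗ Y)).hom =
    (αᵣ Z X Y).hom ≫ (β X).hom ⊵ᵣ Y ≫ (midAssoc X Z Y).hom ≫ X ⊴ₗ (β Y).hom ≫ (αₗ X Y Z).inv

variable {A M : Type*} [Category* A] [Category* M] [Preadditive A] [Preadditive M]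
  [HasFiniteBiproducts A] [HasFiniteBiproducts M] [MonoidalCategory A] [MonoidalPreadditive A]
  [MonoidalLeftAction A M] [MonoidalRightAction A M] [StarBimodule A M] [BimodulePreadditive A M]

/-- The restriction of `T` to complexes concentrated in degree zero is `τ`. -/
def RestrictsTo {Z : Kb M} (T : RelHalfBraiding (Kb A) Z) (τ : RelHalfBraiding A Z) : Prop :=
  ∀ X : A, (T.β ((Kb.single A).obj X)).hom =
    (Kb.quot M).map (Chb.singleRightIso (rightAct A M) Z.as X).hom ≫ (τ.β X).hom ≫
      (Kb.quot M).map (Chb.singleLeftIso (leftAct A M) X Z.as).inv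

/-- The half-braiding `T` extends `τ` by filtered maps: for every bounded complex `X` the
isomorphism `T_X : Z ⋆ X ⟶ X ⋆ Z` is represented by a chain map `f` that does not lower the degree
in `X`, and whose component from `Z ⋆ X i` to `X i ⋆ Z` is, up to the sign `(-1) ^ (i * j)` on
`Z j ⋆ X i`, a chain map representing `τ_{X i}`. -/
def IsFilteredExtension {Z : Kb M} (T : RelHalfBraiding (Kb A) Z) (τ : RelHalfBraiding A Z) : Prop :=
  ∀ X : Chb A,
    ∃ (f : ((Chb.map₂ (rightAct A M)).obj Z.as).obj X ⟶ ((Chb.map₂ (leftAct A M)).obj X).obj Z.as)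
      (g : ∀ i : ℤ, (Chb.map ((rightAct A M).flip.obj (X.obj.X i))).obj Z.as ⟶
        (Chb.map ((leftAct A M).obj (X.obj.X i))).obj Z.as),
      (Kb.quot M).map f = (T.β ((Kb.quot A).obj X)).hom ∧
      (∀ i : ℤ, (Kb.quot M).map (g i) = (τ.β (X.obj.X i)).hom) ∧
      (∀ (j i i' j' n : ℤ) (h : j + i = n), i' + j' = n → i' < i →
        HomologicalComplex.ιMapBifunctor Z.as.obj X.obj (rightAct A M) (.up ℤ) j i n h ≫ f.hom.f n ≫
          mapBifunctorProj (leftAct A M) X.obj Z.as.obj i' j' n = 0) ∧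
      (∀ (j i n : ℤ) (h : j + i = n),
        HomologicalComplex.ιMapBifunctor Z.as.obj X.obj (rightAct A M) (.up ℤ) j i n h ≫ f.hom.f n ≫
          mapBifunctorProj (leftAct A M) X.obj Z.as.obj i j n =
        (i * j).negOnePow • (g i).hom.f j)

/-- The half-braiding `T` over the homotopy category of `A` is a lift of the half-braiding `τ`
over `A`. -/
structure IsLift {Z : Kb M} (T : RelHalfBraiding (Kb A) Z) (τ : RelHalfBraiding A Z) : Prop where
  restrictsTo : RestrictsTo T τ
  isFilteredExtension : IsFilteredExtension T τ

end Centralizer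

end DrinfeldLifting

open DrinfeldLifting MonoidalCategory MonoidalLeftAction MonoidalRightAction

/-! The argument is obstruction theory for a filtration. As a graded object, `Z ⋆ X` is the sum of
shifted copies of the complexes `Z ⋆ X^i`, and `X ⋆ Z` of the complexes `X^i ⋆ Z`. A cochain of
degree `n` between them is therefore a matrix whose `(i, j)` coefficient is a cochain `Z ⋆ X^i → X^j
⋆ Z` of degree `n - (j - i)`. Both differentials only raise the degree in `X` or act inside a
summand. So if the coefficients with `j - i < s` vanish, the differential acts on those with `j - i
= s`, up to sign, as the differential of the hom complexes from `Z ⋆ X^i` to `X^j ⋆ Z`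
(`Decomp.coeff_δ`). For a cocycle with `s > n` these leading coefficients are cocycles of negative
degree, hence coboundaries by hypothesis. Subtracting them raises `s`, and by boundedness this
stops: every cocycle of degree `n` that raises degrees by more than `n` is a coboundary of a cochain
raising degrees equally far (`Decomp.exists_δ_eq_of_raises`).

Two consequences carry the theorem. Uniqueness: two filtered chain maps with homotopic diagonals are
homotopic, because once the diagonal homotopies are subtracted the difference has degree `0` and
raises degrees by `1` (`Decomp.nonempty_homotopy_of_coeff`). Existence: the diagonal matrix of
representatives of `τ_{X^i}` fails to be a chain map only in the entries `i → i + 1`, where the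
defect is null-homotopic by naturality of `τ` at `d_X`. Subtracting the homotopies leaves a defect
of degree `1` that raises degrees by `2`, which can be removed as well
(`Decomp.exists_hom_of_coeff`).

All remaining properties reduce to uniqueness. Homotopy inverses, naturality in `X`, agreement with
`τ` on objects in degree `0`, and uniqueness of the lift each compare two filtered maps with
homotopic diagonals. For multiplicativity, `Z ⋆ (X ⊗ Y)` is decomposed by the pairs of degrees in
`X` and `Y` and filtered by their sum. The composite of the maps for `X` and `Y` has no coefficient
between distinct pairs of equal sum, since one of the two degrees would drop. For the map of `X ⊗ Y`
such coefficients are null-homotopic, by naturality of `τ` at the inclusion of `X^p ⊗ Y^q`. -/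

namespace DrinfeldLifting

set_option linter.unusedSectionVars false

open CochainComplex.HomComplex

/-! ### Cochains between decomposed complexes and the filtration by degree. -/

section Cochains

variable {M : Type*} [Category* M] [Preadditive M] {K L N P : CochainComplex M ℤ}

theorem comp_assoc_cochain {a b c ab bc abc : ℤ} (x : Cochain K L a) (y : Cochain L N b)
    (z : Cochain N P c) (h₁ : a + b = ab) (h₂ : ab + c = abc) (h₃ : b + c = bc) :
    (x.comp y h₁).comp z h₂ = x.comp (y.comp z h₃) (by lia) :=
  Cochain.comp_assoc _ _ _ _ _ (by lia)

theorem comp_sum_cochain {I : Type*} {a b c : ℤ} (s : Finset I) (x : Cochain K L a)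
    (y : I → Cochain L N b) (h : a + b = c) :
    x.comp (∑ i ∈ s, y i) h = ∑ i ∈ s, x.comp (y i) h :=
  map_sum (AddMonoidHom.mk' (fun y : Cochain L N b => x.comp y h) (fun _ _ => Cochain.comp_add _ _ _ _)) y s

theorem sum_comp_cochain {I : Type*} {a b c : ℤ} (s : Finset I) (x : I → Cochain K L a)
    (y : Cochain L N b) (h : a + b = c) :
    (∑ i ∈ s, x i).comp y h = ∑ i ∈ s, (x i).comp y h :=
  map_sum (AddMonoidHom.mk' (fun x : Cochain K L a => x.comp y h) (fun _ _ => Cochain.add_comp _ _ _ _)) x s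

theorem sum_v {I : Type*} {n : ℤ} (s : Finset I) (x : I → Cochain K L n) (p q : ℤ)
    (h : p + n = q) : (∑ i ∈ s, x i).v p q h = ∑ i ∈ s, (x i).v p q h :=
  map_sum (AddMonoidHom.mk' (fun x : Cochain K L n => x.v p q h) (fun _ _ => rfl)) x s

/-- A decomposition of the graded object underlying `T` into finitely many shifted summands. -/
structure Decomp {I : Type*} (deg : I → ℤ) (K : I → CochainComplex M ℤ)
    (T : CochainComplex M ℤ) where
  /-- The inclusion of a summand. -/
  ι (i : I) : Cochain (K i) T (deg i)
  /-- The projection to a summand. -/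
  π (i : I) : Cochain T (K i) (-deg i)
  /-- The summands that may be nonzero. -/
  supp : Finset I
  ι_π_self (i : I) {n : ℤ} (h : deg i + -deg i = n) (hn : n = 0) :
    (ι i).comp (π i) h = hn ▸ Cochain.ofHom (𝟙 (K i))
  ι_π_ne (i j : I) (hij : i ≠ j) {n : ℤ} (h : deg i + -deg j = n) : (ι i).comp (π j) h = 0
  total : ∑ i ∈ supp, (π i).comp (ι i) (neg_add_cancel _) = Cochain.ofHom (𝟙 T)

namespace Decomp

variable {I J : Type*} {deg : I → ℤ} {K : I → CochainComplex M ℤ} {T : CochainComplex M ℤ}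
  (D : Decomp deg K T) {deg' : J → ℤ} {K' : J → CochainComplex M ℤ} {T' : CochainComplex M ℤ}
  (D' : Decomp deg' K' T') {n m : ℤ}

theorem ι_π_comp_self (i : I) (x : Cochain (K i) L n) {a : ℤ} (h : -deg i + n = a)
    (h' : deg i + a = n) : (D.ι i).comp ((D.π i).comp x h) h' = x := by
  rw [← comp_assoc_cochain _ _ _ (add_neg_cancel _) (zero_add n), D.ι_π_self _ _ rfl,
    Cochain.id_comp]

theorem ι_π_comp_ne (i j : I) (hij : i ≠ j) (x : Cochain (K j) L n) {a b : ℤ}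
    (h : -deg j + n = a) (h' : deg i + a = b) : (D.ι i).comp ((D.π j).comp x h) h' = 0 := by
  rw [← comp_assoc_cochain _ _ _ rfl (by lia), D.ι_π_ne _ _ hij, Cochain.zero_comp]

theorem comp_ι_π_self (i : I) (x : Cochain L (K i) n) {a : ℤ} (h : n + deg i = a)
    (h' : a + -deg i = n) : (x.comp (D.ι i) h).comp (D.π i) h' = x := by
  rw [comp_assoc_cochain _ _ _ h h' (add_neg_cancel _), D.ι_π_self _ _ rfl,
    Cochain.comp_id]

theorem comp_ι_π_ne (i j : I) (hij : i ≠ j) (x : Cochain L (K i) n) {a b : ℤ}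
    (h : n + deg i = a) (h' : a + -deg j = b) : (x.comp (D.ι i) h).comp (D.π j) h' = 0 := by
  rw [comp_assoc_cochain _ _ _ h h' rfl, D.ι_π_ne _ _ hij, Cochain.comp_zero]

theorem eq_sum_comp_π_ι (z : Cochain L T n) :
    z = ∑ i ∈ D.supp, (z.comp (D.π i) rfl).comp (D.ι i) (by lia) := by
  conv_lhs => rw [← Cochain.comp_id z, ← D.total, comp_sum_cochain]
  exact Finset.sum_congr rfl fun i _ => (comp_assoc_cochain _ _ _ _ _ _).symm

theorem eq_sum_π_ι_comp (z : Cochain T L n) :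
    z = ∑ i ∈ D.supp, (D.π i).comp ((D.ι i).comp z rfl) (by lia) := by
  conv_lhs => rw [← Cochain.id_comp z, ← D.total, sum_comp_cochain]
  exact Finset.sum_congr rfl fun i _ => comp_assoc_cochain _ _ _ _ _ _

variable {D} in
theorem ext_ι {z z' : Cochain T L n} (h : ∀ i, (D.ι i).comp z rfl = (D.ι i).comp z' rfl) :
    z = z' := by
  rw [D.eq_sum_π_ι_comp z, D.eq_sum_π_ι_comp z']
  simp only [h]

variable {D} in
theorem ext_π {z z' : Cochain L T n}
    (h : ∀ i, z.comp (D.π i) rfl = z'.comp (D.π i) rfl) : z = z' := by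
  rw [D.eq_sum_comp_π_ι z, D.eq_sum_comp_π_ι z']
  simp only [h]

/-- For `i` outside `supp`, every term of `ι i ≫ ∑ π j ≫ ι j` vanishes, so `ι i = 0`; then `ι i ≫ π
i`, which is the identity, is zero too. -/
theorem id_eq_zero {i : I} (hi : i ∉ D.supp) : Cochain.ofHom (𝟙 (K i)) = 0 := by
  classical
  have h : D.ι i = 0 := by
    rw [D.eq_sum_comp_π_ι (D.ι i)]
    refine Finset.sum_eq_zero fun j hj => ?_
    rw [D.ι_π_ne i j (fun h => hi (h ▸ hj)), Cochain.zero_comp]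
  have h' := D.ι_π_self i (add_neg_cancel _) rfl
  rw [h, Cochain.zero_comp] at h'
  exact h'.symm

theorem eq_zero_of_notMem_left {i : I} (hi : i ∉ D.supp) (z : Cochain (K i) L n) : z = 0 := by
  rw [← Cochain.id_comp z, D.id_eq_zero hi, Cochain.zero_comp]

theorem eq_zero_of_notMem_right {i : I} (hi : i ∉ D.supp) (z : Cochain L (K i) n) : z = 0 := by
  rw [← Cochain.comp_id z, D.id_eq_zero hi, Cochain.comp_zero]

theorem exists_desc (H : ∀ i, Cochain (K i) L (deg i + n)) :
    ∃ z : Cochain T L n, ∀ i, (D.ι i).comp z rfl = H i := by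
  classical
  refine ⟨∑ i ∈ D.supp, (D.π i).comp (H i) (by lia), fun i => ?_⟩
  by_cases hi : i ∈ D.supp
  · rw [comp_sum_cochain, Finset.sum_eq_single_of_mem i hi fun j _ hj =>
      D.ι_π_comp_ne i j hj.symm _ _ _, D.ι_π_comp_self]
  · rw [D.eq_zero_of_notMem_left hi (H i), D.eq_zero_of_notMem_left hi (Cochain.comp _ _ _)]

theorem exists_lift (H : ∀ i, Cochain L (K i) (n + -deg i)) :
    ∃ z : Cochain L T n, ∀ i, z.comp (D.π i) rfl = H i := by
  classical
  refine ⟨∑ i ∈ D.supp, (H i).comp (D.ι i) (by lia), fun i => ?_⟩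
  by_cases hi : i ∈ D.supp
  · rw [sum_comp_cochain, Finset.sum_eq_single_of_mem i hi fun j _ hj =>
      D.comp_ι_π_ne j i hj _ _ _, D.comp_ι_π_self]
  · rw [D.eq_zero_of_notMem_right hi (H i), D.eq_zero_of_notMem_right hi (Cochain.comp _ _ _)]

/-- The matrix coefficients of a cochain between decomposed complexes. -/
def coeff (z : Cochain T T' n) (i : I) (j : J) (m : ℤ) (h : deg i + n = deg' j + m) :
    Cochain (K i) (K' j) m :=
  ((D.ι i).comp z rfl).comp (D'.π j) (by lia)

theorem coeff_eq (z : Cochain T T' n) (i : I) (j : J) (m : ℤ) (h : deg i + n = deg' j + m)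
    {k : ℤ} (hk : deg i + n = k) :
    D.coeff D' z i j m h = ((D.ι i).comp z hk).comp (D'.π j) (by lia) := by
  subst hk
  rfl

variable {D D'} in
theorem coeff_ext {z z' : Cochain T T' n}
    (h : ∀ i j m hm, D.coeff D' z i j m hm = D.coeff D' z' i j m hm) : z = z' :=
  ext_ι (D := D) fun i => ext_π (D := D') fun j => h i j _ (by lia)

/-- Matrices can be prescribed freely: entries outside the two supports are cochains from or to a
contractible (indeed zero) summand. This is how the correction terms are assembled. -/
theorem exists_of_coeff (c : ∀ i j m, deg i + n = deg' j + m → Cochain (K i) (K' j) m) :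
    ∃ z : Cochain T T' n, ∀ i j m hm, D.coeff D' z i j m hm = c i j m hm := by
  choose x hx using fun i => D'.exists_lift (n := deg i + n)
    (fun j => c i j (deg i + n + -deg' j) (by lia))
  obtain ⟨z, hz⟩ := D.exists_desc x
  refine ⟨z, fun i j m hm => ?_⟩
  obtain rfl : deg i + n + -deg' j = m := by lia
  rw [coeff, hz, hx]

theorem coeff_sub (z z' : Cochain T T' n) (i : I) (j : J) (m : ℤ)
    (h : deg i + n = deg' j + m) :
    D.coeff D' (z - z') i j m h = D.coeff D' z i j m h - D.coeff D' z' i j m h := by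
  rw [coeff, Cochain.comp_sub, Cochain.sub_comp]; rfl

theorem coeff_zero (i : I) (j : J) (m : ℤ) (h : deg i + n = deg' j + m) :
    D.coeff D' (0 : Cochain T T' n) i j m h = 0 := by
  rw [coeff, Cochain.comp_zero, Cochain.zero_comp]

/-- The differential of `T` raises the degree of the summands. -/
def Filtered : Prop :=
  ∀ i j m (h : deg i + 1 + -deg j = m), deg j ≤ deg i →
    (δ (deg i) (deg i + 1) (D.ι i)).comp (D.π j) h = 0

/-- The cochain `z` raises the degree of the summands by at least `s`. -/
def Raises (s : ℤ) (z : Cochain T T' n) : Prop :=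
  ∀ i j m (h : deg i + n = deg' j + m), deg' j < deg i + s → D.coeff D' z i j m h = 0

variable {D D'}

/-- The composite of `ι i` and `π j` is an identity or zero, hence closed, so the Leibniz rule turns
the condition on `δ (ι i)` into one on `δ (π j)`. -/
theorem Filtered.ι_comp_δ_π (hD : D.Filtered) (i j : I) {a : ℤ} (hij : deg j ≤ deg i)
    {m : ℤ} (ha : -deg j + 1 = a) (h : deg i + a = m) :
    (D.ι i).comp (δ (-deg j) a (D.π j)) h = 0 := by
  have h₁ := δ_comp (D.ι i) (D.π j) rfl (deg i + 1) a m (by lia) rfl ha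
  have h₂ : δ (deg i + -deg j) m ((D.ι i).comp (D.π j) rfl) = 0 := by
    by_cases hne : i = j
    · subst hne
      -- The degree is generalised because `deg i + -deg i` is `0` only propositionally.
      have : ∀ (k : ℤ) (hk : deg i + -deg i = k), δ k m ((D.ι i).comp (D.π i) hk) = 0 := by
        intro k hk
        obtain rfl : k = 0 := by lia
        rw [D.ι_π_self i _ rfl, δ_ofHom]
      exact this _ _
    · rw [D.ι_π_ne i j hne, δ_zero]
  rw [h₂, hD i j m _ hij, smul_zero, add_zero] at h₁
  exact h₁.symm

/-- The differential on the associated graded. The Leibniz rule for `ι i ≫ z ≫ π j` produces error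
terms with `δ (ι i)` and `δ (π j)`. Expanded over an intermediate summand `k`, each product contains
either a coefficient of `z` that raises degrees by less than `s`, or a part of the differential of
`T` or `T'` that does not raise degrees; both are zero. The sign comes from moving `δ` past `π j`,
of degree `-deg' j`. -/
theorem coeff_δ (hD : D.Filtered) (hD' : D'.Filtered) {s n₁ : ℤ} {z : Cochain T T' n}
    (hz : D.Raises D' s z) (hn : n + 1 = n₁) (i : I) (j : J) {m m₁ : ℤ} (hm : m + 1 = m₁)
    (h : deg i + n₁ = deg' j + m₁) (hij : deg' j ≤ deg i + s) :
    D.coeff D' (δ n n₁ z) i j m₁ h =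
      (deg' j).negOnePow • δ m m₁ (D.coeff D' z i j m (by lia)) := by
  have h₁ := δ_comp ((D.ι i).comp z rfl) (D'.π j) (show _ = m by lia) (deg i + n₁)
    (-deg' j + 1) m₁ hm (by lia) rfl
  have h₂ := δ_comp (D.ι i) z rfl (deg i + 1) n₁ (deg i + n₁) (by lia) rfl hn
  have h₃ : ((D.ι i).comp z rfl).comp (δ (-deg' j) (-deg' j + 1) (D'.π j))
      (show _ = m₁ by lia) = 0 := by
    rw [D'.eq_sum_comp_π_ι ((D.ι i).comp z rfl), sum_comp_cochain]
    refine Finset.sum_eq_zero fun k _ => ?_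
    by_cases hk : deg' k < deg i + s
    · rw [show ((D.ι i).comp z rfl).comp (D'.π k) rfl = 0 from
        hz i k (deg i + n + -deg' k) (by lia) hk]
      simp
    · rw [comp_assoc_cochain _ _ _ _ _ rfl, hD'.ι_comp_δ_π k j (by lia) rfl, Cochain.comp_zero]
  have h₄ : ((δ (deg i) (deg i + 1) (D.ι i)).comp z
      (show _ = deg i + n₁ by lia)).comp (D'.π j) (show _ = m₁ by lia) = 0 := by
    rw [comp_assoc_cochain _ _ _ _ _ rfl, D.eq_sum_comp_π_ι (δ (deg i) (deg i + 1) (D.ι i)),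
      sum_comp_cochain]
    refine Finset.sum_eq_zero fun k _ => ?_
    by_cases hk : deg k ≤ deg i
    · rw [hD i k _ rfl hk]
      simp
    · rw [comp_assoc_cochain _ _ _ _ _ (show deg k + (n + -deg' j) = n + deg k - deg' j by lia),
        ← comp_assoc_cochain (D.ι k) z _ rfl (by lia)]
      have : ((D.ι k).comp z rfl).comp (D'.π j) (show _ = n + deg k - deg' j by lia) = 0 :=
        hz k j _ (by lia) (by lia)
      rw [this, Cochain.comp_zero]
  rw [coeff, coeff, h₁, h₃, zero_add, Int.negOnePow_neg, h₂, Cochain.add_comp, Cochain.units_smul_comp,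
    h₄, smul_zero, add_zero, smul_smul, Int.units_mul_self, one_smul]

theorem Raises.mono {s t : ℤ} (hst : s ≤ t) {z : Cochain T T' n} (hz : D.Raises D' t z) :
    D.Raises D' s z :=
  fun i j m h hij => hz i j m h (by lia)

theorem Raises.sub {s : ℤ} {z z' : Cochain T T' n} (hz : D.Raises D' s z)
    (hz' : D.Raises D' s z') : D.Raises D' s (z - z') := fun i j m h hij => by
  rw [coeff_sub, hz i j m h hij, hz' i j m h hij, sub_zero]

variable (D D') in
theorem exists_raises_eq_zero (n : ℤ) :
    ∃ s : ℤ, ∀ z : Cochain T T' n, D.Raises D' s z → z = 0 := by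
  obtain ⟨a, ha⟩ := (D.supp.image deg).bddBelow
  obtain ⟨b, hb⟩ := (D'.supp.image deg').bddAbove
  -- No jump between a summand in `D.supp` and one in `D'.supp` exceeds `b - a`.
  refine ⟨b - a + 1, fun z hz => coeff_ext (D := D) (D' := D') fun i j m hm => ?_⟩
  rw [coeff_zero]
  by_cases hi : i ∈ D.supp
  · by_cases hj : j ∈ D'.supp
    · have h₁ : a ≤ deg i := ha (by exact_mod_cast Finset.mem_image_of_mem deg hi)
      have h₂ : deg' j ≤ b := hb (by exact_mod_cast Finset.mem_image_of_mem deg' hj)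
      exact hz i j m hm (by lia)
    · exact D'.eq_zero_of_notMem_right hj _
  · exact D.eq_zero_of_notMem_left hi _

/-- A cocycle that raises degrees by `s` and whose leading coefficients are coboundaries is
cohomologous to a cocycle that raises degrees by `s + 1`. -/
theorem exists_raises_sub_δ (hD : D.Filtered) (hD' : D'.Filtered) {s n₀ : ℤ} {z : Cochain T T' n}
    (hz : D.Raises D' s z) (hn : n₀ + 1 = n)
    (hc : ∀ i j m m₀ (h : deg i + n = deg' j + m), deg' j = deg i + s → m₀ + 1 = m →
      ∃ y : Cochain (K i) (K' j) m₀, δ m₀ m y = D.coeff D' z i j m h) :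
    ∃ y : Cochain T T' n₀, D.Raises D' s y ∧ D.Raises D' (s + 1) (z - δ n₀ n y) := by
  choose y hy using hc
  -- The primitives are placed exactly on the entries of jump `s`, with the sign that cancels the
  -- one in `coeff_δ`.
  obtain ⟨x, hx⟩ := D.exists_of_coeff D' (n := n₀) (fun i j m h =>
    if hij : deg' j = deg i + s then
      (deg' j).negOnePow • y i j (m + 1) m (by lia) hij rfl else 0)
  have hxs : D.Raises D' s x := fun i j m h hij => by rw [hx, dif_neg (by lia)]
  refine ⟨x, hxs, fun i j m h hij => ?_⟩
  obtain ⟨m, rfl⟩ : ∃ k, m = k + 1 := ⟨m - 1, by lia⟩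
  rw [coeff_sub, coeff_δ hD hD' hxs hn i j rfl h (by lia), hx]
  split_ifs with hij'
  · rw [δ_units_smul, smul_smul, Int.units_mul_self, one_smul, sub_eq_zero]
    exact (hy i j (m + 1) m h hij' rfl).symm
  · rw [hz i j _ h (by lia), δ_zero, smul_zero, sub_zero]

theorem coeff_cocycle (hD : D.Filtered) (hD' : D'.Filtered) {s n₁ : ℤ} {z : Cochain T T' n}
    (hz : D.Raises D' s z) (hn : n + 1 = n₁) (hz' : CochainComplex.HomComplex.δ n n₁ z = 0)
    (i : I) (j : J) {m m₁ : ℤ} (hm : m + 1 = m₁)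
    (h : deg i + n = deg' j + m) (hij : deg' j ≤ deg i + s) :
    CochainComplex.HomComplex.δ m m₁ (D.coeff D' z i j m h) = 0 := by
  have := coeff_δ hD hD' hz hn i j hm (by lia) hij
  rw [hz', coeff_zero] at this
  have h' := congrArg (fun x => (deg' j).negOnePow • x) this
  simpa [smul_smul] using h'.symm

end Decomp

/-- The hom complex from `K` to `L` has no cohomology in negative degrees. -/
def NegVanish (K L : CochainComplex M ℤ) : Prop :=
  ∀ (n n₀ : ℤ), n < 0 → n₀ + 1 = n → ∀ z : Cochain K L n, δ n (n + 1) z = 0 →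
    ∃ y : Cochain K L n₀, δ n₀ n y = z

namespace Decomp

variable {I J : Type*} {deg : I → ℤ} {K : I → CochainComplex M ℤ} {T : CochainComplex M ℤ}
  {D : Decomp deg K T} {deg' : J → ℤ} {K' : J → CochainComplex M ℤ} {T' : CochainComplex M ℤ}
  {D' : Decomp deg' K' T'} {n : ℤ}

/-- The leading coefficients lie in degree `n - s < 0`, where hom complexes have no cohomology, so
they can be removed one filtration step at a time; finite supports end the process. -/
theorem exists_δ_eq_of_raises (hD : D.Filtered) (hD' : D'.Filtered)
    (hV : ∀ i j, NegVanish (K i) (K' j)) {s n₀ : ℤ} (hs : n < s) {z : Cochain T T' n}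
    (hz : D.Raises D' s z) (hn : n₀ + 1 = n) (hz' : δ n (n + 1) z = 0) :
    ∃ y : Cochain T T' n₀, D.Raises D' s y ∧ δ n₀ n y = z := by
  obtain ⟨N, hN⟩ := D.exists_raises_eq_zero D' n
  -- `k` bounds the number of filtration steps left before the bound `N` forces the cocycle to
  -- vanish.
  obtain ⟨k, hk⟩ : ∃ k : ℕ, N ≤ s + k := ⟨(N - s).toNat, by lia⟩
  induction k generalizing s z with
  | zero => exact ⟨0, fun i j m h _ => coeff_zero .., by
      rw [hN z (hz.mono (by simpa using hk)), δ_zero]⟩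
  | succ k ih =>
    obtain ⟨x, hx, hxz⟩ := exists_raises_sub_δ hD hD' hz hn (fun i j m m₀ h hij hm =>
      hV i j m m₀ (by lia) hm _ (coeff_cocycle hD hD' hz rfl hz' i j rfl h hij.le))
    obtain ⟨y, hy, hyz⟩ := ih (s := s + 1) (by lia) hxz (by rw [δ_sub, hz', δ_δ, sub_zero])
      (by push_cast at hk; lia)
    refine ⟨y + x, ?_, by rw [δ_add, hyz, sub_add_cancel]⟩
    rw [← sub_neg_eq_add]
    refine (hy.mono (by lia)).sub fun i j m h hij => ?_
    rw [← zero_sub, coeff_sub, coeff_zero, hx i j m h hij, sub_zero]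

end Decomp

end Cochains


/-! ### Existence, uniqueness and invertibility of filtered chain maps up to homotopy. -/

section Homotopies

variable {M : Type*} [Category* M] [Preadditive M]

section

variable {K L N P : CochainComplex M ℤ}

theorem nonempty_homotopy_iff (f g : K ⟶ L) :
    Nonempty (Homotopy f g) ↔
      ∃ y : Cochain K L (-1), δ (-1) 0 y = Cochain.ofHom f - Cochain.ofHom g := by
  rw [(Cochain.equivHomotopy f g).nonempty_congr, nonempty_subtype]
  simp only [eq_sub_iff_add_eq, eq_comm]

theorem δ_comp_hom {n m : ℤ} (y : Cochain K L n) (f : L ⟶ N) (h : n + 1 = m) :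
    δ n m (y.comp (Cochain.ofHom f) (add_zero n)) =
      (δ n m y).comp (Cochain.ofHom f) (add_zero m) := by
  rw [δ_comp_zero_cochain _ _ _ h, δ_ofHom, Cochain.comp_zero, zero_add]

theorem δ_hom_comp {n m : ℤ} (f : K ⟶ L) (y : Cochain L N n) (h : n + 1 = m) :
    δ n m ((Cochain.ofHom f).comp y (zero_add n)) =
      (Cochain.ofHom f).comp (δ n m y) (zero_add m) := by
  rw [δ_zero_cochain_comp _ _ _ h, δ_ofHom, Cochain.zero_comp, smul_zero, add_zero]

/-- If `δ x = f ≫ g - 1`, then for a cocycle `z` the Leibniz rule gives `δ (x ≫ z) = (-1) ^ n (f ≫ g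
≫ z - z)`, which dictates the sign of the witness. -/
theorem exists_δ_eq_self_sub_hom_comp {f : K ⟶ L} {g : L ⟶ K} (h : Homotopy (f ≫ g) (𝟙 K))
    {n n₀ : ℤ} (hn : n₀ + 1 = n) (z : Cochain K N n) (hz : δ n (n + 1) z = 0) :
    ∃ y : Cochain K N n₀, δ n₀ n y =
      z - (Cochain.ofHom f).comp ((Cochain.ofHom g).comp z (zero_add n)) (zero_add n) := by
  obtain ⟨x, hx⟩ := (nonempty_homotopy_iff _ _).1 ⟨h⟩
  refine ⟨-n.negOnePow • x.comp z (by lia), ?_⟩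
  rw [δ_units_smul, δ_comp x z (by lia) 0 (n + 1) n hn (by lia) rfl, hz, Cochain.comp_zero, zero_add,
    smul_smul, hx, neg_mul, Int.units_mul_self, Cochain.sub_comp, Cochain.id_comp,
    Cochain.ofHom_comp, comp_assoc_cochain _ _ _ _ _ (zero_add n), Units.neg_smul, one_smul,
    neg_sub]

theorem exists_δ_eq_self_sub_comp_hom {f : L ⟶ N} {g : N ⟶ L} (h : Homotopy (f ≫ g) (𝟙 L))
    {n n₀ : ℤ} (hn : n₀ + 1 = n) (z : Cochain K L n) (hz : δ n (n + 1) z = 0) :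
    ∃ y : Cochain K L n₀, δ n₀ n y =
      z - (z.comp (Cochain.ofHom f) (add_zero n)).comp (Cochain.ofHom g) (add_zero n) := by
  obtain ⟨x, hx⟩ := (nonempty_homotopy_iff _ _).1 ⟨h⟩
  refine ⟨-z.comp x (by lia), ?_⟩
  rw [δ_neg, δ_comp z x (by lia) (n + 1) 0 n hn rfl (by lia), hz, Cochain.zero_comp, smul_zero,
    add_zero, hx, Cochain.comp_sub, Cochain.comp_id,
    Cochain.ofHom_comp, ← comp_assoc_cochain _ _ _ (add_zero n) (add_zero n), neg_sub]

/-- A cocycle is transported along the equivalence, bounded there, and transported back, up to the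
coboundary of the previous lemmas. Vanishing is assumed only for maps from `Z ⋆ X₁` to `X₂ ⋆ Z`;
this lemma and the next extend it to the other directions, which homotopy inverses require. -/
theorem NegVanish.of_homotopyEquiv_left (h : NegVanish L N) (e : HomotopyEquiv K L) :
    NegVanish K N := by
  intro n n₀ hn h₀ z hz
  obtain ⟨y, hy⟩ := h n n₀ hn h₀ ((Cochain.ofHom e.inv).comp z (zero_add n))
    (by rw [δ_hom_comp _ _ rfl, hz, Cochain.comp_zero])
  obtain ⟨x, hx⟩ := exists_δ_eq_self_sub_hom_comp e.homotopyHomInvId h₀ z hz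
  refine ⟨x + (Cochain.ofHom e.hom).comp y (zero_add _), ?_⟩
  rw [δ_add, hx, δ_hom_comp _ _ h₀, hy, sub_add_cancel]

theorem NegVanish.of_homotopyEquiv_right (h : NegVanish K N) (e : HomotopyEquiv L N) :
    NegVanish K L := by
  intro n n₀ hn h₀ z hz
  obtain ⟨y, hy⟩ := h n n₀ hn h₀ (z.comp (Cochain.ofHom e.hom) (add_zero n))
    (by rw [δ_comp_hom _ _ rfl, hz, Cochain.zero_comp])
  obtain ⟨x, hx⟩ := exists_δ_eq_self_sub_comp_hom e.homotopyHomInvId h₀ z hz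
  refine ⟨x + y.comp (Cochain.ofHom e.inv) (add_zero _), ?_⟩
  rw [δ_add, hx, δ_comp_hom _ _ h₀, hy, sub_add_cancel]

theorem negVanish_of_isZero_homology
    (h : ∀ n : ℤ, n < 0 → IsZero ((CochainComplex.HomComplex K L).homology n)) :
    NegVanish K L := by
  intro n n₀ hn h₀ z hz
  have h' := (CochainComplex.HomComplex K L).exactAt_iff_isZero_homology n |>.2 (h n hn)
  rw [HomologicalComplex.exactAt_iff' _ n₀ n (n + 1) (by simp; lia) (by simp),
    ShortComplex.ab_exact_iff] at h'
  exact h' z hz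

end

namespace Decomp

section

variable {I J : Type*} {deg : I → ℤ} {K : I → CochainComplex M ℤ} {T : CochainComplex M ℤ}
  {D : Decomp deg K T} {deg' : J → ℤ} {K' : J → CochainComplex M ℤ} {T' : CochainComplex M ℤ}
  {D' : Decomp deg' K' T'} {n : ℤ}

/-- The uniqueness principle. Homotopies on the coefficients of jump `0` reduce the difference to a
cocycle of degree `0` that raises degrees by `1`, and such a cocycle is a coboundary. -/
theorem nonempty_homotopy_of_coeff (hD : D.Filtered) (hD' : D'.Filtered)
    (hV : ∀ i j, NegVanish (K i) (K' j)) (f g : T ⟶ T')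
    (h : D.Raises D' 0 (Cochain.ofHom f - Cochain.ofHom g))
    (hc : ∀ i j (hij : deg i + 0 = deg' j + 0), ∃ y : Cochain (K i) (K' j) (-1),
      δ (-1) 0 y = D.coeff D' (Cochain.ofHom f - Cochain.ofHom g) i j 0 hij) :
    Nonempty (Homotopy f g) := by
  rw [nonempty_homotopy_iff]
  obtain ⟨x, _, hxz⟩ := exists_raises_sub_δ (n₀ := -1) hD hD' h rfl (fun i j m m₀ h hij hm => by
    obtain rfl : m = 0 := by lia
    obtain rfl : m₀ = -1 := by lia
    exact hc i j h)
  obtain ⟨y, _, hy⟩ := exists_δ_eq_of_raises (n₀ := -1) hD hD' hV (by lia) hxz rfl (by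
    rw [δ_sub, δ_δ, δ_sub, δ_ofHom, δ_ofHom, sub_self, sub_zero])
  exact ⟨y + x, by rw [δ_add, hy, sub_add_cancel]⟩

end

variable {B B' B'' : ℤ → CochainComplex M ℤ} {T T' T'' : CochainComplex M ℤ}

/-- The differential of `T` maps the summand of degree `i` to itself and, by `b i`, to the
summand of degree `i + 1`. -/
def HasEdges (D : Decomp (fun i : ℤ => i) B T) (b : ∀ i, B i ⟶ B (i + 1)) : Prop :=
  ∀ i, δ i (i + 1) (D.ι i) = (Cochain.ofHom (b i)).comp (D.ι (i + 1)) (zero_add _)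

variable {D : Decomp (fun i : ℤ => i) B T} {D' : Decomp (fun i : ℤ => i) B' T'}
  {D'' : Decomp (fun i : ℤ => i) B'' T''}
  {b : ∀ i, B i ⟶ B (i + 1)} {b' : ∀ i, B' i ⟶ B' (i + 1)}

theorem HasEdges.filtered (hD : D.HasEdges b) : D.Filtered := by
  intro i j m h hij
  rw [hD i]
  exact D.comp_ι_π_ne (i + 1) j (by lia) _ (zero_add (i + 1)) h

/-- The existence principle: a diagonal that commutes with the edges up to homotopy extends to a
filtered chain map. The corrections raise degrees by at least `1`, so the diagonal is attained
exactly and not merely up to homotopy. -/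
theorem exists_hom_of_coeff (hD : D.HasEdges b) (hD' : D'.HasEdges b')
    (hV : ∀ i j, NegVanish (B i) (B' j)) (g : ∀ i, B i ⟶ B' i)
    (hg : ∀ i, Nonempty (Homotopy (g i ≫ b' i) (b i ≫ g (i + 1)))) :
    ∃ f : T ⟶ T', D.Raises D' 0 (Cochain.ofHom f) ∧
      ∀ i, D.coeff D' (Cochain.ofHom f) i i 0 rfl = Cochain.ofHom (g i) := by
  obtain ⟨z, hz⟩ := D.exists_desc (n := 0)
    (fun i => (Cochain.ofHom (g i)).comp (D'.ι i) (by lia))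
  have hz₀ : D.Raises D' 0 z := fun i j m h hij => by
    rw [coeff, hz]
    exact D'.comp_ι_π_ne i j (by lia) _ _ _
  -- The defect of the diagonal matrix sits in the entries `i → i + 1` only, where it is the failure
  -- of `g` to commute with the edges.
  have hδ : ∀ i, (D.ι i).comp (δ 0 1 z) rfl =
      (Cochain.ofHom (g i ≫ b' i) - Cochain.ofHom (b i ≫ g (i + 1))).comp
        (D'.ι (i + 1)) (zero_add _) := fun i => by
    have h₁ := δ_comp (D.ι i) z (add_zero i) (i + 1) 1 (i + 1) rfl rfl rfl
    have h₂ : ∀ (i k : ℤ) (hk : i + 0 = k), (D.ι i).comp z hk =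
        (Cochain.ofHom (g i)).comp (D'.ι i) (by lia) := by
      rintro i k rfl
      exact hz i
    rw [h₂ i, δ_hom_comp _ _ rfl, hD' i, hD i, Int.negOnePow_zero, one_smul,
      comp_assoc_cochain _ _ _ _ _ (add_zero (i + 1)), h₂ (i + 1)] at h₁
    rw [Cochain.sub_comp, Cochain.ofHom_comp, Cochain.ofHom_comp,
      comp_assoc_cochain _ _ _ _ _ (zero_add (i + 1)),
      comp_assoc_cochain _ _ _ _ _ (zero_add (i + 1)), h₁, add_sub_cancel_right]
  have hδ₁ : D.Raises D' 1 (δ 0 1 z) := fun i j m h hij => by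
    rw [coeff, hδ]
    exact D'.comp_ι_π_ne (i + 1) j (by lia) _ _ _
  -- A coefficient of jump `1` of a cochain of degree `1` has degree `0`, just outside the reach of
  -- `NegVanish`; here the given homotopies supply the primitives.
  obtain ⟨x, hx, hxz⟩ := exists_raises_sub_δ (n₀ := 0) hD.filtered hD'.filtered hδ₁ rfl
    (fun i j m m₀ h hij hm => by
      obtain rfl : j = i + 1 := hij
      obtain rfl : m = 0 := by lia
      obtain rfl : m₀ = -1 := by lia
      obtain ⟨y, hy⟩ := (nonempty_homotopy_iff _ _).1 (hg i)
      refine ⟨y, ?_⟩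
      rw [hy, coeff, hδ]
      exact (D'.comp_ι_π_self (i + 1) _ _ _).symm)
  -- The remaining defect has degree `1` and raises degrees by `2`, so the general vanishing
  -- applies.
  obtain ⟨y, hy, hyz⟩ := exists_δ_eq_of_raises (n₀ := 0) hD.filtered hD'.filtered hV
    (show (1 : ℤ) < 1 + 1 by lia) hxz rfl (by rw [δ_sub, δ_δ, δ_δ, sub_zero])
  have hy₁ := hy.mono (show (1 : ℤ) ≤ 1 + 1 by lia)
  have hw := (hz₀.sub (hx.mono (show (0 : ℤ) ≤ 1 by lia))).sub (hy₁.mono (show (0 : ℤ) ≤ 1 by lia))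
  let w : Cocycle T T' 0 := Cocycle.mk (z - x - y) 1 rfl (by rw [δ_sub, δ_sub, hyz, sub_self])
  have hw' : Cochain.ofHom w.homOf = z - x - y := Cocycle.cochain_ofHom_homOf_eq_coe w
  refine ⟨w.homOf, by rwa [hw'], fun i => ?_⟩
  rw [hw', coeff_sub, coeff_sub, hx i i 0 rfl (by lia), hy₁ i i 0 rfl (by lia), sub_zero,
    sub_zero, coeff, hz]
  exact D'.comp_ι_π_self i _ _ _

theorem coeff_comp {I J L : Type*} {deg : I → ℤ} {K : I → CochainComplex M ℤ}
    {D : Decomp deg K T} {deg' : J → ℤ} {K' : J → CochainComplex M ℤ} {D' : Decomp deg' K' T'}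
    {deg'' : L → ℤ} {K'' : L → CochainComplex M ℤ} {D'' : Decomp deg'' K'' T''}
    (z : Cochain T T' 0) (z' : Cochain T' T'' 0) (i : I) (j : L) {m : ℤ}
    (h : deg i + 0 = deg'' j + m) :
    D.coeff D'' (z.comp z' (add_zero 0)) i j m h = ∑ k ∈ D'.supp,
      (D.coeff D' z i k (deg i - deg' k) (by lia)).comp
        (D'.coeff D'' z' k j (deg' k - deg'' j) (by lia)) (by lia) := by
  rw [coeff, ← comp_assoc_cochain (D.ι i) z z' rfl (by lia)]
  have := congrArg (fun x => (x.comp z' (add_zero (deg i + 0))).comp (D''.π j) (show _ = m by lia))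
    (D'.eq_sum_comp_π_ι ((D.ι i).comp z rfl))
  refine this.trans ?_
  rw [sum_comp_cochain, sum_comp_cochain]
  refine Finset.sum_congr rfl fun k _ => ?_
  rw [coeff_eq _ _ z' _ _ _ _ (add_zero _),
    comp_assoc_cochain _ (D'.ι k) _ _ _ (add_zero _),
    comp_assoc_cochain _ _ (D''.π j) _ _ (show _ = deg' k - deg'' j by lia)]
  -- Only the bookkeeping of degrees differs: `deg i + 0 + -deg' k` against `deg i - deg' k`.
  have : ∀ (a : ℤ) (ha : deg i + 0 + -deg' k = a) (hb : a + (deg' k - deg'' j) = m),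
      (((D.ι i).comp z rfl).comp (D'.π k) rfl).comp (((D'.ι k).comp z' (add_zero _)).comp (D''.π j)
        (show _ = deg' k - deg'' j by lia)) (show _ = m by lia) =
      (((D.ι i).comp z rfl).comp (D'.π k) ha).comp (((D'.ι k).comp z' (add_zero _)).comp (D''.π j)
        (by lia)) hb := by
    rintro a rfl hb
    rfl
  exact this _ _ _

theorem Raises.comp_zero {z : Cochain T T' 0} {z' : Cochain T' T'' 0} (hz : D.Raises D' 0 z)
    (hz' : D'.Raises D'' 0 z') : D.Raises D'' 0 (z.comp z' (add_zero 0)) := by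
  intro i j m h hij
  rw [coeff_comp (D' := D')]
  refine Finset.sum_eq_zero fun k _ => ?_
  by_cases hk : k < i + 0
  · rw [hz i k _ _ hk, Cochain.zero_comp]
  · rw [hz' k j _ _ (by lia), Cochain.comp_zero]

/-- Triangular matrices: a path `i → k → i` with `k ≠ i` contains a step that lowers the degree, so
only `k = i` contributes. -/
theorem coeff_comp_self {z : Cochain T T' 0} {z' : Cochain T' T'' 0} (hz : D.Raises D' 0 z)
    (hz' : D'.Raises D'' 0 z') (i : ℤ) :
    D.coeff D'' (z.comp z' (add_zero 0)) i i 0 rfl =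
      (D.coeff D' z i i 0 rfl).comp (D'.coeff D'' z' i i 0 rfl) (add_zero 0) := by
  rw [coeff_comp (D' := D')]
  have key : ∀ (a b : ℤ) (ha : i + 0 = i + a) (hb : i + 0 = i + b) (hab : a + b = 0),
      (D.coeff D' z i i a ha).comp (D'.coeff D'' z' i i b hb) hab =
      (D.coeff D' z i i 0 rfl).comp (D'.coeff D'' z' i i 0 rfl) (add_zero 0) := by
    intro a b ha hb hab
    obtain rfl : a = 0 := by lia
    obtain rfl : b = 0 := by lia
    rfl
  by_cases hi : i ∈ D'.supp
  · rw [Finset.sum_eq_single_of_mem i hi, key]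
    intro k _ hk
    by_cases hk' : k < i
    · rw [hz i k _ _ (by lia), Cochain.zero_comp]
    · rw [hz' k i _ _ (by lia), Cochain.comp_zero]
  · rw [D'.eq_zero_of_notMem_right hi (D.coeff D' z i i 0 rfl), Cochain.zero_comp]
    refine Finset.sum_eq_zero fun k hk' => ?_
    rcases lt_or_ge k i with hk | hk
    · rw [hz i k _ _ (by lia), Cochain.zero_comp]
    · rw [hz' k i _ _ (by have : k ≠ i := fun h => hi (h ▸ hk'); lia), Cochain.comp_zero]

theorem coeff_id_self (i : ℤ) :
    D.coeff D (Cochain.ofHom (𝟙 T)) i i 0 rfl = Cochain.ofHom (𝟙 (B i)) := by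
  rw [coeff_eq _ _ _ _ _ _ _ (add_zero _), Cochain.comp_id]
  exact D.ι_π_self i _ rfl

theorem raises_id : D.Raises D 0 (Cochain.ofHom (𝟙 T)) := by
  intro i j m h hij
  rw [coeff_eq _ _ _ _ _ _ _ (add_zero _), Cochain.comp_id]
  exact D.ι_π_ne i j (by lia) _

/-- A chain map that raises degrees and is a homotopy equivalence on each summand has a left
homotopy inverse with the same properties. -/
theorem nonempty_homotopyEquiv (hD : D.HasEdges b) (hD' : D'.HasEdges b')
    (hV : ∀ i j, NegVanish (B i) (B' j)) (g : ∀ i, HomotopyEquiv (B i) (B' i))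
    (hg : ∀ i, Nonempty (Homotopy ((g i).hom ≫ b' i) (b i ≫ (g (i + 1)).hom)))
    (f : T ⟶ T') (hf : D.Raises D' 0 (Cochain.ofHom f))
    (hfg : ∀ i, D.coeff D' (Cochain.ofHom f) i i 0 rfl = Cochain.ofHom (g i).hom) :
    ∃ f' : T' ⟶ T, Nonempty (Homotopy (f ≫ f') (𝟙 T)) ∧ Nonempty (Homotopy (f' ≫ f) (𝟙 T')) := by
  -- Exchanging both sides along the equivalences `g` gives the vanishing needed to construct a map
  -- in the opposite direction.
  have hV' : ∀ i j, NegVanish (B' i) (B j) := fun i j =>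
    ((hV i j).of_homotopyEquiv_left (g i).symm).of_homotopyEquiv_right (g j)
  -- The inverses commute with the edges up to homotopy: `g⁻¹ b ∼ g⁻¹ b g g⁻¹ ∼ g⁻¹ g b' g⁻¹ ∼ b'
  -- g⁻¹`, composition being written from left to right.
  obtain ⟨f', hf', hfg'⟩ := exists_hom_of_coeff hD' hD hV' (fun i => (g i).inv) (fun i => by
    obtain ⟨h⟩ := hg i
    have h₁ := ((h.compRight (g (i + 1)).inv).compLeft (g i).inv).symm
    have h₂ := (((g (i + 1)).homotopyHomInvId.compLeft (b i)).compLeft (g i).inv).symm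
    have h₃ := ((g i).homotopyInvHomId.compRight (b' i)).compRight (g (i + 1)).inv
    simp only [assoc, comp_id, id_comp] at h₁ h₂ h₃
    exact ⟨h₂.trans (h₁.trans h₃)⟩)
  -- Each composite is filtered with diagonal homotopic to the identity, so the uniqueness principle
  -- compares it with the identity.
  refine ⟨f', nonempty_homotopy_of_coeff hD.filtered hD.filtered
    (fun i j => (hV i j).of_homotopyEquiv_right (g j)) _ _ ?_ ?_,
    nonempty_homotopy_of_coeff hD'.filtered hD'.filtered
    (fun i j => (hV i j).of_homotopyEquiv_left (g i).symm) _ _ ?_ ?_⟩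
  · rw [Cochain.ofHom_comp]
    exact (hf.comp_zero hf').sub raises_id
  · intro i j hij
    obtain rfl : i = j := by lia
    rw [Cochain.ofHom_comp, coeff_sub, coeff_comp_self hf hf', hfg, hfg', coeff_id_self,
      ← Cochain.ofHom_comp, ← nonempty_homotopy_iff]
    exact ⟨(g i).homotopyHomInvId⟩
  · rw [Cochain.ofHom_comp]
    exact (hf'.comp_zero hf).sub raises_id
  · intro i j hij
    obtain rfl : i = j := by lia
    rw [Cochain.ofHom_comp, coeff_sub, coeff_comp_self hf' hf, hfg, hfg', coeff_id_self,
      ← Cochain.ofHom_comp, ← nonempty_homotopy_iff]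
    exact ⟨(g i).homotopyInvHomId⟩

end Decomp

end Homotopies


/-! ### Total complexes decomposed by the degree in one factor. -/

section TotalDecomp

open HomologicalComplex

variable {C₁ C₂ D : Type*} [Category* C₁] [Category* C₂] [Category* D]
  [Preadditive C₁] [Preadditive C₂] [Preadditive D] [HasFiniteBiproducts D]
  (F : C₁ ⥤ C₂ ⥤ D) [F.Additive] [∀ X, (F.obj X).Additive]
  (K : CochainComplex C₁ ℤ) (L : CochainComplex C₂ ℤ) [IsBounded K] [IsBounded L]

/-- The complex with terms `F (X) (L j)`. -/
abbrev mapLeft (X : C₁) (L : CochainComplex C₂ ℤ) : CochainComplex D ℤ where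
  X j := (F.obj X).obj (L.X j)
  d i j := (F.obj X).map (L.d i j)
  shape i j h := by rw [L.shape _ _ h, Functor.map_zero]
  d_comp_d' i j k _ _ := by rw [← Functor.map_comp, L.d_comp_d, Functor.map_zero]

/-- The complex with terms `F (K j) (X)`. -/
abbrev mapRight (K : CochainComplex C₁ ℤ) (X : C₂) : CochainComplex D ℤ where
  X j := (F.obj (K.X j)).obj X
  d i j := (F.map (K.d i j)).app X
  shape i j h := by rw [K.shape _ _ h, Functor.map_zero, zero_app]
  d_comp_d' i j k _ _ := by
    rw [← NatTrans.comp_app, ← Functor.map_comp, K.d_comp_d, Functor.map_zero, zero_app]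

/-- The functoriality of `mapLeft`. -/
@[simps]
def mapLeftHom {X X' : C₁} (f : X ⟶ X') {L L' : CochainComplex C₂ ℤ} (g : L ⟶ L') :
    mapLeft F X L ⟶ mapLeft F X' L' where
  f j := (F.map f).app (L.X j) ≫ (F.obj X').map (g.f j)
  comm' i j _ := by simp [← Functor.map_comp]

/-- The functoriality of `mapRight`. -/
@[simps]
def mapRightHom {K K' : CochainComplex C₁ ℤ} (f : K ⟶ K') {X X' : C₂} (g : X ⟶ X') :
    mapRight F K X ⟶ mapRight F K' X' where
  f j := (F.map (f.f j)).app X ≫ (F.obj (K'.X j)).map g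
  comm' i j _ := by
    simp only [assoc, NatTrans.naturality]
    simp only [← NatTrans.comp_app_assoc, ← Functor.map_comp, f.comm]

/-- The inclusion of the summands `F (K i) (L j)`, for fixed `i`, in the total complex. -/
noncomputable def ιLeft (i : ℤ) : Cochain (mapLeft F (K.X i) L) (mapBifunctor K L F (.up ℤ)) i :=
  Cochain.mk fun p q h => ιMapBifunctor K L F (.up ℤ) i p q (by change i + p = q; lia)

/-- The inclusion of the summands `F (K i) (L j)`, for fixed `j`, in the total complex, with
the sign that makes it compatible with the differentials. -/
noncomputable def ιRight (j : ℤ) : Cochain (mapRight F K (L.X j)) (mapBifunctor K L F (.up ℤ)) j :=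
  Cochain.mk fun p q h => (j * p).negOnePow • ιMapBifunctor K L F (.up ℤ) p j q h

/-- The projection to the summands `F (K i) (L j)` for fixed `i`. -/
noncomputable def πLeft (i : ℤ) :
    Cochain (mapBifunctor K L F (.up ℤ)) (mapLeft F (K.X i) L) (-i) :=
  Cochain.mk fun p q _ => mapBifunctorProj F K L i q p

/-- The projection to the summands `F (K i) (L j)` for fixed `j`, with signs. -/
noncomputable def πRight (j : ℤ) :
    Cochain (mapBifunctor K L F (.up ℤ)) (mapRight F K (L.X j)) (-j) :=
  Cochain.mk fun p q _ => (j * q).negOnePow • mapBifunctorProj F K L q j p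

theorem ι_mapBifunctorProj_ne_right (i j i' j' n : ℤ) (h : i + j = n) (hij : j ≠ j') :
    ιMapBifunctor K L F (.up ℤ) i j n h ≫ mapBifunctorProj F K L i' j' n = 0 := by
  rw [mapBifunctorProj, ι_mapBifunctorDesc, dif_neg fun h => hij h.2]

/-- The decomposition of a total complex by the degree in the first complex. -/
noncomputable def decompLeft :
    Decomp (fun i : ℤ => i) (fun i => mapLeft F (K.X i) L) (mapBifunctor K L F (.up ℤ)) where
  ι := ιLeft F K L
  π := πLeft F K L
  supp := Finset.Icc (IsBounded.exists_bounds (K := K)).choose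
    (IsBounded.exists_bounds (K := K)).choose_spec.choose
  ι_π_self i n h hn := by
    subst hn
    ext p
    rw [Cochain.comp_v _ _ h p (p + i) p rfl (by lia), Cochain.ofHom_v]
    exact ι_mapBifunctorProj_self F K L i p (p + i) (add_comm _ _)
  ι_π_ne i j hij n h := by
    ext p q hpq
    rw [Cochain.comp_v _ _ h p (p + i) q rfl (by lia), Cochain.zero_v]
    exact ι_mapBifunctorProj_ne F K L i p j q (p + i) (add_comm _ _) hij
  total := by
    ext n i j h
    rw [Cochain.ofHom_v]
    change i + j = n at h
    have h₁ : (∑ i ∈ Finset.Icc (IsBounded.exists_bounds (K := K)).choose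
        (IsBounded.exists_bounds (K := K)).choose_spec.choose,
        (πLeft F K L i).comp (ιLeft F K L i) (neg_add_cancel i)).v n n (add_zero n) =
        ∑ i ∈ Finset.Icc (IsBounded.exists_bounds (K := K)).choose
        (IsBounded.exists_bounds (K := K)).choose_spec.choose,
        mapBifunctorProj F K L i (n - i) n ≫ ιMapBifunctor K L F (.up ℤ) i (n - i) n
          (by change i + (n - i) = n; lia) := by
      rw [sum_v]
      refine Finset.sum_congr rfl fun i _ => ?_
      exact Cochain.comp_v _ _ _ n (n - i) n (by lia) (by lia)
    rw [h₁, Preadditive.comp_sum]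
    by_cases hi : i ∈ Finset.Icc (IsBounded.exists_bounds (K := K)).choose
        (IsBounded.exists_bounds (K := K)).choose_spec.choose
    · rw [Finset.sum_eq_single_of_mem i hi fun i' _ hi' => by
        rw [← assoc, ι_mapBifunctorProj_ne F K L _ _ _ _ _ h hi'.symm, zero_comp]]
      obtain rfl : j = n - i := by lia
      rw [← assoc, ι_mapBifunctorProj_self]
      simp
    · refine ((F.map_isZero (X := K.X i) ?_).obj (L.X j)).eq_of_src _ _
      refine (IsBounded.exists_bounds (K := K)).choose_spec.choose_spec i ?_
      rw [Finset.mem_Icc] at hi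
      lia

/-- The decomposition of a total complex by the degree in the second complex. -/
noncomputable def decompRight :
    Decomp (fun i : ℤ => i) (fun i => mapRight F K (L.X i)) (mapBifunctor K L F (.up ℤ)) where
  ι := ιRight F K L
  π := πRight F K L
  supp := Finset.Icc (IsBounded.exists_bounds (K := L)).choose
    (IsBounded.exists_bounds (K := L)).choose_spec.choose
  ι_π_self i n h hn := by
    subst hn
    ext p
    rw [Cochain.comp_v _ _ h p (p + i) p rfl (by lia), Cochain.ofHom_v]
    simp only [ιRight, πRight, Cochain.mk_v, Linear.units_smul_comp, Linear.comp_units_smul,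
      smul_smul, Int.units_mul_self, one_smul]
    exact ι_mapBifunctorProj_self F K L p i (p + i) rfl
  ι_π_ne i j hij n h := by
    ext p q hpq
    rw [Cochain.comp_v _ _ h p (p + i) q rfl (by lia), Cochain.zero_v]
    simp only [ιRight, πRight, Cochain.mk_v, Linear.units_smul_comp, Linear.comp_units_smul]
    rw [ι_mapBifunctorProj_ne_right F K L p i q j (p + i) rfl hij, smul_zero, smul_zero]
  total := by
    ext n i j h
    rw [Cochain.ofHom_v]
    change i + j = n at h
    have h₁ : (∑ i ∈ Finset.Icc (IsBounded.exists_bounds (K := L)).choose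
        (IsBounded.exists_bounds (K := L)).choose_spec.choose,
        (πRight F K L i).comp (ιRight F K L i) (neg_add_cancel i)).v n n (add_zero n) =
        ∑ i ∈ Finset.Icc (IsBounded.exists_bounds (K := L)).choose
        (IsBounded.exists_bounds (K := L)).choose_spec.choose,
        mapBifunctorProj F K L (n - i) i n ≫ ιMapBifunctor K L F (.up ℤ) (n - i) i n
          (by change n - i + i = n; lia) := by
      rw [sum_v]
      refine Finset.sum_congr rfl fun i _ => ?_
      refine (Cochain.comp_v _ _ _ n (n - i) n (by lia) (by lia)).trans ?_
      simp only [ιRight, πRight, Cochain.mk_v, Linear.units_smul_comp, Linear.comp_units_smul,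
        smul_smul, Int.units_mul_self, one_smul]
    rw [h₁, Preadditive.comp_sum]
    by_cases hj : j ∈ Finset.Icc (IsBounded.exists_bounds (K := L)).choose
        (IsBounded.exists_bounds (K := L)).choose_spec.choose
    · rw [Finset.sum_eq_single_of_mem j hj fun j' _ hj' => by
        rw [← assoc, ι_mapBifunctorProj_ne_right F K L _ _ _ _ _ h hj'.symm, zero_comp]]
      obtain rfl : i = n - j := by lia
      rw [← assoc, ι_mapBifunctorProj_self]
      simp
    · refine ((F.obj (K.X i)).map_isZero (X := L.X j) ?_).eq_of_src _ _
      refine (IsBounded.exists_bounds (K := L)).choose_spec.choose_spec j ?_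
      rw [Finset.mem_Icc] at hj
      lia

theorem decompLeft_ι (i : ℤ) : (decompLeft F K L).ι i = ιLeft F K L i := rfl

theorem decompRight_ι (i : ℤ) : (decompRight F K L).ι i = ιRight F K L i := rfl

/-- In `δ (ι i)` the part `(-1) ^ i id ⋆ d_L` of the total differential cancels against the
differential of the summand, leaving `d_K ⋆ id`. -/
theorem decompLeft_hasEdges : (decompLeft F K L).HasEdges fun i =>
    mapLeftHom F (K.d i (i + 1)) (𝟙 L) := by
  intro i
  ext p q hpq
  rw [δ_v i (i + 1) rfl _ p q hpq (p + i) (p + 1) (by lia) rfl, Cochain.zero_cochain_comp_v,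
    Cochain.ofHom_v]
  simp only [decompLeft, ιLeft, Cochain.mk_v, mapBifunctor.d_eq, Preadditive.comp_add,
    mapBifunctor.ι_D₁, mapBifunctor.ι_D₂]
  rw [mapBifunctor.d₁_eq _ _ _ _ (i₁ := i) (i₁' := i + 1) rfl _ _ (by
      change i + 1 + p = q; lia),
    mapBifunctor.d₂_eq _ _ _ _ _ (i₂ := p) (i₂' := p + 1) rfl _ (by
      change i + (p + 1) = q; lia)]
  simp only [ComplexShape.ε₁_def, ComplexShape.ε₂_def, Int.negOnePow_succ, one_smul, ComplexShape.ε_up_ℤ]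
  simp

/-- Here the sign `(-1) ^ (i * p)` in `ιRight` is essential. It makes the two `d_K` terms cancel,
and together with the sign `(-1) ^ p` of `d_L` it becomes `(-1) ^ ((i + 1) * p)`, the sign of the
next inclusion. -/
theorem decompRight_hasEdges : (decompRight F K L).HasEdges fun i =>
    mapRightHom F (𝟙 K) (L.d i (i + 1)) := by
  intro i
  ext p q hpq
  rw [δ_v i (i + 1) rfl _ p q hpq (p + i) (p + 1) (by lia) rfl, Cochain.zero_cochain_comp_v,
    Cochain.ofHom_v]
  simp only [decompRight, ιRight, Cochain.mk_v, mapBifunctor.d_eq, Preadditive.comp_add,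
    mapBifunctor.ι_D₁, mapBifunctor.ι_D₂, Linear.units_smul_comp]
  rw [mapBifunctor.d₁_eq _ _ _ _ (i₁ := p) (i₁' := p + 1) rfl _ _ (by
      change p + 1 + i = q; lia),
    mapBifunctor.d₂_eq _ _ _ _ _ (i₂ := i) (i₂' := i + 1) rfl _ (by
      change p + (i + 1) = q; lia)]
  simp only [ComplexShape.ε₁_def, ComplexShape.ε₂_def, ComplexShape.ε_up_ℤ, one_smul, mapRightHom_f,
    id_f, Linear.comp_units_smul, smul_smul]
  rw [← Int.negOnePow_add, ← Int.negOnePow_add,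
    show i + 1 + i * (p + 1) = i * p + 1 + 2 * i by ring, Int.negOnePow_add _ (2 * i),
    Int.negOnePow_two_mul, mul_one, Int.negOnePow_succ, show i * p + p = (i + 1) * p by ring,
    Units.neg_smul]
  simp

end TotalDecomp


/-! ### Actions on cochains, and associators on the summands. -/

section TotalDecomp

open HomologicalComplex

section

variable {C₁ C₂ D : Type*} [Category* C₁] [Category* C₂] [Category* D]
  [Preadditive C₁] [Preadditive C₂] [Preadditive D]
  (F : C₁ ⥤ C₂ ⥤ D) [F.Additive] [∀ X, (F.obj X).Additive]

/-- The functoriality of `mapRight` for cochains. -/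
def mapRightCochain {K K' : CochainComplex C₁ ℤ} {n : ℤ} (x : Cochain K K' n) (X : C₂) :
    Cochain (mapRight F K X) (mapRight F K' X) n :=
  Cochain.mk fun p q h => (F.map (x.v p q h)).app X

/-- The functoriality of `mapLeft` for cochains. -/
def mapLeftCochain (X : C₁) {L L' : CochainComplex C₂ ℤ} {n : ℤ} (x : Cochain L L' n) :
    Cochain (mapLeft F X L) (mapLeft F X L') n :=
  Cochain.mk fun p q h => (F.obj X).map (x.v p q h)

section

variable {K K' K'' : CochainComplex C₁ ℤ} {L L' L'' : CochainComplex C₂ ℤ} {n m k : ℤ}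

theorem mapRightCochain_comp (x : Cochain K K' n) (y : Cochain K' K'' m) (h : n + m = k) (X : C₂) :
    mapRightCochain F (x.comp y h) X =
      (mapRightCochain F x X).comp (mapRightCochain F y X) h := by
  ext p q hpq
  rw [Cochain.comp_v _ _ h p (p + n) q rfl (by lia)]
  simp [mapRightCochain, Cochain.comp_v _ _ h p (p + n) q rfl (by lia)]

theorem mapLeftCochain_comp (X : C₁) (x : Cochain L L' n) (y : Cochain L' L'' m) (h : n + m = k) :
    mapLeftCochain F X (x.comp y h) =
      (mapLeftCochain F X x).comp (mapLeftCochain F X y) h := by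
  ext p q hpq
  rw [Cochain.comp_v _ _ h p (p + n) q rfl (by lia)]
  simp [mapLeftCochain, Cochain.comp_v _ _ h p (p + n) q rfl (by lia)]

theorem mapRightCochain_ofHom (f : K ⟶ K') (X : C₂) :
    mapRightCochain F (Cochain.ofHom f) X = Cochain.ofHom (mapRightHom F f (𝟙 X)) := by
  ext p
  simp [mapRightCochain]

theorem mapLeftCochain_ofHom (X : C₁) (f : L ⟶ L') :
    mapLeftCochain F X (Cochain.ofHom f) = Cochain.ofHom (mapLeftHom F (𝟙 X) f) := by
  ext p
  simp [mapLeftCochain]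

theorem mapRightCochain_zero (X : C₂) : mapRightCochain F (0 : Cochain K K' n) X = 0 := by
  ext p q h
  simp [mapRightCochain]

theorem mapLeftCochain_zero (X : C₁) : mapLeftCochain F X (0 : Cochain L L' n) = 0 := by
  ext p q h
  simp [mapLeftCochain]

theorem mapRightCochain_sum {I : Type*} (s : Finset I) (x : I → Cochain K K' n) (X : C₂) :
    mapRightCochain F (∑ i ∈ s, x i) X = ∑ i ∈ s, mapRightCochain F (x i) X := by
  refine map_sum (AddMonoidHom.mk' (fun x : Cochain K K' n => mapRightCochain F x X) ?_) x s
  intro x y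
  ext p q h
  simp [mapRightCochain, F.map_add]

theorem mapLeftCochain_sum {I : Type*} (X : C₁) (s : Finset I) (x : I → Cochain L L' n) :
    mapLeftCochain F X (∑ i ∈ s, x i) = ∑ i ∈ s, mapLeftCochain F X (x i) := by
  refine map_sum (AddMonoidHom.mk' (fun x : Cochain L L' n => mapLeftCochain F X x) ?_) x s
  intro x y
  ext p q h
  simp [mapLeftCochain, Functor.map_add]

end

variable [HasFiniteBiproducts D]

theorem ιRight_naturality {K K' : CochainComplex C₁ ℤ} {L L' : CochainComplex C₂ ℤ} [IsBounded K]
    [IsBounded L] [IsBounded K'] [IsBounded L'] (u : K ⟶ K') (v : L ⟶ L') (j : ℤ) :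
    (ιRight F K L j).comp (Cochain.ofHom (mapBifunctorMap u v F (.up ℤ))) (add_zero j) =
      (Cochain.ofHom (mapRightHom F u (v.f j))).comp (ιRight F K' L' j) (zero_add j) := by
  ext p q h
  rw [Cochain.comp_zero_cochain_v, Cochain.zero_cochain_comp_v, Cochain.ofHom_v, Cochain.ofHom_v]
  simp [ιRight]

theorem ιLeft_naturality {K K' : CochainComplex C₁ ℤ} {L L' : CochainComplex C₂ ℤ} [IsBounded K]
    [IsBounded L] [IsBounded K'] [IsBounded L'] (u : K ⟶ K') (v : L ⟶ L') (j : ℤ) :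
    (ιLeft F K L j).comp (Cochain.ofHom (mapBifunctorMap u v F (.up ℤ))) (add_zero j) =
      (Cochain.ofHom (mapLeftHom F (u.f j) v)).comp (ιLeft F K' L' j) (zero_add j) := by
  ext p q h
  rw [Cochain.comp_zero_cochain_v, Cochain.zero_cochain_comp_v, Cochain.ofHom_v, Cochain.ofHom_v]
  simp [ιLeft]

/-- The components of the total complex, as objects of `D`, are finite sums of the summands. -/
theorem exists_finset_sum_mapBifunctorProj_ι (K : CochainComplex C₁ ℤ) (L : CochainComplex C₂ ℤ)
    [IsBounded K] [IsBounded L] : ∃ S : Finset (ℤ × ℤ), ∀ n : ℤ,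
      ∑ x ∈ S with x.1 + x.2 = n, mapBifunctorProj F K L x.1 x.2 n ≫
        ιMapBifunctorOrZero K L F (.up ℤ) x.1 x.2 n = 𝟙 _ := by
  obtain ⟨a, b, hK⟩ := IsBounded.exists_bounds (K := K)
  obtain ⟨a', b', hL⟩ := IsBounded.exists_bounds (K := L)
  refine ⟨Finset.Icc a b ×ˢ Finset.Icc a' b', fun n => ?_⟩
  apply mapBifunctor.hom_ext
  intro i j h
  rw [Preadditive.comp_sum, comp_id]
  by_cases hij : i ∈ Finset.Icc a b ∧ j ∈ Finset.Icc a' b'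
  · rw [Finset.sum_eq_single_of_mem (i, j) (by simpa using ⟨by simpa using hij, h⟩)]
    · rw [← assoc, ι_mapBifunctorProj_self _ _ _ _ _ _ h, id_comp,
        ιMapBifunctorOrZero_eq _ _ _ _ _ _ _ h]
    · rintro ⟨i', j'⟩ h' hne
      rw [← assoc]
      by_cases hi : i = i'
      · rw [ι_mapBifunctorProj_ne_right _ _ _ _ _ _ _ _ h (fun hj => hne (by rw [hi, hj])),
          zero_comp]
      · rw [ι_mapBifunctorProj_ne _ _ _ _ _ _ _ _ h hi, zero_comp]
  · simp only [Finset.mem_Icc] at hij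
    by_cases hi : a ≤ i ∧ i ≤ b
    · exact ((F.obj _).map_isZero (hL j (by lia))).eq_of_src _ _
    · exact ((F.map_isZero (hK i (by lia))).obj _).eq_of_src _ _

end

section Associator

variable {C₁ C₂ C₃ C₁₂ C₂₃ D : Type*} [Category* C₁] [Category* C₂] [Category* C₃]
  [Category* C₁₂] [Category* C₂₃] [Category* D]
  [Preadditive C₁] [Preadditive C₂] [Preadditive C₃] [Preadditive C₁₂] [Preadditive C₂₃]
  [Preadditive D]
  {F₁₂ : C₁ ⥤ C₂ ⥤ C₁₂} {G : C₁₂ ⥤ C₃ ⥤ D} {F : C₁ ⥤ C₂₃ ⥤ D} {G₂₃ : C₂ ⥤ C₃ ⥤ C₂₃}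
  [F₁₂.Additive] [∀ X, (F₁₂.obj X).Additive] [G.Additive] [∀ X, (G.obj X).Additive]
  [F.Additive] [∀ X, (F.obj X).Additive] [G₂₃.Additive] [∀ X, (G₂₃.obj X).Additive]
  (α : bifunctorComp₁₂ F₁₂ G ≅ bifunctorComp₂₃ F G₂₃)

/-- The components of an associativity isomorphism. -/
def assocApp (X : C₁) (Y : C₂) (Z : C₃) :
    (G.obj ((F₁₂.obj X).obj Y)).obj Z ≅ (F.obj X).obj ((G₂₃.obj Y).obj Z) :=
  ((α.app X).app Y).app Z

theorem assocApp_naturality_fst {X X' : C₁} (f : X ⟶ X') (Y : C₂) (Z : C₃) :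
    (G.map ((F₁₂.map f).app Y)).app Z ≫ (assocApp α X' Y Z).hom =
      (assocApp α X Y Z).hom ≫ (F.map f).app _ :=
  congr_app (congr_app (α.hom.naturality f) Y) Z

theorem assocApp_naturality_snd (X : C₁) {Y Y' : C₂} (f : Y ⟶ Y') (Z : C₃) :
    (G.map ((F₁₂.obj X).map f)).app Z ≫ (assocApp α X Y' Z).hom =
      (assocApp α X Y Z).hom ≫ (F.obj X).map ((G₂₃.map f).app Z) :=
  congr_app ((α.hom.app X).naturality f) Z

theorem assocApp_naturality_thd (X : C₁) (Y : C₂) {Z Z' : C₃} (f : Z ⟶ Z') :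
    (G.obj ((F₁₂.obj X).obj Y)).map f ≫ (assocApp α X Y Z').hom =
      (assocApp α X Y Z).hom ≫ (F.obj X).map ((G₂₃.obj Y).map f) :=
  ((α.hom.app X).app Y).naturality f

/-- The associativity isomorphism `(K ⋆ X) ⋆ Y ≅ K ⋆ (X ⋆ Y)` for a complex `K`. -/
@[simps!]
def assocComplexFst (K : CochainComplex C₁ ℤ) (X : C₂) (Y : C₃) :
    mapRight G (mapRight F₁₂ K X) Y ≅ mapRight F K ((G₂₃.obj X).obj Y) :=
  Hom.isoOfComponents (fun i => assocApp α (K.X i) X Y) (fun i j _ =>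
    (assocApp_naturality_fst α (K.d i j) X Y).symm)

/-- The associativity isomorphism `(X ⋆ K) ⋆ Y ≅ X ⋆ (K ⋆ Y)` for a complex `K`. -/
@[simps!]
def assocComplexSnd (X : C₁) (K : CochainComplex C₂ ℤ) (Y : C₃) :
    mapRight G (mapLeft F₁₂ X K) Y ≅ mapLeft F X (mapRight G₂₃ K Y) :=
  Hom.isoOfComponents (fun i => assocApp α X (K.X i) Y) (fun i j _ =>
    (assocApp_naturality_snd α X (K.d i j) Y).symm)

/-- The associativity isomorphism `(X ⋆ Y) ⋆ K ≅ X ⋆ (Y ⋆ K)` for a complex `K`. -/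
@[simps!]
def assocComplexThd (X : C₁) (Y : C₂) (K : CochainComplex C₃ ℤ) :
    mapLeft G ((F₁₂.obj X).obj Y) K ≅ mapLeft F X (mapLeft G₂₃ Y K) :=
  Hom.isoOfComponents (fun i => assocApp α X Y (K.X i)) (fun i j _ =>
    (assocApp_naturality_thd α X Y (K.d i j)).symm)

variable [HasFiniteBiproducts C₁₂] [HasFiniteBiproducts C₂₃] [HasFiniteBiproducts D]
  (K : CochainComplex C₁ ℤ) (L : CochainComplex C₂ ℤ) (N : CochainComplex C₃ ℤ)
  [IsBounded K] [IsBounded L] [IsBounded N]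

theorem ι_associator (i j k ij jk n : ℤ) (hij : i + j = ij) (hjk : j + k = jk) (h : ij + k = n)
    (h' : i + jk = n) :
    (G.map (ιMapBifunctor K L F₁₂ (.up ℤ) i j ij hij)).app (N.X k) ≫
      ιMapBifunctor (mapBifunctor K L F₁₂ (.up ℤ)) N G (.up ℤ) ij k n h ≫
        (mapBifunctorAssociator α K L N (.up ℤ) (.up ℤ) (.up ℤ)).hom.f n =
    (assocApp α (K.X i) (L.X j) (N.X k)).hom ≫
      (F.obj (K.X i)).map (ιMapBifunctor L N G₂₃ (.up ℤ) j k jk hjk) ≫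
        ιMapBifunctor K (mapBifunctor L N G₂₃ (.up ℤ)) F (.up ℤ) i jk n h' := by
  have h₁ := mapBifunctor₁₂.ι_eq F₁₂ G K L N (.up ℤ) (.up ℤ) i j k ij n hij h
  have h₂ := mapBifunctor₂₃.ι_eq F G₂₃ K L N (.up ℤ) (.up ℤ) (.up ℤ) i j k jk n hjk h'
  rw [← assoc, ← h₁]
  exact (ι_mapBifunctorAssociatorX_hom α K L N (.up ℤ) (.up ℤ) (.up ℤ) i j k n _).trans
    (congrArg (fun z => (assocApp α (K.X i) (L.X j) (N.X k)).hom ≫ z) h₂)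

/-- On each summand the associator is `α`, so only signs need comparison: `q * (i + p) + p * i` on
the left against `(p + q) * i` on the right. They differ by `p * q`. -/
theorem ιRight_ιRight_associator (p q r : ℤ) (h : p + q = r) :
    ((mapRightCochain G (ιRight F₁₂ K L p) (N.X q)).comp
      (ιRight G (mapBifunctor K L F₁₂ (.up ℤ)) N q) h).comp
        (Cochain.ofHom (mapBifunctorAssociator α K L N (.up ℤ) (.up ℤ) (.up ℤ)).hom)
        (add_zero r) =
    (p * q).negOnePow • (Cochain.ofHom (assocComplexFst α K (L.X p) (N.X q)).hom).comp
      ((Cochain.ofHom (mapRightHom F (𝟙 K) (ιMapBifunctor L N G₂₃ (.up ℤ) p q r h))).comp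
        (ιRight F K (mapBifunctor L N G₂₃ (.up ℤ)) r) (zero_add r)) (zero_add r) := by
  ext i n hin
  rw [Cochain.comp_zero_cochain_v, Cochain.comp_v _ _ h i (i + p) n rfl (by lia),
    Cochain.units_smul_v, Cochain.zero_cochain_comp_v, Cochain.zero_cochain_comp_v, Cochain.ofHom_v,
    Cochain.ofHom_v, Cochain.ofHom_v]
  have := ι_associator α K L N i p q (i + p) r n rfl h (by lia) hin
  simp only [mapRightCochain, ιRight, Cochain.mk_v, mapRightHom_f, id_f, CategoryTheory.Functor.map_id,
    NatTrans.id_app, id_comp, assocComplexFst_hom_f, Linear.units_smul_comp, assoc,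
    Linear.comp_units_smul, smul_smul, Functor.map_units_smul, NatTrans.app_units_zsmul, this]
  rw [← Int.negOnePow_add, ← Int.negOnePow_add,
    show q * (i + p) + p * i = p * q + r * i by rw [← h]; ring]

/-- The signs are `q * (i + p)` on the left and `q * i` on the right, since `ιLeft` has none; again
`p * q` remains. -/
theorem ιLeft_ιRight_associator (p q r : ℤ) (h : p + q = r) :
    ((mapRightCochain G (ιLeft F₁₂ K L p) (N.X q)).comp
      (ιRight G (mapBifunctor K L F₁₂ (.up ℤ)) N q) h).comp
        (Cochain.ofHom (mapBifunctorAssociator α K L N (.up ℤ) (.up ℤ) (.up ℤ)).hom)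
        (add_zero r) =
    (p * q).negOnePow • (Cochain.ofHom (assocComplexSnd α (K.X p) L (N.X q)).hom).comp
      ((mapLeftCochain F (K.X p) (ιRight G₂₃ L N q)).comp
        (ιLeft F K (mapBifunctor L N G₂₃ (.up ℤ)) p) (by lia)) (zero_add r) := by
  ext i n hin
  rw [Cochain.comp_zero_cochain_v, Cochain.comp_v _ _ h i (i + p) n rfl (by lia),
    Cochain.units_smul_v, Cochain.zero_cochain_comp_v, Cochain.ofHom_v,
    Cochain.comp_v _ _ (show q + p = r by lia) i (i + q) n rfl (by lia), Cochain.ofHom_v]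
  have := ι_associator α K L N p i q (i + p) (i + q) n (by lia) rfl (by lia) (by lia)
  simp only [mapRightCochain, mapLeftCochain, ιLeft, ιRight, Cochain.mk_v, assocComplexSnd_hom_f,
    Linear.units_smul_comp, assoc,
    Linear.comp_units_smul, smul_smul, Functor.map_units_smul, this]
  rw [← Int.negOnePow_add, show q * (i + p) = p * q + q * i by ring]

theorem ιLeft_associator (p q r : ℤ) (h : p + q = r) :
    ((Cochain.ofHom (mapLeftHom G (ιMapBifunctor K L F₁₂ (.up ℤ) p q r h) (𝟙 N))).comp
      (ιLeft G (mapBifunctor K L F₁₂ (.up ℤ)) N r) (zero_add r)).comp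
        (Cochain.ofHom (mapBifunctorAssociator α K L N (.up ℤ) (.up ℤ) (.up ℤ)).hom)
        (add_zero r) =
    (Cochain.ofHom (assocComplexThd α (K.X p) (L.X q) N).hom).comp
      ((mapLeftCochain F (K.X p) (ιLeft G₂₃ L N q)).comp
        (ιLeft F K (mapBifunctor L N G₂₃ (.up ℤ)) p) (by lia)) (zero_add r) := by
  ext i n hin
  rw [Cochain.comp_zero_cochain_v, Cochain.zero_cochain_comp_v, Cochain.zero_cochain_comp_v,
    Cochain.ofHom_v, Cochain.ofHom_v, Cochain.ofHom_v,
    Cochain.comp_v _ _ (show q + p = r by lia) i (i + q) n rfl (by lia)]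
  have := ι_associator α K L N p q i r (i + q) n h (by lia) (by lia) (by lia)
  simp only [mapLeftCochain, ιLeft, Cochain.mk_v, assocComplexThd_hom_f, mapLeftHom_f, id_f,
    CategoryTheory.Functor.map_id, comp_id, assoc, this]

end Associator

end TotalDecomp


/-! ### Refinement of a decomposition. -/

section Refine

variable {M : Type*} [Category* M] [Preadditive M]

theorem ofHom_sum {K L : CochainComplex M ℤ} {I : Type*} (s : Finset I) (f : I → (K ⟶ L)) :
    Cochain.ofHom (∑ i ∈ s, f i) = ∑ i ∈ s, Cochain.ofHom (f i) :=
  map_sum (AddMonoidHom.mk' (fun f : K ⟶ L => Cochain.ofHom f) Cochain.ofHom_add) f s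

namespace Decomp

variable {I J : Type*} {deg : I → ℤ} {K : I → CochainComplex M ℤ} {T : CochainComplex M ℤ}

theorem sum_of_supp_subset [DecidableEq I] (D : Decomp deg K T) {s : Finset I} (hs : D.supp ⊆ s) :
    ∑ i ∈ s, (D.π i).comp (D.ι i) (neg_add_cancel _) = Cochain.ofHom (𝟙 T) := by
  rw [← D.total]
  refine (Finset.sum_subset hs fun i _ hi => ?_).symm
  rw [D.eq_zero_of_notMem_left hi (D.ι i), Cochain.comp_zero]

/-- The decomposition obtained by decomposing each summand. -/
noncomputable def refine (D : Decomp deg K T) (r : J → I) (K' : J → CochainComplex M ℤ)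
    (c : ∀ j i, K' j ⟶ K i) (e : ∀ j i, K i ⟶ K' j) (S : Finset J) [DecidableEq I]
    (h_self : ∀ j, c j (r j) ≫ e j (r j) = 𝟙 (K' j))
    (h_ne : ∀ j j' i, j ≠ j' → r j = i → c j i ≫ e j' i = 0)
    (h_sum : ∀ i, ∑ j ∈ S with r j = i, e j i ≫ c j i = 𝟙 (K i)) :
    Decomp (fun j => deg (r j)) K' T where
  ι j := (Cochain.ofHom (c j (r j))).comp (D.ι (r j)) (zero_add _)
  π j := (D.π (r j)).comp (Cochain.ofHom (e j (r j))) (add_zero _)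
  supp := S
  ι_π_self j n h hn := by
    subst hn
    rw [comp_assoc_cochain _ _ _ _ _ (add_neg_cancel _), D.ι_π_comp_self, ← Cochain.ofHom_comp,
      h_self]
  ι_π_ne j j' hj n h := by
    rw [comp_assoc_cochain _ _ _ _ _ h]
    by_cases hr : r j = r j'
    · obtain rfl : n = 0 := by rw [hr] at h; lia
      -- The equality `r j = r j'` cannot be substituted directly, so one of the two indices is
      -- generalised. For this reason `c` and `e` are given for all `i`, not only for `r j`.
      have key : ∀ i, i = r j' → ∀ (h : deg i + -deg (r j') = 0),
          (Cochain.ofHom (c j i)).comp ((D.ι i).comp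
            ((D.π (r j')).comp (Cochain.ofHom (e j' (r j'))) (add_zero _)) h) (zero_add 0) =
          Cochain.ofHom (c j (r j') ≫ e j' (r j')) := by
        rintro i rfl h
        rw [D.ι_π_comp_self, ← Cochain.ofHom_comp]
      rw [key _ hr, h_ne _ _ _ hj hr, Cochain.ofHom_zero]
    · rw [D.ι_π_comp_ne _ _ hr, Cochain.comp_zero]
  total := by
    rw [← D.sum_of_supp_subset (s := D.supp ∪ S.image r) Finset.subset_union_left,
      ← Finset.sum_fiberwise_of_maps_to (s := S) (g := r) (t := D.supp ∪ S.image r)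
        (fun j hj => Finset.mem_union_right _ (Finset.mem_image_of_mem r hj))]
    refine Finset.sum_congr rfl fun i _ => ?_
    conv_rhs => rw [← Cochain.id_comp (D.ι i), ← h_sum i, ofHom_sum, sum_comp_cochain,
      comp_sum_cochain]
    refine Finset.sum_congr rfl fun j hj => ?_
    obtain rfl := (Finset.mem_filter.1 hj).2
    rw [Cochain.ofHom_comp, comp_assoc_cochain _ _ _ _ _ (zero_add _),
      comp_assoc_cochain _ _ _ _ _ (zero_add _)]

variable (D : Decomp deg K T) (r : J → I) (K' : J → CochainComplex M ℤ)
    (c : ∀ j i, K' j ⟶ K i) (e : ∀ j i, K i ⟶ K' j) (S : Finset J) [DecidableEq I]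
    (h_self : ∀ j, c j (r j) ≫ e j (r j) = 𝟙 (K' j))
    (h_ne : ∀ j j' i, j ≠ j' → r j = i → c j i ≫ e j' i = 0)
    (h_sum : ∀ i, ∑ j ∈ S with r j = i, e j i ≫ c j i = 𝟙 (K i))

/-- The new inclusions and projections differ from the old ones by chain maps, through which `δ`
passes. -/
theorem Filtered.refine (hD : D.Filtered) :
    (D.refine r K' c e S h_self h_ne h_sum).Filtered := by
  intro j j' m h hj
  change (δ _ _ ((Cochain.ofHom (c j (r j))).comp (D.ι (r j)) (zero_add _))).comp
    ((D.π (r j')).comp (Cochain.ofHom (e j' (r j'))) (add_zero _)) h = 0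
  rw [δ_hom_comp _ _ rfl, ← comp_assoc_cochain _ (D.π _) _ h (by lia) _,
    comp_assoc_cochain _ _ (D.π _) _ _ h, hD _ _ _ h hj, Cochain.comp_zero, Cochain.zero_comp]

theorem coeff_refine {I' J' : Type*} {deg' : I' → ℤ} {L : I' → CochainComplex M ℤ}
    {T' : CochainComplex M ℤ} (D' : Decomp deg' L T') (r' : J' → I') (L' : J' → CochainComplex M ℤ)
    (c' : ∀ j i, L' j ⟶ L i) (e' : ∀ j i, L i ⟶ L' j) (S' : Finset J') [DecidableEq I']
    (h_self' : ∀ j, c' j (r' j) ≫ e' j (r' j) = 𝟙 (L' j))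
    (h_ne' : ∀ j j' i, j ≠ j' → r' j = i → c' j i ≫ e' j' i = 0)
    (h_sum' : ∀ i, ∑ j ∈ S' with r' j = i, e' j i ≫ c' j i = 𝟙 (L i)) {n : ℤ}
    (z : Cochain T T' n) (j : J) (j' : J') (m : ℤ) (h : deg (r j) + n = deg' (r' j') + m) :
    (D.refine r K' c e S h_self h_ne h_sum).coeff (D'.refine r' L' c' e' S' h_self' h_ne' h_sum')
      z j j' m h =
    (Cochain.ofHom (c j (r j))).comp ((D.coeff D' z (r j) (r' j') m h).comp
      (Cochain.ofHom (e' j' (r' j'))) (add_zero _)) (zero_add _) := by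
  change (((Cochain.ofHom (c j (r j))).comp (D.ι (r j)) (zero_add _)).comp z rfl).comp
    ((D'.π (r' j')).comp (Cochain.ofHom (e' j' (r' j'))) (add_zero _)) _ = _
  rw [← comp_assoc_cochain _ (D'.π _) _ (show _ = m by lia) (add_zero m),
    comp_assoc_cochain _ (D.ι _) _ _ _ rfl, comp_assoc_cochain _ _ (D'.π _) _ _ (show _ = m by lia),
    comp_assoc_cochain _ _ _ _ _ (add_zero m)]
  rfl

end Decomp

end Refine

/-! ### Decomposition of `K ⋆ (L ⋆ N)` and `(L ⋆ N) ⋆ K` by pairs of degrees. -/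

section Tensor

open HomologicalComplex

variable {C₁ C₂ C₃ C₂₃ D : Type*} [Category* C₁] [Category* C₂] [Category* C₃]
  [Category* C₂₃] [Category* D]
  [Preadditive C₁] [Preadditive C₂] [Preadditive C₃] [Preadditive C₂₃]
  [Preadditive D]
  (F : C₁ ⥤ C₂₃ ⥤ D) (F' : C₂₃ ⥤ C₁ ⥤ D) (G : C₂ ⥤ C₃ ⥤ C₂₃)
  [F.Additive] [∀ X, (F.obj X).Additive] [F'.Additive] [∀ X, (F'.obj X).Additive]
  [G.Additive] [∀ X, (G.obj X).Additive]

section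

theorem mapRightHom_id (K : CochainComplex C₁ ℤ) (X : C₂₃) :
    mapRightHom F (𝟙 K) (𝟙 X) = 𝟙 _ := by
  ext
  simp

theorem mapLeftHom_id (X : C₂₃) (K : CochainComplex C₁ ℤ) :
    mapLeftHom F' (𝟙 X) (𝟙 K) = 𝟙 _ := by
  ext
  simp

theorem mapRightHom_comp {K K' K'' : CochainComplex C₁ ℤ} (f : K ⟶ K') (f' : K' ⟶ K'')
    {X X' X'' : C₂₃} (g : X ⟶ X') (g' : X' ⟶ X'') :
    mapRightHom F f g ≫ mapRightHom F f' g' = mapRightHom F (f ≫ f') (g ≫ g') := by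
  ext
  simp

theorem mapLeftHom_comp {X X' X'' : C₂₃} (g : X ⟶ X') (g' : X' ⟶ X'')
    {K K' K'' : CochainComplex C₁ ℤ} (f : K ⟶ K') (f' : K' ⟶ K'') :
    mapLeftHom F' g f ≫ mapLeftHom F' g' f' = mapLeftHom F' (g ≫ g') (f ≫ f') := by
  ext
  simp

theorem mapRightHom_sum (K : CochainComplex C₁ ℤ) {X Y : C₂₃} {I : Type*} (s : Finset I)
    (f : I → (X ⟶ Y)) :
    mapRightHom F (𝟙 K) (∑ i ∈ s, f i) = ∑ i ∈ s, mapRightHom F (𝟙 K) (f i) := by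
  refine map_sum (AddMonoidHom.mk' (fun f : X ⟶ Y => mapRightHom F (𝟙 K) f) ?_) f s
  intro f g
  ext
  simp [Functor.map_add]

theorem mapLeftHom_sum (K : CochainComplex C₁ ℤ) {X Y : C₂₃} {I : Type*} (s : Finset I)
    (f : I → (X ⟶ Y)) :
    mapLeftHom F' (∑ i ∈ s, f i) (𝟙 K) = ∑ i ∈ s, mapLeftHom F' (f i) (𝟙 K) := by
  refine map_sum (AddMonoidHom.mk' (fun f : X ⟶ Y => mapLeftHom F' f (𝟙 K)) ?_) f s
  intro f g
  ext
  simp [Functor.map_add]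

theorem mapRightHom_zero (K : CochainComplex C₁ ℤ) (X Y : C₂₃) :
    mapRightHom F (𝟙 K) (0 : X ⟶ Y) = 0 := by
  ext
  simp

theorem mapLeftHom_zero (X Y : C₂₃) (K : CochainComplex C₁ ℤ) :
    mapLeftHom F' (0 : X ⟶ Y) (𝟙 K) = 0 := by
  ext
  simp

end

variable [HasFiniteBiproducts C₂₃] [HasFiniteBiproducts D]
  (K : CochainComplex C₁ ℤ) (L : CochainComplex C₂ ℤ) (N : CochainComplex C₃ ℤ)
  [IsBounded K] [IsBounded L] [IsBounded N]

theorem ιOrZero_mapBifunctorProj_self (x : ℤ × ℤ) :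
    ιMapBifunctorOrZero L N G (.up ℤ) x.1 x.2 (x.1 + x.2) ≫
      mapBifunctorProj G L N x.1 x.2 (x.1 + x.2) = 𝟙 _ := by
  rw [ιMapBifunctorOrZero_eq L N G (.up ℤ) x.1 x.2 (x.1 + x.2) rfl]
  exact ι_mapBifunctorProj_self G L N _ _ _ rfl

theorem ιOrZero_mapBifunctorProj_ne (x y : ℤ × ℤ) (n : ℤ) (hxy : x ≠ y) (h : x.1 + x.2 = n) :
    ιMapBifunctorOrZero L N G (.up ℤ) x.1 x.2 n ≫ mapBifunctorProj G L N y.1 y.2 n = 0 := by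
  rw [ιMapBifunctorOrZero_eq _ _ _ _ _ _ _ h]
  by_cases h' : x.1 = y.1
  · exact ι_mapBifunctorProj_ne_right G L N _ _ _ _ _ h fun h'' => hxy (Prod.ext h' h'')
  · exact ι_mapBifunctorProj_ne G L N _ _ _ _ _ h h'

/-- The decomposition of `K ⋆ (L ⋆ N)` by the degrees in `L` and `N`. -/
noncomputable def decompRightTensor :
    Decomp (fun x : ℤ × ℤ => x.1 + x.2)
      (fun x => mapRight F K ((G.obj (L.X x.1)).obj (N.X x.2)))
      (mapBifunctor K (mapBifunctor L N G (.up ℤ)) F (.up ℤ)) :=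
  (decompRight F K (mapBifunctor L N G (.up ℤ))).refine (fun x : ℤ × ℤ => x.1 + x.2) _
    -- `refine` asks for a map into every `n`; the default value zero covers `n ≠ x.1 + x.2`.
    (fun x n => mapRightHom F (𝟙 K) (ιMapBifunctorOrZero L N G (.up ℤ) x.1 x.2 n))
    (fun x n => mapRightHom F (𝟙 K) (mapBifunctorProj G L N x.1 x.2 n))
    (exists_finset_sum_mapBifunctorProj_ι G L N).choose
    (fun x => by rw [mapRightHom_comp, ιOrZero_mapBifunctorProj_self, id_comp, mapRightHom_id])
    (fun x y n hxy h => by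
      rw [mapRightHom_comp, ιOrZero_mapBifunctorProj_ne _ _ _ _ _ _ hxy h, id_comp,
        mapRightHom_zero])
    (fun n => by
      simp only [mapRightHom_comp, id_comp]
      rw [← mapRightHom_sum, (exists_finset_sum_mapBifunctorProj_ι G L N).choose_spec n,
        mapRightHom_id])

/-- The decomposition of `(L ⋆ N) ⋆ K` by the degrees in `L` and `N`. -/
noncomputable def decompLeftTensor :
    Decomp (fun x : ℤ × ℤ => x.1 + x.2)
      (fun x => mapLeft F' ((G.obj (L.X x.1)).obj (N.X x.2)) K)
      (mapBifunctor (mapBifunctor L N G (.up ℤ)) K F' (.up ℤ)) :=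
  (decompLeft F' (mapBifunctor L N G (.up ℤ)) K).refine (fun x : ℤ × ℤ => x.1 + x.2) _
    (fun x n => mapLeftHom F' (ιMapBifunctorOrZero L N G (.up ℤ) x.1 x.2 n) (𝟙 K))
    (fun x n => mapLeftHom F' (mapBifunctorProj G L N x.1 x.2 n) (𝟙 K))
    (exists_finset_sum_mapBifunctorProj_ι G L N).choose
    (fun x => by rw [mapLeftHom_comp, ιOrZero_mapBifunctorProj_self, id_comp, mapLeftHom_id])
    (fun x y n hxy h => by
      rw [mapLeftHom_comp, ιOrZero_mapBifunctorProj_ne _ _ _ _ _ _ hxy h, id_comp,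
        mapLeftHom_zero])
    (fun n => by
      simp only [mapLeftHom_comp, id_comp]
      rw [← mapLeftHom_sum, (exists_finset_sum_mapBifunctorProj_ι G L N).choose_spec n,
        mapLeftHom_id])

theorem decompRightTensor_filtered : (decompRightTensor F G K L N).Filtered :=
  (decompRight_hasEdges _ _ _).filtered.refine _ _ _ _ _ _ _ _ _

theorem decompLeftTensor_filtered : (decompLeftTensor F' G K L N).Filtered :=
  (decompLeft_hasEdges _ _ _).filtered.refine _ _ _ _ _ _ _ _ _

theorem decompRightTensor_ι (x : ℤ × ℤ) : (decompRightTensor F G K L N).ι x =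
    (Cochain.ofHom (mapRightHom F (𝟙 K)
      (ιMapBifunctor L N G (.up ℤ) x.1 x.2 (x.1 + x.2) rfl))).comp
        (ιRight F K (mapBifunctor L N G (.up ℤ)) (x.1 + x.2)) (zero_add _) := by
  rw [← ιMapBifunctorOrZero_eq L N G (.up ℤ) x.1 x.2 (x.1 + x.2) rfl]
  rfl

theorem decompLeftTensor_ι (x : ℤ × ℤ) : (decompLeftTensor F' G K L N).ι x =
    (Cochain.ofHom (mapLeftHom F'
      (ιMapBifunctor L N G (.up ℤ) x.1 x.2 (x.1 + x.2) rfl) (𝟙 K))).comp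
        (ιLeft F' (mapBifunctor L N G (.up ℤ)) K (x.1 + x.2)) (zero_add _) := by
  rw [← ιMapBifunctorOrZero_eq L N G (.up ℤ) x.1 x.2 (x.1 + x.2) rfl]
  rfl

/-- This reads the coefficients by pairs off those by total degree, so that a map known only to be
filtered in `L ⋆ N` can be compared with one built from `L` and `N` separately. -/
theorem coeff_decompTensor {n : ℤ}
    (z : Cochain (mapBifunctor K (mapBifunctor L N G (.up ℤ)) F (.up ℤ))
      (mapBifunctor (mapBifunctor L N G (.up ℤ)) K F' (.up ℤ)) n) (x y : ℤ × ℤ) (m : ℤ)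
    (h : x.1 + x.2 + n = y.1 + y.2 + m) :
    (decompRightTensor F G K L N).coeff (decompLeftTensor F' G K L N) z x y m h =
    (Cochain.ofHom (mapRightHom F (𝟙 K)
      (ιMapBifunctor L N G (.up ℤ) x.1 x.2 (x.1 + x.2) rfl))).comp
      (((decompRight F K (mapBifunctor L N G (.up ℤ))).coeff
        (decompLeft F' (mapBifunctor L N G (.up ℤ)) K) z (x.1 + x.2) (y.1 + y.2) m h).comp
        (Cochain.ofHom (mapLeftHom F' (mapBifunctorProj G L N y.1 y.2 (y.1 + y.2)) (𝟙 K)))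
        (add_zero _)) (zero_add _) := by
  rw [← ιMapBifunctorOrZero_eq L N G (.up ℤ) x.1 x.2 (x.1 + x.2) rfl]
  exact Decomp.coeff_refine ..

end Tensor

open HomologicalComplex

section

variable {M : Type*} [Category* M] [Preadditive M]

/-- Converts the formulas for associators into formulas for their inverses; the sign is its own
inverse. -/
theorem comp_inv_eq_of_comp_hom_eq {K K' T T' : CochainComplex M ℤ} (a : T ≅ T') (b : K ≅ K')
    {n : ℤ} (u : Cochain K T n) (v : Cochain K' T' n) (s : ℤˣ)
    (h : u.comp (Cochain.ofHom a.hom) (add_zero n) =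
      s • (Cochain.ofHom b.hom).comp v (zero_add n)) :
    v.comp (Cochain.ofHom a.inv) (add_zero n) =
      s • (Cochain.ofHom b.inv).comp u (zero_add n) := by
  have h' := congrArg (fun z => s • (Cochain.ofHom b.inv).comp
    (z.comp (Cochain.ofHom a.inv) (add_zero n)) (zero_add n)) h
  simp only [Cochain.units_smul_comp, Cochain.comp_units_smul, smul_smul, Int.units_mul_self,
    one_smul] at h'
  rw [comp_assoc_cochain _ _ _ _ _ (add_zero 0), ← Cochain.ofHom_comp, a.hom_inv_id,
    Cochain.comp_id, comp_assoc_cochain _ v _ _ _ (add_zero n),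
    ← comp_assoc_cochain _ _ _ (add_zero 0) (zero_add n), ← Cochain.ofHom_comp, b.inv_hom_id,
    Cochain.id_comp] at h'
  exact h'.symm

namespace Decomp

variable {I J : Type*} {deg : I → ℤ} {K : I → CochainComplex M ℤ} {T : CochainComplex M ℤ}
  (D : Decomp deg K T) {deg' : J → ℤ} {K' : J → CochainComplex M ℤ} {T' : CochainComplex M ℤ}
  (D' : Decomp deg' K' T')

theorem ι_comp_eq_sum (z : Cochain T T' 0) (i : I) :
    (D.ι i).comp z (add_zero _) = ∑ j ∈ D'.supp,
      (D.coeff D' z i j (deg i - deg' j) (by lia)).comp (D'.ι j) (by lia) := by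
  rw [D'.eq_sum_comp_π_ι ((D.ι i).comp z (add_zero _))]
  refine Finset.sum_congr rfl fun j _ => ?_
  rw [coeff_eq _ _ _ _ _ _ _ (add_zero _)]

variable {B B' : ℤ → CochainComplex M ℤ} {D : Decomp (fun i : ℤ => i) B T}
  {D' : Decomp (fun i : ℤ => i) B' T'} {z : Cochain T T' 0} {w : ∀ i, B i ⟶ B' i}

theorem raises_of_ι_comp (h : ∀ i, (D.ι i).comp z (add_zero i) =
    (Cochain.ofHom (w i)).comp (D'.ι i) (zero_add i)) : D.Raises D' 0 z := by
  intro i j m hm hij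
  rw [coeff_eq _ _ _ _ _ _ _ (add_zero i), h]
  exact D'.comp_ι_π_ne i j (by lia) _ _ _

theorem coeff_of_ι_comp (h : ∀ i, (D.ι i).comp z (add_zero i) =
    (Cochain.ofHom (w i)).comp (D'.ι i) (zero_add i)) (i : ℤ) :
    D.coeff D' z i i 0 rfl = Cochain.ofHom (w i) := by
  rw [coeff_eq _ _ _ _ _ _ _ (add_zero i), h]
  exact D'.comp_ι_π_self i _ _ _

end Decomp

end

/-! ### The maps `f ⋆ id` and `id ⋆ f` on iterated inclusions. -/

section Expansion

variable {C₁ C₂ D₁ D : Type*} [Category* C₁] [Category* C₂] [Category* D₁] [Category* D]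
  [Preadditive C₁] [Preadditive C₂] [Preadditive D₁] [Preadditive D]
  (F : D₁ ⥤ C₁ ⥤ D) (F' : C₁ ⥤ D₁ ⥤ D)
  [F.Additive] [∀ X, (F.obj X).Additive] [F'.Additive] [∀ X, (F'.obj X).Additive]
  [HasFiniteBiproducts D]
  {I J : Type*} {deg : I → ℤ} {K : I → CochainComplex D₁ ℤ} {T : CochainComplex D₁ ℤ}
  (E : Decomp deg K T) {deg' : J → ℤ} {K' : J → CochainComplex D₁ ℤ} {T' : CochainComplex D₁ ℤ}
  (E' : Decomp deg' K' T') [IsBounded T] [IsBounded T'] (f : T ⟶ T')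
  (L : CochainComplex C₁ ℤ) [IsBounded L]

theorem mapRightCochain_ι_comp (i : I) (q : ℤ) {n : ℤ} (h : deg i + q = n) :
    ((mapRightCochain F (E.ι i) (L.X q)).comp (ιRight F T L q) h).comp
      (Cochain.ofHom (mapBifunctorMap f (𝟙 L) F (.up ℤ))) (add_zero n) =
    ∑ j ∈ E'.supp, (mapRightCochain F
        (E.coeff E' (Cochain.ofHom f) i j (deg i - deg' j) (by lia)) (L.X q)).comp
      ((mapRightCochain F (E'.ι j) (L.X q)).comp (ιRight F T' L q) rfl) (by lia) := by
  rw [comp_assoc_cochain _ _ _ _ _ (add_zero q), ιRight_naturality, id_f,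
    ← mapRightCochain_ofHom, ← comp_assoc_cochain _ _ _ (add_zero (deg i)) h,
    ← mapRightCochain_comp, E.ι_comp_eq_sum E', mapRightCochain_sum, sum_comp_cochain]
  refine Finset.sum_congr rfl fun j _ => ?_
  rw [mapRightCochain_comp, comp_assoc_cochain _ _ _ _ _ rfl]

theorem mapLeftCochain_ι_comp (i : I) (q : ℤ) {n : ℤ} (h : deg i + q = n) :
    ((mapLeftCochain F' (L.X q) (E.ι i)).comp (ιLeft F' L T q) h).comp
      (Cochain.ofHom (mapBifunctorMap (𝟙 L) f F' (.up ℤ))) (add_zero n) =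
    ∑ j ∈ E'.supp, (mapLeftCochain F' (L.X q)
        (E.coeff E' (Cochain.ofHom f) i j (deg i - deg' j) (by lia))).comp
      ((mapLeftCochain F' (L.X q) (E'.ι j)).comp (ιLeft F' L T' q) rfl) (by lia) := by
  rw [comp_assoc_cochain _ _ _ _ _ (add_zero q), ιLeft_naturality, id_f,
    ← mapLeftCochain_ofHom, ← comp_assoc_cochain _ _ _ (add_zero (deg i)) h,
    ← mapLeftCochain_comp, E.ι_comp_eq_sum E', mapLeftCochain_sum, sum_comp_cochain]
  refine Finset.sum_congr rfl fun j _ => ?_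
  rw [mapLeftCochain_comp, comp_assoc_cochain _ _ _ _ _ rfl]

end Expansion

/-! ### Matrix coefficients of the composite that defines multiplicativity. -/

section Multiplicativity

variable {A M : Type*} [Category* A] [Category* M] [Preadditive A] [Preadditive M]
  [HasFiniteBiproducts A] [HasFiniteBiproducts M] [MonoidalCategory A] [MonoidalPreadditive A]
  [MonoidalLeftAction A M] [MonoidalRightAction A M] [StarBimodule A M] [BimodulePreadditive A M]
  (Z : CochainComplex M ℤ) (X Y : CochainComplex A ℤ) [IsBounded Z] [IsBounded X] [IsBounded Y]
  (f : mapBifunctor Z X (rightAct A M) (.up ℤ) ⟶ mapBifunctor X Z (leftAct A M) (.up ℤ))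
  (g : mapBifunctor Z Y (rightAct A M) (.up ℤ) ⟶ mapBifunctor Y Z (leftAct A M) (.up ℤ))

/-- The composite `Z ⋆ (X ⊗ Y) ⟶ (X ⊗ Y) ⋆ Z` induced by `f : Z ⋆ X ⟶ X ⋆ Z` and
`g : Z ⋆ Y ⟶ Y ⋆ Z`. -/
noncomputable def tensorComposite :
    mapBifunctor Z (mapBifunctor X Y (curriedTensor A) (.up ℤ)) (rightAct A M) (.up ℤ) ⟶
      mapBifunctor (mapBifunctor X Y (curriedTensor A) (.up ℤ)) Z (leftAct A M) (.up ℤ) :=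
  (mapBifunctorAssociator (rightAssocIso A M) Z X Y (.up ℤ) (.up ℤ) (.up ℤ)).inv ≫
    mapBifunctorMap f (𝟙 Y) (rightAct A M) (.up ℤ) ≫
    (mapBifunctorAssociator (midAssocIso A M) X Z Y (.up ℤ) (.up ℤ) (.up ℤ)).hom ≫
    mapBifunctorMap (𝟙 X) g (leftAct A M) (.up ℤ) ≫
    (mapBifunctorAssociator (MonoidalLeftAction.actionAssocNatIso A M) X Y Z
      (.up ℤ) (.up ℤ) (.up ℤ)).inv

/-- The matrix coefficients of `tensorComposite`, in terms of those of `f` and `g`. -/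
def tensorCoeff (x y : ℤ × ℤ) {a b m : ℤ}
    (φ : Cochain (mapRight (rightAct A M) Z (X.X x.1)) (mapLeft (leftAct A M) (X.X y.1) Z) a)
    (ψ : Cochain (mapRight (rightAct A M) Z (Y.X x.2)) (mapLeft (leftAct A M) (Y.X y.2) Z) b)
    (hm : a + b = m) :
    Cochain (mapRight (rightAct A M) Z (((curriedTensor A).obj (X.X x.1)).obj (Y.X x.2)))
      (mapLeft (leftAct A M) (((curriedTensor A).obj (X.X y.1)).obj (Y.X y.2)) Z) m :=
  -- The first term is the sign of the right associator on `Z`, `X^{x.1}`, `Y^{x.2}`, the second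
  -- that of the middle associator on `X^{y.1}`, `Z`, `Y^{x.2}`. The left associator contributes
  -- none.
  (x.1 * x.2 + y.1 * x.2).negOnePow •
    (Cochain.ofHom (assocComplexFst (rightAssocIso A M) Z (X.X x.1) (Y.X x.2)).inv).comp
    ((mapRightCochain (rightAct A M) φ (Y.X x.2)).comp
      ((Cochain.ofHom (assocComplexSnd (midAssocIso A M) (X.X y.1) Z (Y.X x.2)).hom).comp
        ((mapLeftCochain (leftAct A M) (X.X y.1) ψ).comp
          (Cochain.ofHom (assocComplexThd (MonoidalLeftAction.actionAssocNatIso A M)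
            (X.X y.1) (Y.X y.2) Z).inv) (add_zero b)) (zero_add b)) hm) (zero_add m)

theorem tensorCoeff_zero_left (x y : ℤ × ℤ) {a b m : ℤ}
    (ψ : Cochain (mapRight (rightAct A M) Z (Y.X x.2)) (mapLeft (leftAct A M) (Y.X y.2) Z) b)
    (hm : a + b = m) : tensorCoeff Z X Y x y (0 : Cochain _ _ a) ψ hm = 0 := by
  rw [tensorCoeff, mapRightCochain_zero, Cochain.zero_comp, Cochain.comp_zero, smul_zero]

theorem tensorCoeff_zero_right (x y : ℤ × ℤ) {a b m : ℤ}
    (φ : Cochain (mapRight (rightAct A M) Z (X.X x.1)) (mapLeft (leftAct A M) (X.X y.1) Z) a)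
    (hm : a + b = m) : tensorCoeff Z X Y x y φ (0 : Cochain _ _ b) hm = 0 := by
  rw [tensorCoeff, mapLeftCochain_zero, Cochain.zero_comp, Cochain.comp_zero, Cochain.comp_zero,
    Cochain.comp_zero, smul_zero]

/-- The inclusion is pushed through the five factors of `tensorComposite` in turn, by `h₁` to `h₅`.
Only `f` and `g` branch, which gives the double sum over the target degrees `p` and `q`. -/
theorem ι_comp_tensorComposite (x : ℤ × ℤ) :
    ((decompRightTensor (rightAct A M) (curriedTensor A) Z X Y).ι x).comp
      (Cochain.ofHom (tensorComposite Z X Y f g)) (add_zero _) =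
    ∑ p ∈ (decompLeft (leftAct A M) X Z).supp, ∑ q ∈ (decompLeft (leftAct A M) Y Z).supp,
      (tensorCoeff Z X Y x (p, q)
        ((decompRight (rightAct A M) Z X).coeff (decompLeft (leftAct A M) X Z) (Cochain.ofHom f)
          x.1 p (x.1 - p) (by lia))
        ((decompRight (rightAct A M) Z Y).coeff (decompLeft (leftAct A M) Y Z) (Cochain.ofHom g)
          x.2 q (x.2 - q) (by lia)) rfl).comp
      ((decompLeftTensor (leftAct A M) (curriedTensor A) Z X Y).ι (p, q))
        (show _ + (p + q) = _ by lia) := by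
  have h₁ := comp_inv_eq_of_comp_hom_eq _ _ _ _ _
    (ιRight_ιRight_associator (rightAssocIso A M) Z X Y x.1 x.2 _ rfl)
  have h₅ : ∀ (p q r : ℤ) (hr : q + p = r),
      ((mapLeftCochain (leftAct A M) (X.X p) (ιLeft (leftAct A M) Y Z q)).comp
        (ιLeft (leftAct A M) X (mapBifunctor Y Z (leftAct A M) (.up ℤ)) p) hr).comp
        (Cochain.ofHom (mapBifunctorAssociator (MonoidalLeftAction.actionAssocNatIso A M) X Y Z
          (.up ℤ) (.up ℤ) (.up ℤ)).inv) (add_zero r) =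
      (Cochain.ofHom (assocComplexThd (MonoidalLeftAction.actionAssocNatIso A M)
        (X.X p) (Y.X q) Z).inv).comp
        ((decompLeftTensor (leftAct A M) (curriedTensor A) Z X Y).ι (p, q))
        (show 0 + (p + q) = r by lia) := by
    intro p q r hr
    obtain rfl : r = p + q := by lia
    rw [decompLeftTensor_ι]
    refine (comp_inv_eq_of_comp_hom_eq _ _ _ _ 1
      ((ιLeft_associator (F := leftAct A M) (G := leftAct A M) (G₂₃ := leftAct A M)
      (MonoidalLeftAction.actionAssocNatIso A M) X Y Z p q _ rfl).trans
      (one_smul _ _).symm)).trans (one_smul _ _)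
  have h₂ := mapRightCochain_ι_comp (rightAct A M) (decompRight (rightAct A M) Z X)
    (decompLeft (leftAct A M) X Z) f Y x.1 x.2 rfl
  have h₃ : ∀ p : ℤ, _ := fun p =>
    ιLeft_ιRight_associator (midAssocIso A M) X Z Y p x.2 _ rfl
  have h₄ : ∀ p : ℤ, _ := fun p =>
    mapLeftCochain_ι_comp (leftAct A M) (decompRight (rightAct A M) Z Y)
    (decompLeft (leftAct A M) Y Z) g X x.2 p (add_comm _ _)
  simp only [decompLeft_ι, decompRight_ι] at h₂ h₄
  rw [decompRightTensor_ι, tensorComposite, Cochain.ofHom_comp, Cochain.ofHom_comp,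
    Cochain.ofHom_comp, Cochain.ofHom_comp, ← comp_assoc_cochain _ _ _ (add_zero _) (add_zero _), h₁,
    Cochain.units_smul_comp, comp_assoc_cochain _ _ _ _ _ (add_zero _),
    ← comp_assoc_cochain _ (Cochain.ofHom (mapBifunctorMap f (𝟙 Y) (rightAct A M) (.up ℤ))) _
      (add_zero _) (add_zero _), h₂, sum_comp_cochain, comp_sum_cochain, Finset.smul_sum]
  refine Finset.sum_congr rfl fun p _ => ?_
  rw [comp_assoc_cochain _ _ _ _ _ (add_zero _),
    ← comp_assoc_cochain _ (Cochain.ofHom (mapBifunctorAssociator _ _ _ _ _ _ _).hom) _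
      (add_zero _) (add_zero _), h₃, Cochain.units_smul_comp, Cochain.comp_units_smul,
    Cochain.comp_units_smul, comp_assoc_cochain _ _ _ _ _ (add_zero _),
    ← comp_assoc_cochain _ (Cochain.ofHom (mapBifunctorMap (𝟙 X) g (leftAct A M) (.up ℤ))) _
      (add_zero _) (add_zero _), h₄, sum_comp_cochain, comp_sum_cochain, comp_sum_cochain,
    comp_sum_cochain, Finset.smul_sum, Finset.smul_sum]
  refine Finset.sum_congr rfl fun q _ => ?_
  rw [comp_assoc_cochain _ _ _ _ _ (add_zero _), h₅ p q, tensorCoeff,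
    Cochain.units_smul_comp, smul_smul, ← Int.negOnePow_add]
  congr 1
  rw [comp_assoc_cochain _ _ _ _ _ (show _ = x.1 + x.2 by lia),
    comp_assoc_cochain _ _ _ _ _ (show _ = p + x.2 by lia),
    comp_assoc_cochain _ _ _ _ _ (show _ = p + x.2 by lia),
    comp_assoc_cochain _ _ _ _ _ (show _ = p + q by lia)]
  rfl

theorem coeff_tensorComposite (x y : ℤ × ℤ) {a b m : ℤ} (ha : x.1 + 0 = y.1 + a)
    (hb : x.2 + 0 = y.2 + b) (hm : a + b = m) :
    (decompRightTensor (rightAct A M) (curriedTensor A) Z X Y).coeff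
      (decompLeftTensor (leftAct A M) (curriedTensor A) Z X Y)
      (Cochain.ofHom (tensorComposite Z X Y f g)) x y m (by lia) =
    tensorCoeff Z X Y x y
      ((decompRight (rightAct A M) Z X).coeff (decompLeft (leftAct A M) X Z) (Cochain.ofHom f)
          x.1 y.1 a ha)
      ((decompRight (rightAct A M) Z Y).coeff (decompLeft (leftAct A M) Y Z) (Cochain.ofHom g)
          x.2 y.2 b hb) hm := by
  obtain ⟨p, q⟩ := y
  obtain rfl : a = x.1 - p := by lia
  obtain rfl : b = x.2 - q := by lia
  rw [Decomp.coeff_eq _ _ _ _ _ _ _ (add_zero _), ι_comp_tensorComposite, sum_comp_cochain]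
  simp only [sum_comp_cochain]
  have h₁ : ∀ p' q' : ℤ, p' ≠ p ∨ q' ≠ q → ∀ (N : CochainComplex M ℤ) (c d e : ℤ)
      (w : Cochain N _ c) (h : _ = d) (h' : _ = e),
      (w.comp ((decompLeftTensor (leftAct A M) (curriedTensor A) Z X Y).ι (p', q')) h).comp
        ((decompLeftTensor (leftAct A M) (curriedTensor A) Z X Y).π (p, q)) h' =
        0 := by
    intro p' q' hpq _ _ _ _ w h h'
    refine (decompLeftTensor (leftAct A M) (curriedTensor A) Z X Y).comp_ι_π_ne (p', q') (p, q)
      (fun e => ?_) w _ _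
    rw [Prod.mk.injEq] at e
    lia
  -- If `p` or `q` is outside its support, both sides vanish: no term of the sum hits `(p, q)`, and
  -- a coefficient into a zero summand is zero.
  by_cases hp : p ∈ (decompLeft (leftAct A M) X Z).supp
  · by_cases hq : q ∈ (decompLeft (leftAct A M) Y Z).supp
    · rw [Finset.sum_eq_single_of_mem p hp fun p' _ hp' => Finset.sum_eq_zero fun q' _ =>
          h₁ p' q' (Or.inl hp') _ _ _ _ _ _ _,
        Finset.sum_eq_single_of_mem q hq fun q' _ hq' => h₁ p q' (Or.inr hq') _ _ _ _ _ _ _]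
      subst hm
      exact (decompLeftTensor (leftAct A M) (curriedTensor A) Z X Y).comp_ι_π_self (p, q) _ _ _
    · rw [Finset.sum_eq_zero fun p' _ => Finset.sum_eq_zero fun q' hq' =>
        h₁ p' q' (Or.inr fun e => hq (e ▸ hq')) _ _ _ _ _ _ _,
        show (decompRight (rightAct A M) Z Y).coeff (decompLeft (leftAct A M) Y Z)
          (Cochain.ofHom g) x.2 q (x.2 - q) hb = 0 from Decomp.eq_zero_of_notMem_right _ hq _,
        tensorCoeff_zero_right]
  · rw [Finset.sum_eq_zero fun p' hp' => Finset.sum_eq_zero fun q' _ =>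
        h₁ p' q' (Or.inl fun e => hp (e ▸ hp')) _ _ _ _ _ _ _,
        show (decompRight (rightAct A M) Z X).coeff (decompLeft (leftAct A M) X Z)
          (Cochain.ofHom f) x.1 p (x.1 - p) ha = 0 from Decomp.eq_zero_of_notMem_right _ hp _,
        tensorCoeff_zero_left]

/-- If the sum of two degrees drops, one of them drops, and the corresponding coefficient of `f` or
`g` vanishes. -/
theorem raises_tensorComposite
    (hf : (decompRight (rightAct A M) Z X).Raises (decompLeft (leftAct A M) X Z) 0 (Cochain.ofHom f))
    (hg : (decompRight (rightAct A M) Z Y).Raises (decompLeft (leftAct A M) Y Z) 0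
      (Cochain.ofHom g)) :
    (decompRightTensor (rightAct A M) (curriedTensor A) Z X Y).Raises
      (decompLeftTensor (leftAct A M) (curriedTensor A) Z X Y) 0
      (Cochain.ofHom (tensorComposite Z X Y f g)) := by
  intro x y m h hxy
  rw [coeff_tensorComposite Z X Y f g x y (a := x.1 - y.1) (b := x.2 - y.2) (by lia) (by lia)
    (by lia)]
  by_cases h' : y.1 < x.1
  · rw [hf x.1 y.1 _ _ (by lia), tensorCoeff_zero_left]
  · rw [hg x.2 y.2 _ _ (by lia), tensorCoeff_zero_right]

/-- Distinct pairs with equal sum also force one degree to drop. Hence the leading part is diagonal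
in the pairs, although the filtration only records their sum. -/
theorem coeff_tensorComposite_ne
    (hf : (decompRight (rightAct A M) Z X).Raises (decompLeft (leftAct A M) X Z) 0 (Cochain.ofHom f))
    (hg : (decompRight (rightAct A M) Z Y).Raises (decompLeft (leftAct A M) Y Z) 0
      (Cochain.ofHom g)) (x y : ℤ × ℤ) (hxy : x ≠ y) {m : ℤ}
    (h : x.1 + x.2 + 0 = y.1 + y.2 + m) (hm : m = 0) :
    (decompRightTensor (rightAct A M) (curriedTensor A) Z X Y).coeff
      (decompLeftTensor (leftAct A M) (curriedTensor A) Z X Y)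
      (Cochain.ofHom (tensorComposite Z X Y f g)) x y m h = 0 := by
  rw [coeff_tensorComposite Z X Y f g x y (a := x.1 - y.1) (b := x.2 - y.2) (by lia) (by lia)
    (by lia)]
  by_cases h' : y.1 < x.1
  · rw [hf x.1 y.1 _ _ (by lia), tensorCoeff_zero_left]
  · have h₁ : x.1 = y.1 → x.2 ≠ y.2 := fun h₁ h₂ => hxy (Prod.ext h₁ h₂)
    rw [hg x.2 y.2 _ _ (by lia), tensorCoeff_zero_right]

theorem coeff_tensorComposite_self (x : ℤ × ℤ)
    {φ : mapRight (rightAct A M) Z (X.X x.1) ⟶ mapLeft (leftAct A M) (X.X x.1) Z}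
    {ψ : mapRight (rightAct A M) Z (Y.X x.2) ⟶ mapLeft (leftAct A M) (Y.X x.2) Z}
    (hφ : (decompRight (rightAct A M) Z X).coeff (decompLeft (leftAct A M) X Z) (Cochain.ofHom f)
      x.1 x.1 0 rfl = Cochain.ofHom φ)
    (hψ : (decompRight (rightAct A M) Z Y).coeff (decompLeft (leftAct A M) Y Z) (Cochain.ofHom g)
      x.2 x.2 0 rfl = Cochain.ofHom ψ) :
    (decompRightTensor (rightAct A M) (curriedTensor A) Z X Y).coeff
      (decompLeftTensor (leftAct A M) (curriedTensor A) Z X Y)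
      (Cochain.ofHom (tensorComposite Z X Y f g)) x x 0 rfl =
    Cochain.ofHom ((assocComplexFst (rightAssocIso A M) Z (X.X x.1) (Y.X x.2)).inv ≫
      mapRightHom (rightAct A M) φ (𝟙 (Y.X x.2)) ≫
      (assocComplexSnd (midAssocIso A M) (X.X x.1) Z (Y.X x.2)).hom ≫
      mapLeftHom (leftAct A M) (𝟙 (X.X x.1)) ψ ≫
      (assocComplexThd (MonoidalLeftAction.actionAssocNatIso A M) (X.X x.1) (Y.X x.2) Z).inv) := by
  rw [coeff_tensorComposite Z X Y f g x x rfl rfl (add_zero 0), hφ, hψ, tensorCoeff,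
    mapRightCochain_ofHom, mapLeftCochain_ofHom, ← Cochain.ofHom_comp, ← Cochain.ofHom_comp,
    ← Cochain.ofHom_comp, ← Cochain.ofHom_comp, Int.negOnePow_even _ (Even.add_self _), one_smul]

end Multiplicativity


/-! ### Homotopies under the actions, and complexes concentrated in degree zero. -/

section

variable {C₁ C₂ D : Type*} [Category* C₁] [Category* C₂] [Category* D]
  [Preadditive C₁] [Preadditive C₂] [Preadditive D]
  (F : C₁ ⥤ C₂ ⥤ D) [F.Additive] [∀ X, (F.obj X).Additive]

theorem mapRightHom_eq_map {K K' : CochainComplex C₁ ℤ} (f : K ⟶ K') (X : C₂) :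
    mapRightHom F f (𝟙 X) = ((F.flip.obj X).mapHomologicalComplex (.up ℤ)).map f := by
  ext j
  exact (congrArg (fun z => _ ≫ z) ((F.obj (K'.X j)).map_id X)).trans (comp_id _)

theorem mapLeftHom_eq_map (X : C₁) {K K' : CochainComplex C₂ ℤ} (f : K ⟶ K') :
    mapLeftHom F (𝟙 X) f = ((F.obj X).mapHomologicalComplex (.up ℤ)).map f := by
  ext j
  simp

/-- A homotopy between chain maps induces one between their images under `mapRightHom`. -/
def mapRightHomotopy {K K' : CochainComplex C₁ ℤ} {f g : K ⟶ K'} (h : Homotopy f g) (X : C₂) :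
    Homotopy (mapRightHom F f (𝟙 X)) (mapRightHom F g (𝟙 X)) :=
  (Homotopy.ofEq (mapRightHom_eq_map F f X)).trans
    (((F.flip.obj X).mapHomotopy h).trans (Homotopy.ofEq (mapRightHom_eq_map F g X).symm))

/-- A homotopy between chain maps induces one between their images under `mapLeftHom`. -/
def mapLeftHomotopy (X : C₁) {K K' : CochainComplex C₂ ℤ} {f g : K ⟶ K'} (h : Homotopy f g) :
    Homotopy (mapLeftHom F (𝟙 X) f) (mapLeftHom F (𝟙 X) g) :=
  (Homotopy.ofEq (mapLeftHom_eq_map F X f)).trans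
    (((F.obj X).mapHomotopy h).trans (Homotopy.ofEq (mapLeftHom_eq_map F X g).symm))

variable [HasFiniteBiproducts D] [HasZeroObject C₁] [HasZeroObject C₂]

theorem ιRight_singleRightIsoX_inv (K : CochainComplex C₁ ℤ) [IsBounded K] (X : C₂)
    (a : mapBifunctor K ((single C₂ (.up ℤ) 0).obj X) F (.up ℤ) ⟶ mapRight F K X)
    (ha : ∀ n, a.f n = (singleRightIsoX F K X n).inv) :
    (ιRight F K ((single C₂ (.up ℤ) 0).obj X) 0).comp (Cochain.ofHom a) (add_zero 0) =
      Cochain.ofHom (mapRightHom F (𝟙 K) (singleObjXSelf (.up ℤ) 0 X).hom) := by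
  ext p
  rw [Cochain.comp_zero_cochain_v, Cochain.ofHom_v, Cochain.ofHom_v, ha, Iso.comp_inv_eq]
  simp [ιRight, singleRightIsoX, ← Functor.map_comp_assoc]

theorem singleLeftIsoX_hom_πLeft (X : C₁) (K : CochainComplex C₂ ℤ) [IsBounded K]
    (b : mapLeft F X K ⟶ mapBifunctor ((single C₁ (.up ℤ) 0).obj X) K F (.up ℤ))
    (hb : ∀ n, b.f n = (singleLeftIsoX F X K n).hom) :
    (Cochain.ofHom b).comp ((decompLeft F ((single C₁ (.up ℤ) 0).obj X) K).π 0) (zero_add 0) =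
      Cochain.ofHom (mapLeftHom F (singleObjXSelf (.up ℤ) 0 X).inv (𝟙 K)) := by
  ext p
  rw [Cochain.comp_v _ _ (zero_add 0) p p p (by lia) (by lia), Cochain.ofHom_v, Cochain.ofHom_v,
    hb]
  change (_ ≫ _) ≫ mapBifunctorProj _ _ _ _ _ _ = _
  rw [assoc, ι_mapBifunctorProj_self]
  simp

end

/-! ### Extending a homotopy half-braiding to bounded complexes. -/

section HalfBraiding

variable {A M : Type*} [Category* A] [Category* M] [Preadditive A] [Preadditive M]
  [HasFiniteBiproducts A] [HasFiniteBiproducts M] [MonoidalCategory A] [MonoidalPreadditive A]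
  [MonoidalLeftAction A M] [MonoidalRightAction A M] [StarBimodule A M] [BimodulePreadditive A M]

variable (A) in
/-- A half-braiding up to homotopy for the termwise actions of `A` on the complex `Z`. -/
structure HomotopyHalfBraiding (Z : CochainComplex M ℤ) where
  /-- The component at `X`. -/
  equiv (X : A) : HomotopyEquiv (mapRight (rightAct A M) Z X) (mapLeft (leftAct A M) X Z)
  naturality {X Y : A} (u : X ⟶ Y) : Nonempty (Homotopy
    (mapRightHom (rightAct A M) (𝟙 Z) u ≫ (equiv Y).hom)
    ((equiv X).hom ≫ mapLeftHom (leftAct A M) u (𝟙 Z)))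
  multiplicativity (X Y : A) : Nonempty (Homotopy (equiv (((curriedTensor A).obj X).obj Y)).hom
    ((assocComplexFst (rightAssocIso A M) Z X Y).inv ≫
      mapRightHom (rightAct A M) (equiv X).hom (𝟙 Y) ≫
      (assocComplexSnd (midAssocIso A M) X Z Y).hom ≫
      mapLeftHom (leftAct A M) (𝟙 X) (equiv Y).hom ≫
      (assocComplexThd (MonoidalLeftAction.actionAssocNatIso A M) X Y Z).inv))

namespace HomotopyHalfBraiding

variable {Z : CochainComplex M ℤ} [IsBounded Z] (σ : HomotopyHalfBraiding A Z)

section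

variable (X : CochainComplex A ℤ) [IsBounded X]

/-- The chain map `f : Z ⋆ X ⟶ X ⋆ Z` does not lower the degree in `X` and has the components of
the half-braiding on its diagonal. -/
structure IsFilteredMap
    (f : mapBifunctor Z X (rightAct A M) (.up ℤ) ⟶ mapBifunctor X Z (leftAct A M) (.up ℤ)) :
    Prop where
  raises : (decompRight (rightAct A M) Z X).Raises (decompLeft (leftAct A M) X Z) 0
    (Cochain.ofHom f)
  exists_coeff (i : ℤ) : ∃ g : mapRight (rightAct A M) Z (X.X i) ⟶ mapLeft (leftAct A M) (X.X i) Z,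
    Nonempty (Homotopy g (σ.equiv (X.X i)).hom) ∧
    (decompRight (rightAct A M) Z X).coeff (decompLeft (leftAct A M) X Z) (Cochain.ofHom f)
      i i 0 rfl = Cochain.ofHom g

variable {X}

theorem IsFilteredMap.nonempty_homotopy
    (hV : ∀ X₁ X₂ : A, NegVanish (mapRight (rightAct A M) Z X₁) (mapLeft (leftAct A M) X₂ Z))
    {f f' : mapBifunctor Z X (rightAct A M) (.up ℤ) ⟶ mapBifunctor X Z (leftAct A M) (.up ℤ)}
    (hf : σ.IsFilteredMap X f) (hf' : σ.IsFilteredMap X f') : Nonempty (Homotopy f f') := by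
  refine Decomp.nonempty_homotopy_of_coeff (decompRight_hasEdges _ _ _).filtered
    (decompLeft_hasEdges _ _ _).filtered (fun i j => hV _ _) f f' (hf.raises.sub hf'.raises) ?_
  intro i j hij
  obtain rfl : i = j := by lia
  obtain ⟨g, ⟨h⟩, hg⟩ := hf.exists_coeff i
  obtain ⟨g', ⟨h'⟩, hg'⟩ := hf'.exists_coeff i
  rw [Decomp.coeff_sub, hg, hg', ← nonempty_homotopy_iff]
  exact ⟨h.trans h'.symm⟩

variable (X) in
-- Naturality of the half-braiding at the differentials of `X` is exactly the compatibility with the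
-- edges that the existence principle needs.
theorem exists_isFilteredMap
    (hV : ∀ X₁ X₂ : A, NegVanish (mapRight (rightAct A M) Z X₁) (mapLeft (leftAct A M) X₂ Z)) :
    ∃ f : mapBifunctor Z X (rightAct A M) (.up ℤ) ⟶ mapBifunctor X Z (leftAct A M) (.up ℤ),
      σ.IsFilteredMap X f ∧ ∃ f', Nonempty (Homotopy (f ≫ f') (𝟙 _)) ∧
        Nonempty (Homotopy (f' ≫ f) (𝟙 _)) := by
  have hg : ∀ i : ℤ, Nonempty (Homotopy
      ((σ.equiv (X.X i)).hom ≫ mapLeftHom (leftAct A M) (X.d i (i + 1)) (𝟙 Z))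
      (mapRightHom (rightAct A M) (𝟙 Z) (X.d i (i + 1)) ≫ (σ.equiv (X.X (i + 1))).hom)) :=
    fun i => (σ.naturality (X.d i (i + 1))).map Homotopy.symm
  obtain ⟨f, hf, hf'⟩ := Decomp.exists_hom_of_coeff (decompRight_hasEdges (rightAct A M) Z X)
    (decompLeft_hasEdges (leftAct A M) X Z) (fun i j => hV _ _)
    (fun i => (σ.equiv (X.X i)).hom) hg
  exact ⟨f, ⟨hf, fun i => ⟨_, ⟨Homotopy.refl _⟩, hf' i⟩⟩,
    Decomp.nonempty_homotopyEquiv (decompRight_hasEdges (rightAct A M) Z X)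
      (decompLeft_hasEdges (leftAct A M) X Z) (fun i j => hV _ _) (fun i => σ.equiv (X.X i)) hg f
      hf hf'⟩

/-- Both composites are filtered, and their diagonals are homotopic by naturality of `σ` at the
components `u.f i`, so the uniqueness principle applies. -/
theorem IsFilteredMap.naturality
    (hV : ∀ X₁ X₂ : A, NegVanish (mapRight (rightAct A M) Z X₁) (mapLeft (leftAct A M) X₂ Z))
    {X' : CochainComplex A ℤ} [IsBounded X']
    {f : mapBifunctor Z X (rightAct A M) (.up ℤ) ⟶ mapBifunctor X Z (leftAct A M) (.up ℤ)}
    {f' : mapBifunctor Z X' (rightAct A M) (.up ℤ) ⟶ mapBifunctor X' Z (leftAct A M) (.up ℤ)}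
    (hf : σ.IsFilteredMap X f) (hf' : σ.IsFilteredMap X' f') (u : X ⟶ X') :
    Nonempty (Homotopy (mapBifunctorMap (𝟙 Z) u (rightAct A M) (.up ℤ) ≫ f')
      (f ≫ mapBifunctorMap u (𝟙 Z) (leftAct A M) (.up ℤ))) := by
  have hr := Decomp.raises_of_ι_comp (D := decompRight (rightAct A M) Z X)
    (D' := decompRight (rightAct A M) Z X') (fun i => ιRight_naturality (rightAct A M) (𝟙 Z) u i)
  have hr' := Decomp.coeff_of_ι_comp (D := decompRight (rightAct A M) Z X)
    (D' := decompRight (rightAct A M) Z X') (fun i => ιRight_naturality (rightAct A M) (𝟙 Z) u i)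
  have hl := Decomp.raises_of_ι_comp (D := decompLeft (leftAct A M) X Z)
    (D' := decompLeft (leftAct A M) X' Z) (fun i => ιLeft_naturality (leftAct A M) u (𝟙 Z) i)
  have hl' := Decomp.coeff_of_ι_comp (D := decompLeft (leftAct A M) X Z)
    (D' := decompLeft (leftAct A M) X' Z) (fun i => ιLeft_naturality (leftAct A M) u (𝟙 Z) i)
  refine Decomp.nonempty_homotopy_of_coeff (decompRight_hasEdges _ _ _).filtered
    (decompLeft_hasEdges _ _ _).filtered (fun i j => hV _ _) _ _ ?_ ?_
  · rw [Cochain.ofHom_comp, Cochain.ofHom_comp]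
    exact (hr.comp_zero hf'.raises).sub (hf.raises.comp_zero hl)
  · intro i j hij
    obtain rfl : i = j := by lia
    obtain ⟨g, ⟨h⟩, hg⟩ := hf.exists_coeff i
    obtain ⟨g', ⟨h'⟩, hg'⟩ := hf'.exists_coeff i
    obtain ⟨h''⟩ := σ.naturality (u.f i)
    rw [Decomp.coeff_sub, Cochain.ofHom_comp, Cochain.ofHom_comp,
      Decomp.coeff_comp_self hr hf'.raises, Decomp.coeff_comp_self hf.raises hl, hr', hl', hg, hg',
      ← Cochain.ofHom_comp, ← Cochain.ofHom_comp, ← nonempty_homotopy_iff]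
    exact ⟨(h'.compLeft _).trans (h''.trans (h.symm.compRight _))⟩

/-- Uniqueness is applied to the decomposition by pairs. Leading coefficients at equal pairs agree
up to homotopy by multiplicativity of `σ`; between distinct pairs of equal sum one is null-homotopic
and the other zero. -/
theorem IsFilteredMap.multiplicativity
    (hV : ∀ X₁ X₂ : A, NegVanish (mapRight (rightAct A M) Z X₁) (mapLeft (leftAct A M) X₂ Z))
    {Y : CochainComplex A ℤ} [IsBounded Y]
    {f : mapBifunctor Z X (rightAct A M) (.up ℤ) ⟶ mapBifunctor X Z (leftAct A M) (.up ℤ)}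
    {g : mapBifunctor Z Y (rightAct A M) (.up ℤ) ⟶ mapBifunctor Y Z (leftAct A M) (.up ℤ)}
    {e : mapBifunctor Z (mapBifunctor X Y (curriedTensor A) (.up ℤ)) (rightAct A M) (.up ℤ) ⟶
      mapBifunctor (mapBifunctor X Y (curriedTensor A) (.up ℤ)) Z (leftAct A M) (.up ℤ)}
    (hf : σ.IsFilteredMap X f) (hg : σ.IsFilteredMap Y g) (he : σ.IsFilteredMap _ e) :
    Nonempty (Homotopy e (tensorComposite Z X Y f g)) := by
  refine Decomp.nonempty_homotopy_of_coeff
    (decompRightTensor_filtered (rightAct A M) (curriedTensor A) Z X Y)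
    (decompLeftTensor_filtered (leftAct A M) (curriedTensor A) Z X Y) (fun i j => hV _ _) _ _ ?_ ?_
  · refine Decomp.Raises.sub (fun x y m h hxy => ?_)
      (raises_tensorComposite Z X Y f g hf.raises hg.raises)
    rw [coeff_decompTensor, he.raises _ _ _ _ hxy, Cochain.zero_comp, Cochain.comp_zero]
  · intro x y hxy
    obtain ⟨a, ⟨ha⟩, ha'⟩ := he.exists_coeff (x.1 + x.2)
    -- The target degree `y.1 + y.2` equals `x.1 + x.2` only propositionally, so it is generalised
    -- before the diagonal coefficient `a` is inserted.
    have key : ∀ (k : ℤ) (hk : x.1 + x.2 + 0 = k + 0),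
        ((decompRight (rightAct A M) Z (mapBifunctor X Y (curriedTensor A) (.up ℤ))).coeff
          (decompLeft (leftAct A M) (mapBifunctor X Y (curriedTensor A) (.up ℤ)) Z)
          (Cochain.ofHom e) (x.1 + x.2) k 0 hk).comp
          (Cochain.ofHom (mapLeftHom (leftAct A M)
            (mapBifunctorProj (curriedTensor A) X Y y.1 y.2 k) (𝟙 Z))) (add_zero 0) =
        Cochain.ofHom (a ≫ mapLeftHom (leftAct A M)
            (mapBifunctorProj (curriedTensor A) X Y y.1 y.2 (x.1 + x.2)) (𝟙 Z)) := by
      intro k hk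
      obtain rfl : k = x.1 + x.2 := by lia
      rw [ha', Cochain.ofHom_comp]
    rw [Decomp.coeff_sub, coeff_decompTensor, key, ← Cochain.ofHom_comp]
    obtain ⟨h₁⟩ := σ.naturality (ιMapBifunctor X Y (curriedTensor A) (.up ℤ) x.1 x.2 (x.1 + x.2) rfl)
    -- By naturality of `σ` at the inclusion of `X^{x.1} ⊗ Y^{x.2}`, the coefficient of `e` is
    -- homotopic to the component of `σ` there followed by inclusion and projection, that is, by an
    -- identity or by zero.
    have h₂ := ((ha.compRight (mapLeftHom (leftAct A M)
      (mapBifunctorProj (curriedTensor A) X Y y.1 y.2 (x.1 + x.2)) (𝟙 Z))).compLeft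
      (mapRightHom (rightAct A M) (𝟙 Z)
        (ιMapBifunctor X Y (curriedTensor A) (.up ℤ) x.1 x.2 (x.1 + x.2) rfl))).trans
      ((Homotopy.ofEq (assoc _ _ _).symm).trans ((h₁.compRight (mapLeftHom (leftAct A M)
      (mapBifunctorProj (curriedTensor A) X Y y.1 y.2 (x.1 + x.2)) (𝟙 Z))).trans
      (Homotopy.ofEq (assoc _ _ _))))
    rw [mapLeftHom_comp, id_comp] at h₂
    by_cases h : x = y
    · subst h
      obtain ⟨b, ⟨hb⟩, hb'⟩ := hf.exists_coeff x.1
      obtain ⟨c, ⟨hc⟩, hc'⟩ := hg.exists_coeff x.2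
      obtain ⟨h₃⟩ := σ.multiplicativity (X.X x.1) (Y.X x.2)
      rw [coeff_tensorComposite_self Z X Y f g x hb' hc', ← nonempty_homotopy_iff]
      rw [ι_mapBifunctorProj_self, mapLeftHom_id, comp_id] at h₂
      refine ⟨h₂.trans (h₃.trans (Homotopy.compLeft ?_ _))⟩
      exact ((mapRightHomotopy _ hb.symm _).compRight _).trans (Homotopy.compLeft
        (Homotopy.compLeft ((mapLeftHomotopy _ _ hc.symm).compRight _) _) _)
    · rw [coeff_tensorComposite_ne Z X Y f g hf.raises hg.raises x y h _ rfl,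
        ← Cochain.ofHom_zero, ← nonempty_homotopy_iff]
      have h₄ := ιOrZero_mapBifunctorProj_ne (curriedTensor A) X Y x y (x.1 + x.2) h rfl
      rw [ιMapBifunctorOrZero_eq X Y (curriedTensor A) (.up ℤ) x.1 x.2 (x.1 + x.2) rfl] at h₄
      rw [h₄, mapLeftHom_zero, comp_zero] at h₂
      exact ⟨h₂⟩

end

/-- Only the summand of degree `0` is nonzero, so the sole condition is on that diagonal entry. It
holds by naturality of `σ` at the isomorphism `singleObjXSelf`. -/
theorem isFilteredMap_single [HasZeroObject A] (X : A)
    (a : mapBifunctor Z ((single A (.up ℤ) 0).obj X) (rightAct A M) (.up ℤ) ⟶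
      mapRight (rightAct A M) Z X)
    (ha : ∀ n, a.f n = (singleRightIsoX (rightAct A M) Z X n).inv)
    (b : mapLeft (leftAct A M) X Z ⟶
      mapBifunctor ((single A (.up ℤ) 0).obj X) Z (leftAct A M) (.up ℤ))
    (hb : ∀ n, b.f n = (singleLeftIsoX (leftAct A M) X Z n).hom)
    (g : mapRight (rightAct A M) Z X ⟶ mapLeft (leftAct A M) X Z)
    (hg : Nonempty (Homotopy g (σ.equiv X).hom)) :
    σ.IsFilteredMap ((single A (.up ℤ) 0).obj X) (a ≫ g ≫ b) := by
  have hl : ∀ (i : ℤ) (hi : i ≠ 0) (K : CochainComplex M ℤ) (m : ℤ) (z : Cochain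
      (mapRight (rightAct A M) Z (((single A (.up ℤ) 0).obj X).X i)) K m), z = 0 := by
    intro i hi K m z
    ext p q h
    exact (((rightAct A M).obj _).map_isZero (isZero_single_obj_X _ _ _ _ hi)).eq_of_src _ _
  have hr : ∀ (i : ℤ) (hi : i ≠ 0) (K : CochainComplex M ℤ) (m : ℤ) (z : Cochain K
      (mapLeft (leftAct A M) (((single A (.up ℤ) 0).obj X).X i) Z) m), z = 0 := by
    intro i hi K m z
    ext p q h
    exact (((leftAct A M).map_isZero (isZero_single_obj_X _ _ _ _ hi)).obj _).eq_of_tgt _ _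
  refine ⟨fun i j m h hij => ?_, fun i => ?_⟩
  · by_cases hi : i = 0
    · exact hr j (by lia) _ _ _
    · exact hl i hi _ _ _
  · by_cases hi : i = 0
    · subst hi
      obtain ⟨h⟩ := hg
      obtain ⟨h'⟩ := σ.naturality (singleObjXSelf (.up ℤ) 0 X).hom
      refine ⟨mapRightHom (rightAct A M) (𝟙 Z) (singleObjXSelf (.up ℤ) 0 X).hom ≫ g ≫
        mapLeftHom (leftAct A M) (singleObjXSelf (.up ℤ) 0 X).inv (𝟙 Z), ⟨?_⟩, ?_⟩
      · refine (((h.compRight _).compLeft _).trans (Homotopy.ofEq (assoc _ _ _).symm)).trans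
          ((h'.compRight _).trans (Homotopy.ofEq ?_))
        rw [assoc, mapLeftHom_comp, Iso.hom_inv_id, id_comp, mapLeftHom_id, comp_id]
      · rw [Decomp.coeff_eq (decompRight (rightAct A M) Z ((single A (.up ℤ) 0).obj X)) _ _ _ _ _ _
          (add_zero 0), decompRight_ι, Cochain.ofHom_comp,
          Cochain.ofHom_comp, ← comp_assoc_cochain _ _ _ (add_zero 0) (add_zero 0),
          ιRight_singleRightIsoX_inv _ _ _ _ ha, comp_assoc_cochain _ _ _ _ _ (zero_add 0),
          comp_assoc_cochain _ _ _ _ _ (zero_add 0), singleLeftIsoX_hom_πLeft _ _ _ _ hb,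
          ← Cochain.ofHom_comp, ← Cochain.ofHom_comp]
    · refine ⟨(σ.equiv _).hom, ⟨Homotopy.refl _⟩, ?_⟩
      exact (hl i hi _ _ _).trans (hl i hi _ _ _).symm

end HomotopyHalfBraiding

end HalfBraiding


theorem Kb.quot_map_eq_iff {C : Type*} [Category* C] [Preadditive C] {K L : Chb C} (f g : K ⟶ L) :
    (Kb.quot C).map f = (Kb.quot C).map g ↔ Nonempty (Homotopy f.hom g.hom) :=
  CategoryTheory.Quotient.functor_map_eq_iff _ f g

/-! ### Matrix coefficients in terms of the components of a chain map. -/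

section Components

variable {A M : Type*} [Category* A] [Category* M] [Preadditive A] [Preadditive M]
  [HasFiniteBiproducts M]
  (F : M ⥤ A ⥤ M) (F' : A ⥤ M ⥤ M)
  [F.Additive] [∀ X, (F.obj X).Additive] [F'.Additive] [∀ X, (F'.obj X).Additive]
  {Z : CochainComplex M ℤ} {X : CochainComplex A ℤ} [IsBounded Z] [IsBounded X]
  (f : mapBifunctor Z X F (.up ℤ) ⟶ mapBifunctor X Z F' (.up ℤ))

/-- The sign is the one built into `ιRight`. It accounts for the sign `(-1) ^ (i * j)` in the
definition of a lift. -/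
theorem coeff_v (i i' m : ℤ) (h : i + 0 = i' + m) (j j' n : ℤ) (hj : j + m = j') (hn : j + i = n) :
    ((decompRight F Z X).coeff (decompLeft F' X Z) (Cochain.ofHom f) i i' m h).v j j' hj =
      (i * j).negOnePow • (ιMapBifunctor Z X F (.up ℤ) j i n hn ≫ f.f n ≫
        mapBifunctorProj F' X Z i' j' n) := by
  rw [Decomp.coeff_eq (decompRight F Z X) _ _ _ _ _ _ (add_zero i),
    Cochain.comp_v _ _ _ j n j' hn (by lia), Cochain.comp_zero_cochain_v, Cochain.ofHom_v]
  change (((i * j).negOnePow • ιMapBifunctor Z X F (.up ℤ) j i n hn) ≫ f.f n) ≫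
    mapBifunctorProj F' X Z i' j' n = _
  rw [Linear.units_smul_comp, Linear.units_smul_comp, assoc]

theorem raises_zero_iff :
    (decompRight F Z X).Raises (decompLeft F' X Z) 0 (Cochain.ofHom f) ↔
      ∀ (j i i' j' n : ℤ) (h : j + i = n), i' + j' = n → i' < i →
        ιMapBifunctor Z X F (.up ℤ) j i n h ≫ f.f n ≫ mapBifunctorProj F' X Z i' j' n = 0 := by
  constructor
  · intro hf j i i' j' n h h' hi
    have := coeff_v F F' f i i' (i - i') (by lia) j j' n (by lia) h
    rw [hf _ _ _ _ (by lia), Cochain.zero_v] at this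
    rw [← one_smul ℤˣ (ιMapBifunctor Z X F (.up ℤ) j i n h ≫ _),
      ← Int.units_mul_self (i * j).negOnePow, mul_smul, ← this, smul_zero]
  · intro hf i i' m h hi
    ext j j' hj
    rw [coeff_v F F' f i i' m h j j' (j + i) hj rfl, hf _ _ _ _ _ rfl (by lia) (by lia), smul_zero,
      Cochain.zero_v]

theorem coeff_self_eq_ofHom_iff (i : ℤ) (g : mapRight F Z (X.X i) ⟶ mapLeft F' (X.X i) Z) :
    (decompRight F Z X).coeff (decompLeft F' X Z) (Cochain.ofHom f) i i 0 rfl = Cochain.ofHom g ↔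
      ∀ (j n : ℤ) (h : j + i = n), ιMapBifunctor Z X F (.up ℤ) j i n h ≫ f.f n ≫
        mapBifunctorProj F' X Z i j n = (i * j).negOnePow • g.f j := by
  constructor
  · intro hf j n h
    have := coeff_v F F' f i i 0 rfl j j n (by lia) h
    rw [hf, Cochain.ofHom_v] at this
    rw [this, smul_smul, Int.units_mul_self, one_smul]
  · intro hf
    ext j
    rw [coeff_v F F' f i i 0 rfl j j (j + i) (by lia) rfl, hf, smul_smul, Int.units_mul_self,
      one_smul, Cochain.ofHom_v]

end Components

/-! ### Half-braidings in the homotopy category and their lifts. -/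

section

variable {A M : Type*} [Category* A] [Category* M] [Preadditive A] [Preadditive M]
  [HasFiniteBiproducts A] [HasFiniteBiproducts M] [MonoidalCategory A] [MonoidalPreadditive A]
  [MonoidalLeftAction A M] [MonoidalRightAction A M] [StarBimodule A M] [BimodulePreadditive A M]

namespace RelHalfBraiding

variable {Z : Kb M} (τ : RelHalfBraiding A Z)

/-- A chain map representing a component of a half-braiding. -/
noncomputable def chainHom (X : A) :
    (Chb.map ((rightAct A M).flip.obj X)).obj Z.as ⟶ (Chb.map ((leftAct A M).obj X)).obj Z.as :=
  (Kb.quot M).preimage (τ.β X).hom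

/-- A chain map representing the inverse of a component of a half-braiding. -/
noncomputable def chainInv (X : A) :
    (Chb.map ((leftAct A M).obj X)).obj Z.as ⟶ (Chb.map ((rightAct A M).flip.obj X)).obj Z.as :=
  (Kb.quot M).preimage (τ.β X).inv

theorem quot_map_chainHom (X : A) : (Kb.quot M).map (τ.chainHom X) = (τ.β X).hom :=
  (Kb.quot M).map_preimage _

theorem quot_map_chainInv (X : A) : (Kb.quot M).map (τ.chainInv X) = (τ.β X).inv :=
  (Kb.quot M).map_preimage _

/-- The half-braiding up to homotopy underlying a half-braiding in the homotopy category. -/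
noncomputable def toHomotopyHalfBraiding : HomotopyHalfBraiding A Z.as.obj where
  equiv X :=
    { hom := (τ.chainHom X).hom
      inv := (τ.chainInv X).hom
      homotopyHomInvId := Nonempty.some ((Kb.quot_map_eq_iff (τ.chainHom X ≫ τ.chainInv X)
        (𝟙 _)).1 (by
          rw [Functor.map_comp, quot_map_chainHom, quot_map_chainInv]
          exact (τ.β X).hom_inv_id))
      homotopyInvHomId := Nonempty.some ((Kb.quot_map_eq_iff (τ.chainInv X ≫ τ.chainHom X)
        (𝟙 _)).1 (by
          rw [Functor.map_comp, quot_map_chainHom, quot_map_chainInv]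
          exact (τ.β X).inv_hom_id)) }
  naturality {X Y} u := by
    obtain ⟨h⟩ := (Kb.quot_map_eq_iff
      ((Chb.mapNatTrans ((rightAct A M).flip.map u)).app Z.as ≫ τ.chainHom Y)
      (τ.chainHom X ≫ (Chb.mapNatTrans ((leftAct A M).map u)).app Z.as)).1 (by
        rw [Functor.map_comp, Functor.map_comp, quot_map_chainHom, quot_map_chainHom]
        exact τ.naturality u)
    refine ⟨(Homotopy.ofEq ?_).trans (h.trans (Homotopy.ofEq ?_))⟩
    · refine congrArg (· ≫ (τ.chainHom Y).hom) (?_ : mapRightHom (rightAct A M) (𝟙 Z.as.obj) u =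
        (NatTrans.mapHomologicalComplex ((rightAct A M).flip.map u) (.up ℤ)).app Z.as.obj)
      ext j
      exact (congrArg (· ≫ Z.as.obj.X j ⊴ᵣ u) (congr_app ((rightAct A M).map_id (Z.as.obj.X j))
        X)).trans (id_comp _)
    · refine congrArg ((τ.chainHom X).hom ≫ ·)
        (?_ : (NatTrans.mapHomologicalComplex ((leftAct A M).map u) (.up ℤ)).app Z.as.obj =
          mapLeftHom (leftAct A M) u (𝟙 Z.as.obj))
      ext j
      exact ((congrArg (u ⊵ₗ Z.as.obj.X j ≫ ·) (((leftAct A M).obj Y).map_id (Z.as.obj.X j))).trans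
        (comp_id _)).symm
  multiplicativity X Y := by
    -- The associators are repackaged as morphisms of bounded complexes, so that multiplicativity of
    -- `τ` becomes an equality of two images under the quotient functor.
    let a₁ : (Chb.map ((rightAct A M).flip.obj (X ⊗ Y))).obj Z.as ⟶
        (Chb.map ((rightAct A M).flip.obj Y)).obj ((Chb.map ((rightAct A M).flip.obj X)).obj Z.as) :=
      ObjectProperty.homMk (assocComplexFst (rightAssocIso A M) Z.as.obj X Y).inv
    let a₂ : (Chb.map ((rightAct A M).flip.obj Y)).obj ((Chb.map ((leftAct A M).obj X)).obj Z.as) ⟶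
        (Chb.map ((leftAct A M).obj X)).obj ((Chb.map ((rightAct A M).flip.obj Y)).obj Z.as) :=
      ObjectProperty.homMk (assocComplexSnd (midAssocIso A M) X Z.as.obj Y).hom
    let a₃ : (Chb.map ((leftAct A M).obj X)).obj ((Chb.map ((leftAct A M).obj Y)).obj Z.as) ⟶
        (Chb.map ((leftAct A M).obj (X ⊗ Y))).obj Z.as :=
      ObjectProperty.homMk
        (assocComplexThd (MonoidalLeftAction.actionAssocNatIso A M) X Y Z.as.obj).inv
    obtain ⟨h⟩ := (Kb.quot_map_eq_iff (τ.chainHom (X ⊗ Y))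
      (a₁ ≫ (Chb.map ((rightAct A M).flip.obj Y)).map (τ.chainHom X) ≫ a₂ ≫
        (Chb.map ((leftAct A M).obj X)).map (τ.chainHom Y) ≫ a₃)).1 (by
        have h₁ : (τ.β X).hom ⊵ᵣ Y = (Kb.quot M).map
            ((Chb.map ((rightAct A M).flip.obj Y)).map (τ.chainHom X)) := by
          rw [← quot_map_chainHom]
          rfl
        have h₂ : X ⊴ₗ (τ.β Y).hom = (Kb.quot M).map
            ((Chb.map ((leftAct A M).obj X)).map (τ.chainHom Y)) := by
          rw [← quot_map_chainHom]
          rfl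
        rw [quot_map_chainHom, τ.multiplicativity X Y, h₁, h₂]
        rfl)
    refine ⟨h.trans (Homotopy.ofEq ?_)⟩
    exact congrArg₂ (fun u v => a₁.hom ≫ u ≫ a₂.hom ≫ v ≫ a₃.hom)
      (mapRightHom_eq_map (rightAct A M) _ _).symm (mapLeftHom_eq_map (leftAct A M) _ _).symm

theorem exists_iso (hV : ∀ X₁ X₂ : A, NegVanish (mapRight (rightAct A M) Z.as.obj X₁)
      (mapLeft (leftAct A M) X₂ Z.as.obj)) (X : Kb A) :
    ∃ (f : ((Chb.map₂ (rightAct A M)).obj Z.as).obj X.as ⟶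
      ((Chb.map₂ (leftAct A M)).obj X.as).obj Z.as) (e : Z ⊙ᵣ X ≅ X ⊙ₗ Z),
    (Kb.quot M).map f = e.hom ∧ τ.toHomotopyHalfBraiding.IsFilteredMap X.as.obj f.hom := by
  obtain ⟨f, hf, f', hff', hf'f⟩ := τ.toHomotopyHalfBraiding.exists_isFilteredMap X.as.obj hV
  let F : ((Chb.map₂ (rightAct A M)).obj Z.as).obj X.as ⟶
    ((Chb.map₂ (leftAct A M)).obj X.as).obj Z.as := ObjectProperty.homMk f
  let F' : ((Chb.map₂ (leftAct A M)).obj X.as).obj Z.as ⟶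
    ((Chb.map₂ (rightAct A M)).obj Z.as).obj X.as := ObjectProperty.homMk f'
  exact ⟨F, ⟨(Kb.quot M).map F, (Kb.quot M).map F',
    (Kb.quot_map_eq_iff (F ≫ F') (𝟙 _)).2 hff', (Kb.quot_map_eq_iff (F' ≫ F) (𝟙 _)).2 hf'f⟩,
    rfl, hf⟩

section Lift

variable (f : ∀ X : Kb A, ((Chb.map₂ (rightAct A M)).obj Z.as).obj X.as ⟶
      ((Chb.map₂ (leftAct A M)).obj X.as).obj Z.as)
  (hf : ∀ X : Kb A, τ.toHomotopyHalfBraiding.IsFilteredMap X.as.obj (f X).hom)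
  (e : ∀ X : Kb A, Z ⊙ᵣ X ≅ X ⊙ₗ Z) (he : ∀ X : Kb A, (Kb.quot M).map (f X) = (e X).hom)
  (hV : ∀ X₁ X₂ : A, NegVanish (mapRight (rightAct A M) Z.as.obj X₁)
    (mapLeft (leftAct A M) X₂ Z.as.obj))

/-- The half-braiding over the homotopy category given by filtered chain maps. -/
def ofFilteredMaps : RelHalfBraiding (Kb A) Z where
  β := e
  naturality {X Y} φ := by
    obtain ⟨u, rfl⟩ : ∃ u : X.as ⟶ Y.as, (Kb.quot A).map u = φ := (Kb.quot A).map_surjective φ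
    rw [← he, ← he]
    exact (Kb.quot_map_eq_iff (((Chb.map₂ (rightAct A M)).obj Z.as).map u ≫ f Y)
      (f X ≫ ((Chb.map₂ (leftAct A M)).map u).app Z.as)).2
      ((hf X).naturality τ.toHomotopyHalfBraiding hV (hf Y) u.hom)
  multiplicativity X Y := by
    rw [← he, ← he, ← he]
    have h := (hf X).multiplicativity τ.toHomotopyHalfBraiding hV (hf Y) (hf (X ⊗ Y))
    exact (Kb.quot_map_eq_iff (f (X ⊗ Y))
      ((Chb.assoc (rightAssocIso A M) Z.as X.as Y.as).inv ≫
        ((Chb.map₂ (rightAct A M)).map (f X)).app Y.as ≫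
        (Chb.assoc (midAssocIso A M) X.as Z.as Y.as).hom ≫
        ((Chb.map₂ (leftAct A M)).obj X.as).map (f Y) ≫
        (Chb.assoc (MonoidalLeftAction.actionAssocNatIso A M) X.as Y.as Z.as).inv)).2 h

end Lift

/-- The diagonal entries may be any representatives of `τ`; being one is the same as being homotopic
to the chosen `chainHom`. -/
theorem isFilteredExtension_iff (T : RelHalfBraiding (Kb A) Z) : IsFilteredExtension T τ ↔
    ∀ X : Chb A, ∃ f : ((Chb.map₂ (rightAct A M)).obj Z.as).obj X ⟶
      ((Chb.map₂ (leftAct A M)).obj X).obj Z.as,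
      (Kb.quot M).map f = (T.β ((Kb.quot A).obj X)).hom ∧
      τ.toHomotopyHalfBraiding.IsFilteredMap X.obj f.hom := by
  refine forall_congr' fun X => exists_congr fun f => ?_
  constructor
  · rintro ⟨g, hf, hg, h₁, h₂⟩
    refine ⟨hf, (raises_zero_iff _ _ _).2 h₁, fun i => ⟨(g i).hom, ?_,
      (coeff_self_eq_ofHom_iff (rightAct A M) (leftAct A M) (Z := Z.as.obj) (X := X.obj) f.hom i
        (g i).hom).2 fun j n h => h₂ j i n h⟩⟩
    exact (Kb.quot_map_eq_iff (g i) (τ.chainHom (X.obj.X i))).1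
      ((hg i).trans (τ.quot_map_chainHom _).symm)
  · rintro ⟨hf, h⟩
    choose g hg hg' using h.exists_coeff
    refine ⟨fun i => ObjectProperty.homMk (g i), hf, fun i => ?_,
      (raises_zero_iff _ _ _).1 h.raises,
      fun j i n h => (coeff_self_eq_ofHom_iff _ _ _ i (g i)).1 (hg' i) j n h⟩
    rw [← quot_map_chainHom]
    exact (Kb.quot_map_eq_iff _ (τ.chainHom (X.obj.X i))).2 (hg i)

/-- The first condition on a lift follows from the second: for `X` in degree `0`, `τ_X` transported
along the canonical identifications is itself a filtered map, so it is homotopic to the given one.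
-/
theorem restrictsTo_of_isFilteredMap
    (hV : ∀ X₁ X₂ : A, NegVanish (mapRight (rightAct A M) Z.as.obj X₁)
      (mapLeft (leftAct A M) X₂ Z.as.obj)) (T : RelHalfBraiding (Kb A) Z)
    (hT : IsFilteredExtension T τ) : RestrictsTo T τ := by
  intro X
  obtain ⟨f, hf, hf'⟩ := (τ.isFilteredExtension_iff T).1 hT ((Chb.single A).obj X)
  have h := τ.toHomotopyHalfBraiding.isFilteredMap_single X
    (Chb.singleRightIso (rightAct A M) Z.as X).hom.hom (fun n => rfl)
    (Chb.singleLeftIso (leftAct A M) X Z.as).inv.hom (fun n => rfl) (τ.chainHom X).hom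
    ⟨Homotopy.refl _⟩
  refine hf.symm.trans (((Kb.quot_map_eq_iff f ((Chb.singleRightIso (rightAct A M) Z.as X).hom ≫
    τ.chainHom X ≫ (Chb.singleLeftIso (leftAct A M) X Z.as).inv)).2
    (hf'.nonempty_homotopy _ hV h)).trans ?_)
  rw [← quot_map_chainHom]
  rfl

theorem existsUnique_isLift
    (hV : ∀ X₁ X₂ : A, NegVanish (mapRight (rightAct A M) Z.as.obj X₁)
      (mapLeft (leftAct A M) X₂ Z.as.obj)) : ∃! T : RelHalfBraiding (Kb A) Z, IsLift T τ := by
  choose f e he hf using τ.exists_iso hV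
  have hT : IsFilteredExtension (τ.ofFilteredMaps f hf e he hV) τ :=
    (τ.isFilteredExtension_iff _).2 fun X => ⟨f ((Kb.quot A).obj X), he _, hf _⟩
  refine ⟨τ.ofFilteredMaps f hf e he hV, ⟨τ.restrictsTo_of_isFilteredMap hV _ hT, hT⟩, ?_⟩
  intro T' hT'
  -- A half-braiding is determined by its components, and any two filtered representatives of a
  -- component are homotopic.
  refine RelHalfBraiding.ext (funext fun X => Iso.ext ?_)
  obtain ⟨f', hf', hf''⟩ := (τ.isFilteredExtension_iff T').1 hT'.isFilteredExtension X.as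
  exact hf'.symm.trans (((Kb.quot_map_eq_iff f' (f X)).2
    (hf''.nonempty_homotopy _ hV (hf X))).trans (he X))

end RelHalfBraiding

end

end DrinfeldLifting

theorem mainTheorem1
    (k : Type*) [CommRing k]
    {A : Type*} [Category* A] [Preadditive A] [Linear k A] [HasFiniteBiproducts A]
    [MonoidalCategory A] [MonoidalPreadditive A] [MonoidalLinear k A]
    {M : Type*} [Category* M] [Preadditive M] [Linear k M] [HasFiniteBiproducts M]
    [MonoidalLeftAction A M] [MonoidalRightAction A M] [StarBimodule A M]
    [BimodulePreadditive A M] [BimoduleLinear A M k]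
    (Z : Kb M)
    (hZ : ∀ (X₁ X₂ : A) (n : ℤ), n < 0 →
      IsZero ((CochainComplex.HomComplex (Z ⊙ᵣ X₁).as.obj (X₂ ⊙ₗ Z).as.obj).homology n))
    (τ : RelHalfBraiding A Z) :
    ∃! T : RelHalfBraiding (Kb A) Z, IsLift T τ :=
  -- The termwise actions unfold to `mapRight` and `mapLeft`, so the hypothesis on homology applies
  -- as it stands.
  τ.existsUnique_isLift fun X₁ X₂ => negVanish_of_isZero_homology (hZ X₁ X₂)
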